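/- Let $n\ge 1$, $k\ge 0$, and let $Cl_{n+1}$ be the real Clifford algebra generated by $\mathbb R^{n+1}$ with $x^2=-\|x\|^2$ and orthonormal basis $e_1,\dots,e_{n+1}$; let $\mathbb R^n=\mathrm{span}(e_1,\dots,e_n)$, with variable $u=\sum_{j\le n}u_je_j$. Let $\mathcal M_k$ (resp. $\overline{\mathcal M}_k$) be the space of $Cl_{n+1}$-valued polynomials $p$ on $\mathbb R^n$, homogeneous of degree $k$, which are left monogenic, $\sum_{j\le n}e_j\,\partial p/\partial u_j=0$ (resp. right monogenic, $\sum_{j\le n}(\partial p/\partial u_j)\,e_j=0$), with $\mathcal M_{-1}=\overline{\mathcal M}_{-1}=0$. Let $\mathcal H_k$ be the space of $Cl_{n+1}$-valued harmonic polynomials on $\mathbb R^n$ homogeneous of degree $k$, and let $P_k$ and $P_{k,r}$ be the projections of $\mathcal H_k=\mathcal M_k\oplus u\mathcal M_{k-1}$ onto $\mathcal M_k$ and of $\mathcal H_k=\overline{\mathcal M}_k\oplus\overline{\mathcal M}_{k-1}u$ onto $\overline{\mathcal M}_k$; the latter is written on the right of its argument. Put $(P,Q)_u=\int_{\mathbb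 S^{n-1}}P(u)Q(u)\,ds(u)$. On the unit sphere $\mathbb S^n\subset\mathbb R^{n+1}$ the spherical Dirac operator is $$D_sf=-w\Big(\sum_{1\le i<j\le n+1}e_ie_j\big(w_i\tfrac{\partial f}{\partial w_j}-w_j\tfrac{\partial f}{\partial w_i}\big)+\tfrac n2f\Big),\qquad w\in\mathbb S^n,$$ and it acts from the right by $$gD_s=-\sum_{1\le i<j\le n+1}\big(w_i\tfrac{\partial g}{\partial w_j}-w_j\tfrac{\partial g}{\partial w_i}\big)\,w\,e_ie_j-\tfrac n2\,g\,w .$$ The left and right spherical Rarita–Schwinger operators are $R_k^Sf=P_kD_sf$ and $gR_k^S=gD_sP_{k,r}$, where $D_s$ acts in the variable $x_s\in\mathbb S^n$. Let $U_s\subset\mathbb S^n$ be open, and let $V_s\subset U_s$ be an open subset of $\mathbb S^n$ whose boundary $\partial V_s$ is contained in $U_s$ and is a $C^1$ hypersurface, with $V_s$ locally on one side of it. Let $n(x_s)$ be the unit vector tangent to $\mathbb S^n$ at $x_s\in\partial V_s$, orthogonal to $\partial V_s$ and pointing out of $V_s$, let $dS$ be the $n$-dimensional area measure of $\mathbb S^n$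 and $d\Sigma$ the $(n-1)$-dimensional surface measure on $\partial V_s$. Let $f,g:U_s\times\mathbb R^n\to Cl_{n+1}$ be $C^1$ with $f(x_s,\cdot)\in\mathcal M_k$ and $g(x_s,\cdot)\in\overline{\mathcal M}_k$ for every $x_s\in U_s$. Then all three outer integrands below are integrable, and $$\int_{V_s}\Big((gR_k^S,f)_u+(g,R_k^Sf)_u\Big)dS(x_s)=\int_{\partial V_s}\big(g,P_k\,n(x_s)f\big)_u\,d\Sigma(x_s)=\int_{\partial V_s}\big(g\,n(x_s)P_{k,r},f\big)_u\,d\Sigma(x_s).$$ -/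

import Mathlib

open MeasureTheory
open scoped Manifold ContDiff

noncomputable section

namespace RS

/-- Euclidean space `ℝᵐ`. -/
abbrev E (m : ℕ) : Type := EuclideanSpace ℝ (Fin m)

/-- The unit sphere `𝕊ⁿ ⊆ ℝⁿ⁺¹`. -/
abbrev S (n : ℕ) : Type := Metric.sphere (0 : E (n + 1)) 1

/-! ### The Clifford algebra `Cl_{n+1}` -/

/-- The quadratic form `x ↦ -‖x‖²` on `ℝⁿ⁺¹`. -/
def negQ (n : ℕ) : QuadraticForm ℝ (E (n + 1)) :=
  -LinearMap.BilinMap.toQuadraticMap (innerₗ (E (n + 1)))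

theorem negQ_apply (n : ℕ) (x : E (n + 1)) : negQ n x = -‖x‖ ^ 2 := by
  simp [negQ]

/-- The Clifford algebra `Cl_{n+1}`, generated by `ℝⁿ⁺¹` with `x² = -‖x‖²`. -/
abbrev Cl (n : ℕ) : Type := CliffordAlgebra (negQ n)

/-- The inclusion `ℝⁿ⁺¹ ⊆ Cl_{n+1}`. -/
def vec (n : ℕ) : E (n + 1) →ₗ[ℝ] Cl n := CliffordAlgebra.ι (negQ n)

theorem vec_mul_self (n : ℕ) (x : E (n + 1)) :
    vec n x * vec n x = algebraMap ℝ (Cl n) (-‖x‖ ^ 2) := by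
  rw [vec, CliffordAlgebra.ι_sq_scalar, negQ_apply]

/-- The standard generators `e₁, …, e_{n+1}` (indexed from `0`). -/
def e (n : ℕ) (i : Fin (n + 1)) : Cl n := vec n (EuclideanSpace.single i 1)

/-- The coordinates of an element of `Cl_{n+1}` in a basis indexed by the subsets of
`{1, …, n+1}`. -/
def coords (n : ℕ) : Cl n ≃ₗ[ℝ] EuclideanSpace ℝ (Finset (Fin (n + 1))) :=
  (CliffordAlgebra.equivExterior (negQ n)).trans
    ((((EuclideanSpace.basisFun (Fin (n + 1)) ℝ).toBasis.ExteriorAlgebra).equivFun).trans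
      (WithLp.linearEquiv 2 ℝ (Finset (Fin (n + 1)) → ℝ)).symm)

/-- The norm of `Cl_{n+1}`. The space is finite-dimensional, so that differentiability and
integrals of `Cl_{n+1}`-valued functions do not depend on the choice of the norm. -/
instance instNormedAddCommGroupCl (n : ℕ) : NormedAddCommGroup (Cl n) :=
  NormedAddCommGroup.induced (Cl n) _ (coords n).toLinearMap (coords n).injective

instance instNormedSpaceCl (n : ℕ) : NormedSpace ℝ (Cl n) :=
  NormedSpace.induced ℝ (Cl n) _ (coords n).toLinearMap

instance instFiniteDimensionalCl (n : ℕ) : FiniteDimensional ℝ (Cl n) :=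
  (coords n).symm.finiteDimensional

/-- The vector variable `u = u₁e₁ + ⋯ + uₙeₙ ∈ ℝⁿ`, as an element of `Cl_{n+1}`. -/
def uvec (n : ℕ) (u : E n) : Cl n := ∑ j : Fin n, u j • e n j.castSucc

/-! ### Monogenic polynomials on `ℝⁿ` and the Almansi–Fischer projections -/

/-- `p` is a `Cl_{n+1}`-valued polynomial in `u ∈ ℝⁿ`, homogeneous of degree `k`. -/
def IsHomPoly (n k : ℕ) (p : E n → Cl n) : Prop :=
  ∃ c : (Fin n → ℕ) → Cl n, ∀ u : E n,
    p u = ∑ α ∈ Finset.Nat.antidiagonalTuple n k, (∏ j, u j ^ α j) • c α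

/-- The Euclidean Dirac operator `D = ∑ eⱼ ∂/∂uⱼ` of `ℝⁿ`, acting from the left. -/
def dirac (n : ℕ) (p : E n → Cl n) (u : E n) : Cl n :=
  ∑ j : Fin n, e n j.castSucc * fderiv ℝ p u (EuclideanSpace.single j 1)

/-- The Euclidean Dirac operator of `ℝⁿ`, acting from the right. -/
def diracRight (n : ℕ) (p : E n → Cl n) (u : E n) : Cl n :=
  ∑ j : Fin n, fderiv ℝ p u (EuclideanSpace.single j 1) * e n j.castSucc

/-- `𝓜ₖ`: left monogenic polynomials, homogeneous of degree `k`. -/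
def leftMonogenic (n k : ℕ) : Set (E n → Cl n) :=
  {p | IsHomPoly n k p ∧ ∀ u, dirac n p u = 0}

/-- `𝓜̄ₖ`: right monogenic polynomials, homogeneous of degree `k`. -/
def rightMonogenic (n k : ℕ) : Set (E n → Cl n) :=
  {p | IsHomPoly n k p ∧ ∀ u, diracRight n p u = 0}

/-- `u 𝓜ₖ₋₁`, which is zero for `k = 0`. -/
def leftRest (n : ℕ) : ℕ → Set (E n → Cl n)
  | 0 => {0}
  | k + 1 => {r | ∃ q ∈ leftMonogenic n k, ∀ u, r u = uvec n u * q u}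

/-- `𝓜̄ₖ₋₁ u`, which is zero for `k = 0`. -/
def rightRest (n : ℕ) : ℕ → Set (E n → Cl n)
  | 0 => {0}
  | k + 1 => {r | ∃ q ∈ rightMonogenic n k, ∀ u, r u = q u * uvec n u}

open Classical in
/-- The left projection `Pₖ : 𝓗ₖ = 𝓜ₖ ⊕ u 𝓜ₖ₋₁ → 𝓜ₖ` (with the value `0` outside `𝓗ₖ`). -/
def leftProj (n k : ℕ) (h : E n → Cl n) : E n → Cl n :=
  if H : ∃ p ∈ leftMonogenic n k, h - p ∈ leftRest n k then H.choose else 0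

open Classical in
/-- The right projection `Pₖ,ᵣ : 𝓗ₖ = 𝓜̄ₖ ⊕ 𝓜̄ₖ₋₁ u → 𝓜̄ₖ` (with the value `0` outside `𝓗ₖ`). -/
def rightProj (n k : ℕ) (h : E n → Cl n) : E n → Cl n :=
  if H : ∃ p ∈ rightMonogenic n k, h - p ∈ rightRest n k then H.choose else 0

/-- The pairing `(P, Q)_u = ∫_{𝕊ⁿ⁻¹} P(u) Q(u) ds(u)`. -/
def pairing (n : ℕ) (P Q : E n → Cl n) : Cl n :=
  ∫ u : Metric.sphere (0 : E n) 1, P u * Q u ∂(volume : Measure (E n)).toSphere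

/-! ### The spherical Dirac and Rarita–Schwinger operators -/

/-- The extension of a function on `𝕊ⁿ` to `ℝⁿ⁺¹ ∖ {0}` that is constant along rays. -/
def radialExt (n : ℕ) (F : S n → Cl n) (x : E (n + 1)) : Cl n :=
  if h : x = 0 then 0 else F ⟨‖x‖⁻¹ • x, by
    rw [mem_sphere_zero_iff_norm, norm_smul, norm_inv, norm_norm,
      inv_mul_cancel₀ (norm_ne_zero_iff.mpr h)]⟩

/-- The angular derivative `wᵢ ∂/∂wⱼ - wⱼ ∂/∂wᵢ` of a function on `𝕊ⁿ`. It is tangential, so that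
any extension to a neighbourhood in `ℝⁿ⁺¹` gives the same value. -/
def angular (n : ℕ) (i j : Fin (n + 1)) (F : S n → Cl n) (w : S n) : Cl n :=
  (w : E (n + 1)) i • fderiv ℝ (radialExt n F) w (EuclideanSpace.single j 1) -
    (w : E (n + 1)) j • fderiv ℝ (radialExt n F) w (EuclideanSpace.single i 1)

/-- The spherical Dirac operator `D_s = -w (Λ + n/2) = w⁻¹ (Λ + n/2)`, where
`Λ = ∑_{i < j} eᵢ eⱼ (wᵢ ∂/∂wⱼ - wⱼ ∂/∂wᵢ)`. Its principal part is the tangential part of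
`∑ eᵢ ∂/∂wᵢ`. -/
def sphDirac (n : ℕ) (F : S n → Cl n) (w : S n) : Cl n :=
  -(vec n w * ((∑ i : Fin (n + 1), ∑ j ∈ Finset.Ioi i, e n i * e n j * angular n i j F w) +
    ((n : ℝ) / 2) • F w))

/-- The spherical Dirac operator acting from the right: the same Clifford coefficients
`-w eᵢ eⱼ` and `-(n/2) w` multiply from the right. -/
def sphDiracRight (n : ℕ) (F : S n → Cl n) (w : S n) : Cl n :=
  -((∑ i : Fin (n + 1), ∑ j ∈ Finset.Ioi i, angular n i j F w * (vec n w * (e n i * e n j))) +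
    ((n : ℝ) / 2) • (F w * vec n w))

/-- The left spherical Rarita–Schwinger operator `Rₖˢ f = Pₖ D_s f`. -/
def raritaSchwinger (n k : ℕ) (f : S n → E n → Cl n) (x : S n) : E n → Cl n :=
  leftProj n k fun u => sphDirac n (fun y => f y u) x

/-- The right spherical Rarita–Schwinger operator `g Rₖˢ = g D_s Pₖ,ᵣ`. -/
def raritaSchwingerRight (n k : ℕ) (g : S n → E n → Cl n) (x : S n) : E n → Cl n :=
  rightProj n k fun u => sphDiracRight n (fun y => g y u) x

/-! ### Domains in the sphere with `C¹` boundary -/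

/-- The component of the gradient of `ρ` at `p ∈ 𝕊ⁿ` that is tangent to the sphere. -/
def tangGrad (n : ℕ) (ρ : E (n + 1) → ℝ) (p : S n) : E (n + 1) :=
  gradient ρ (p : E (n + 1)) -
    (inner ℝ (p : E (n + 1)) (gradient ρ (p : E (n + 1)))) • (p : E (n + 1))

/-- `ρ` is a `C¹` local defining function of `V` at the boundary point `p`: near `p` the set `V`
is `{ρ < 0}`, and `ρ` vanishes at `p` with a non-zero tangential gradient. -/
structure IsDefiningFunction (n : ℕ) (V : Set (S n)) (p : S n) (ρ : E (n + 1) → ℝ) : Prop where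
  contDiffAt : ContDiffAt ℝ 1 ρ p
  eq_zero : ρ p = 0
  tangGrad_ne_zero : tangGrad n ρ p ≠ 0
  mem_iff : ∀ᶠ x : S n in nhds p, x ∈ V ↔ ρ x < 0

/-- The boundary of `V` is a `C¹` hypersurface of `𝕊ⁿ` that bounds `V`, with `V` locally on
one side of it. -/
def HasC1Boundary (n : ℕ) (V : Set (S n)) : Prop :=
  ∀ p ∈ frontier V, ∃ ρ : E (n + 1) → ℝ, IsDefiningFunction n V p ρ

open Classical in
/-- The outward unit normal of `V` at a boundary point `p`: tangent to the sphere and orthogonal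
to the boundary. It does not depend on the defining function. -/
def outerNormal (n : ℕ) (V : Set (S n)) (p : S n) : E (n + 1) :=
  if h : ∃ ρ : E (n + 1) → ℝ, IsDefiningFunction n V p ρ then
    ‖tangGrad n h.choose p‖⁻¹ • tangGrad n h.choose p
  else 0

/-- The `n`-dimensional area measure `dS` of `𝕊ⁿ`. -/
def areaMeasure (n : ℕ) : Measure (S n) := (volume : Measure (E (n + 1))).toSphere

/-- The `(n-1)`-dimensional measure `dΣ` of hypersurfaces of `𝕊ⁿ`: the Hausdorff measure,
normalized so that it is Lebesgue measure on `ℝⁿ⁻¹`. -/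
def hypersurfaceMeasure (n : ℕ) : Measure (S n) := Measure.euclideanHausdorffMeasure (n - 1)

end RS

end

/-! The projections disappear from the pairings. If `g` is right monogenic and `q` left monogenic,
the integral of `g u q` over the unit sphere of `ℝⁿ` vanishes (`integral_mul_uvec_mul_eq_zero`), so
pairing with `g` does not see the component in `u 𝓜ₖ₋₁`, and symmetrically on the right
(`pairing_leftProj`, `pairing_rightProj`). This applies because a vector times a monogenic
polynomial always splits (`leftSplit_vec_mul`), and `D_s f` and `n(x_s) f` are sums of such
products. Hence both boundary pairings equal the integral of `g n f` over `u`. What remains is, for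
each fixed `u`, the Stokes formula `∫_V ((g D_s) f + g (D_s f)) = ∫_∂V g n f`, followed by Fubini
over compact sets.

For the Stokes formula (`integral_sphDirac`), extend functions to be constant along rays. Then `D_s
F = ∑ eⱼ ∂ⱼF - (n/2) w F`, similarly on the right, and the integrand over `V` is the sum over `j` of
`∂ⱼ(‖x‖⁻ⁿ g eⱼ f)`. Everything reduces to `∫_V ∂_v φ = ∫_∂V ⟨v, ν⟩ φ` for `φ` homogeneous of degree
`-n` (`integral_fderiv_eq`). The degree is the one for which `∂_v φ` on the sphere is the tangential
divergence of `φ` times the tangential part of `v`.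

For that divergence theorem it suffices, when `φ ≥ 0`, to have near each point an error at most `δ
∫_∂V φ` (`LocalEstimate`): such errors add up to `δ ∫_∂V φ` under a partition of unity, and `δ` is
arbitrary. At a boundary point, gnomonic projection to the tangent plane turns the integral over the
sphere into a flat one, and `V` into the subgraph of a function of small slope. There the derivative
along the normal axis is integrated exactly by the fundamental theorem of calculus. The derivatives
along the base contribute at most a multiple of the slope, by a translation argument. The graph is
an almost isometric image of a ball, which controls its Hausdorff measure, and the normal is almost
constant. Signed `φ` are handled by adding a multiple of `‖x‖⁻ⁿ`, and vector values by linear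
functionals. -/

noncomputable section

open MeasureTheory Set Metric Module Filter Topology
open scoped NNReal ENNReal Manifold ContDiff

set_option linter.unusedSectionVars false

/-! ### Polar coordinates -/

section Polar

variable {N F : Type*} [NormedAddCommGroup N] [NormedSpace ℝ N] [MeasurableSpace N] [BorelSpace N]
  [FiniteDimensional ℝ N] [Nontrivial N] [NormedAddCommGroup F] [NormedSpace ℝ F]

theorem integral_volumeIoiPow (d : ℕ) (f : ℝ → F) :
    ∫ r : Ioi (0 : ℝ), f r ∂Measure.volumeIoiPow d = ∫ r in Ioi (0 : ℝ), r ^ d • f r := by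
  simp only [Measure.volumeIoiPow, ENNReal.ofReal]
  rw [integral_withDensity_eq_integral_smul
      (measurable_subtype_coe.pow_const _).real_toNNReal,
    integral_subtype_comap measurableSet_Ioi fun a ↦ Real.toNNReal (a ^ d) • f a]
  refine setIntegral_congr_fun measurableSet_Ioi fun x hx ↦ ?_
  simp only [NNReal.smul_def]
  rw [Real.coe_toNNReal _ (pow_nonneg (mem_Ioi.1 hx).le _)]

/-- The origin is a null set, and off it the measure is the product of `toSphere` and `r ^ (d - 1)
dr`, so Fubini applies. -/
theorem integral_polar (μ : Measure N) [μ.IsAddHaarMeasure] {f : N → F} (hf : Integrable f μ) :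
    ∫ x, f x ∂μ = ∫ w : sphere (0 : N) 1,
      (∫ r in Ioi (0 : ℝ), r ^ (finrank ℝ N - 1) • f (r • (w : N))) ∂μ.toSphere := by
  have hmp := μ.measurePreserving_homeomorphUnitSphereProd
  have hemb := (homeomorphUnitSphereProd N).measurableEmbedding
  let g : sphere (0 : N) 1 × Ioi (0 : ℝ) → F := fun q => f ((q.2 : ℝ) • (q.1 : N))
  have hg : g ∘ homeomorphUnitSphereProd N = fun x : ({0}ᶜ : Set N) => f x := by
    funext x
    have hx : ‖(x : N)‖ ≠ 0 := norm_ne_zero_iff.2 x.2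
    simp [g, smul_smul, hx]
  have hint : Integrable g (μ.toSphere.prod (Measure.volumeIoiPow (finrank ℝ N - 1))) := by
    rw [← hmp.integrable_comp_emb hemb, hg]
    have : IntegrableOn f ({0}ᶜ : Set N) μ := hf.integrableOn
    exact (integrableOn_iff_comap_subtypeVal (measurableSet_singleton _).compl).1 this
  calc ∫ x, f x ∂μ = ∫ x in ({0}ᶜ : Set N), f x ∂μ := by rw [restrict_compl_singleton]
    _ = ∫ x : ({0}ᶜ : Set N), f x ∂μ.comap (↑) :=
        (integral_subtype_comap (measurableSet_singleton _).compl f).symm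
    _ = ∫ x, (g ∘ homeomorphUnitSphereProd N) x ∂μ.comap (↑) := by rw [hg]
    _ = ∫ q, g q ∂μ.toSphere.prod (Measure.volumeIoiPow (finrank ℝ N - 1)) :=
        hmp.integral_comp hemb g
    _ = _ := by
        rw [integral_prod _ hint]
        refine integral_congr_ae (Eventually.of_forall fun w => ?_)
        exact integral_volumeIoiPow _ (fun r => f (r • (w : N)))

end Polar

/-! ### Integration over the sphere in gnomonic coordinates -/

section Gnomonic

variable {N W : Type*} [NormedAddCommGroup N] [InnerProductSpace ℝ N] [MeasurableSpace N]
  [BorelSpace N] [FiniteDimensional ℝ N] [NormedAddCommGroup W] [InnerProductSpace ℝ W]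
  [MeasurableSpace W] [BorelSpace W] [FiniteDimensional ℝ W]

/-- An orthonormal splitting of `N` into a line, a subspace modelled on `W`, and a line. -/
abbrev Splitting (N W : Type*) [NormedAddCommGroup N] [InnerProductSpace ℝ N]
    [NormedAddCommGroup W] [InnerProductSpace ℝ W] : Type _ :=
  WithLp 2 (ℝ × WithLp 2 (W × ℝ)) ≃ₗᵢ[ℝ] N

namespace Splitting

/-- The point of `N` with coordinates `(s, y, t)`. -/
def point (T : Splitting N W) (s : ℝ) (z : W × ℝ) : N := T (WithLp.toLp 2 (s, WithLp.toLp 2 z))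

/-- The first axis of a splitting. -/
def pole (T : Splitting N W) : N := T.point 1 0

/-- The last axis of a splitting. -/
def axis (T : Splitting N W) : N := T.point 0 (0, 1)

theorem norm_point_sq (T : Splitting N W) (s : ℝ) (z : W × ℝ) :
    ‖T.point s z‖ ^ 2 = s ^ 2 + (‖z.1‖ ^ 2 + z.2 ^ 2) := by
  simp [point, WithLp.prod_norm_sq_eq_of_L2]

theorem inner_point (T : Splitting N W) (s s' : ℝ) (z z' : W × ℝ) :
    inner ℝ (T.point s z) (T.point s' z') = s * s' + (inner ℝ z.1 z'.1 + z.2 * z'.2) := by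
  simp [point, LinearIsometryEquiv.inner_map_map, WithLp.prod_inner_apply, mul_comm]

theorem point_smul (T : Splitting N W) (c s : ℝ) (z : W × ℝ) :
    T.point (c * s) (c • z) = c • T.point s z := by
  unfold point
  rw [← map_smul]; rfl

theorem point_add (T : Splitting N W) (s s' : ℝ) (z z' : W × ℝ) :
    T.point (s + s') (z + z') = T.point s z + T.point s' z' := by
  unfold point
  rw [← map_add]; rfl

theorem exists_point (T : Splitting N W) (x : N) : ∃ s z, T.point s z = x :=
  ⟨(T.symm x).ofLp.1, (T.symm x).ofLp.2.ofLp, T.apply_symm_apply x⟩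

theorem norm_pole (T : Splitting N W) : ‖T.pole‖ = 1 := by
  have := T.norm_point_sq 1 0
  simp at this
  rcases this with h | h
  · exact h
  · have := norm_nonneg (T.point 1 0)
    linarith

theorem inner_pole (T : Splitting N W) (s : ℝ) (z : W × ℝ) :
    inner ℝ T.pole (T.point s z) = s := by
  simp [pole, inner_point]

theorem finrank_eq (T : Splitting N W) : finrank ℝ N = finrank ℝ W + 2 := by
  rw [← T.toLinearEquiv.finrank_eq, (WithLp.linearEquiv 2 ℝ _).finrank_eq, finrank_prod,
    (WithLp.linearEquiv 2 ℝ _).finrank_eq, finrank_prod]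
  simp; ring

theorem measurePreserving_point (T : Splitting N W) :
    MeasurePreserving (fun q : ℝ × (W × ℝ) => T.point q.1 q.2) := by
  have h1 : MeasurePreserving (fun q : ℝ × (W × ℝ) => ((q.1, WithLp.toLp 2 q.2) : ℝ × WithLp 2 (W × ℝ))) :=
    (MeasurePreserving.id volume).prod (WithLp.volume_preserving_toLp W ℝ)
  exact T.measurePreserving.comp ((WithLp.volume_preserving_toLp ℝ (WithLp 2 (W × ℝ))).comp h1)

theorem measurableEmbedding_point (T : Splitting N W) :
    MeasurableEmbedding (fun q : ℝ × (W × ℝ) => T.point q.1 q.2) := by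
  have h1 : MeasurableEmbedding (fun q : ℝ × (W × ℝ) => ((q.1, WithLp.toLp 2 q.2) : ℝ × WithLp 2 (W × ℝ))) :=
    MeasurableEmbedding.id.prodMap (MeasurableEquiv.toLp 2 (W × ℝ)).measurableEmbedding
  exact T.toHomeomorph.measurableEmbedding.comp
    ((MeasurableEquiv.toLp 2 (ℝ × WithLp 2 (W × ℝ))).measurableEmbedding.comp h1)

/-- Scale invariance of `dr / r`: the slab `1 < r c < 2` has the same mass on every ray that meets
it, whatever the slope `c`. -/
theorem integral_inv_window {c : ℝ} (hc : 0 < c) :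
    ∫ r in Ioi (0 : ℝ), r⁻¹ * (Ioo (1 : ℝ) 2).indicator 1 (r * c) = Real.log 2 := by
  have h1 : ∀ r ∈ Ioi (0 : ℝ), r⁻¹ * (Ioo (1 : ℝ) 2).indicator 1 (r * c)
      = (Ioo (1 / c) (2 / c)).indicator (fun r => r⁻¹) r := by
    intro r _
    simp only [indicator, mem_Ioo, div_lt_iff₀ hc, lt_div_iff₀ hc]
    split_ifs <;> simp
  rw [setIntegral_congr_fun measurableSet_Ioi h1, setIntegral_indicator measurableSet_Ioo]
  have h2 : Ioi (0 : ℝ) ∩ Ioo (1 / c) (2 / c) = Ioo (1 / c) (2 / c) :=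
    inter_eq_right.2 fun r hr => lt_trans (by positivity) hr.1
  rw [h2, ← integral_Ioc_eq_integral_Ioo, ← intervalIntegral.integral_of_le (by gcongr; norm_num),
    integral_inv_of_pos (by positivity) (by positivity)]
  congr 1
  field_simp

/-- Integration over the sphere in gnomonic coordinates. -/
theorem integral_sphere_eq (T : Splitting N W) {H : N → ℝ} (hm : Measurable H)
    (hhom : ∀ r : ℝ, 0 < r → ∀ x, H (r • x) = (r ^ finrank ℝ N)⁻¹ * H x)
    {C c : ℝ} (hc : 0 < c) (hC : ∀ x, ‖x‖ = 1 → |H x| ≤ C)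
    (hsupp : ∀ x, H x ≠ 0 → c * ‖x‖ ≤ inner ℝ T.pole x) :
    ∫ w : sphere (0 : N) 1, H w ∂(volume : Measure N).toSphere = ∫ z, H (T.point 1 z) := by
  have hnt : Nontrivial N := by
    refine ⟨T.pole, 0, fun h => ?_⟩
    have := T.norm_pole
    rw [h] at this; simp at this
  have hd : finrank ℝ N = finrank ℝ W + 2 := T.finrank_eq
  -- The window `1 < ⟨pole, x⟩ < 2` makes the homogeneous function integrable, and the integral of
  -- `G` is computed twice. In polar coordinates the Jacobian and the degree of `H` leave `dr / r`,
  -- so each ray contributes `log 2 * H w`. Slicing along the pole, the slice at height `s`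
  -- contributes `s⁻¹` times the slice at height 1, again with total factor `log 2`.
  set G : N → ℝ := fun x => (Ioo (1 : ℝ) 2).indicator 1 (inner ℝ T.pole x) * H x with hG
  have hGm : Measurable G := by
    refine Measurable.mul ?_ hm
    exact (measurable_one.indicator measurableSet_Ioo).comp (by fun_prop)
  have hC0 : 0 ≤ C := (abs_nonneg _).trans (hC _ T.norm_pole)
  -- On the support of `G`, `hsupp` gives `‖x‖ ≤ 2 / c`, while `‖x‖ ≥ ⟨pole, x⟩ > 1` makes the
  -- homogeneity factor at most 1.
  have hGb : ∀ x, ‖G x‖ ≤ (ball (0 : N) (2 / c + 1)).indicator (fun _ => C) x := by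
    intro x
    by_cases h : inner ℝ T.pole x ∈ Ioo (1 : ℝ) 2 ∧ H x ≠ 0
    · obtain ⟨hx, hH⟩ := h
      have h1 := hsupp x hH
      have hxb : ‖x‖ < 2 / c + 1 := by
        have : ‖x‖ ≤ 2 / c := by
          rw [le_div_iff₀ hc]; nlinarith [hx.2]
        linarith
      have hx1 : 1 ≤ ‖x‖ := by
        have := real_inner_le_norm T.pole x
        rw [T.norm_pole, one_mul] at this
        linarith [hx.1]
      rw [indicator_of_mem (by simpa using hxb)]
      have hx0 : 0 < ‖x‖ := by linarith
      have h2 := hhom ‖x‖ hx0 (‖x‖⁻¹ • x)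
      rw [smul_smul, mul_inv_cancel₀ hx0.ne', one_smul] at h2
      simp only [hG, indicator_of_mem hx, Pi.one_apply, one_mul, Real.norm_eq_abs]
      rw [h2, abs_mul]
      have h3 : |H (‖x‖⁻¹ • x)| ≤ C := hC _ (by rw [norm_smul, norm_inv, norm_norm]; field_simp)
      have h4 : |(‖x‖ ^ finrank ℝ N)⁻¹| ≤ 1 := by
        rw [abs_of_nonneg (by positivity)]
        exact inv_le_one_of_one_le₀ (one_le_pow₀ hx1)
      calc _ ≤ 1 * C := by gcongr
        _ = C := one_mul C
    · have : G x = 0 := by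
        simp only [hG]
        by_cases h1 : inner ℝ T.pole x ∈ Ioo (1 : ℝ) 2
        · have : H x = 0 := by by_contra h2; exact h ⟨h1, h2⟩
          simp [this]
        · simp [indicator_of_notMem h1]
      rw [this, norm_zero]
      exact indicator_nonneg (fun _ _ => hC0) _
  have hGi : Integrable G := by
    refine Integrable.mono' (g := (ball (0 : N) (2 / c + 1)).indicator fun _ => C) ?_
      hGm.aestronglyMeasurable (Eventually.of_forall hGb)
    rw [integrable_indicator_iff measurableSet_ball]
    exact integrableOn_const measure_ball_lt_top.ne
  have hlog : Real.log 2 ≠ 0 := (Real.log_pos (by norm_num)).ne'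
  have e1 : ∫ x, G x = Real.log 2 * ∫ w : sphere (0 : N) 1, H w ∂(volume : Measure N).toSphere := by
    rw [integral_polar volume hGi, ← integral_const_mul]
    refine integral_congr_ae (Eventually.of_forall fun w => ?_)
    simp only
    by_cases hw : H w = 0
    · rw [hw, mul_zero]
      refine (setIntegral_congr_fun measurableSet_Ioi fun r hr => ?_).trans (integral_zero _ _)
      simp [hG, hhom r hr, hw]
    · have hpos : 0 < inner ℝ T.pole (w : N) := by
        have := hsupp w hw
        rw [norm_eq_of_mem_sphere] at this
        linarith
      rw [← integral_inv_window hpos, ← integral_mul_const]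
      refine setIntegral_congr_fun measurableSet_Ioi fun r hr => ?_
      have hr : 0 < r := hr
      simp only [hG, hhom r hr, inner_smul_right, smul_eq_mul, hd]
      rw [show finrank ℝ W + 2 - 1 = finrank ℝ W + 1 by omega]
      field_simp
      ring
  have e2 : ∫ x, G x = Real.log 2 * ∫ z, H (T.point 1 z) := by
    rw [← T.measurePreserving_point.integral_comp T.measurableEmbedding_point]
    have hGi' : Integrable (fun q : ℝ × (W × ℝ) => G (T.point q.1 q.2)) :=
      (T.measurePreserving_point.integrable_comp_emb T.measurableEmbedding_point).2 hGi
    rw [Measure.volume_eq_prod, integral_prod _ hGi']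
    have h1 : ∀ s : ℝ, ∫ z : W × ℝ, G (T.point s z) =
        (Ioo (1 : ℝ) 2).indicator (fun s => s⁻¹) s * ∫ z, H (T.point 1 z) := by
      intro s
      by_cases hs : s ∈ Ioo (1 : ℝ) 2
      · have hs0 : 0 < s := by linarith [hs.1]
        simp only [hG, inner_pole, indicator_of_mem hs, Pi.one_apply, one_mul]
        -- Dilation by `s` in dimension `finrank W + 1`, against the degree `-(finrank W + 2)`,
        -- leaves exactly `s⁻¹`.
        have := Measure.integral_comp_smul_of_nonneg
          ((volume : Measure W).prod (volume : Measure ℝ))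
          (fun z => H (T.point s z)) s (hR := hs0.le)
        have h2 : ∀ z, H (T.point s (s • z)) = (s ^ finrank ℝ N)⁻¹ * H (T.point 1 z) := by
          intro z
          rw [← hhom s hs0, ← T.point_smul, mul_one]
        simp only [h2, integral_const_mul, smul_eq_mul, hd, finrank_prod, finrank_self] at this
        rw [← Measure.volume_eq_prod] at this
        field_simp at this ⊢
        have h3 : s ^ (finrank ℝ W + 1) * ∫ z, H (T.point 1 z) =
            s ^ (finrank ℝ W + 1) * (s * ∫ z, H (T.point s z)) := by
          rw [← mul_assoc, ← pow_succ, ← this]; ring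
        rw [mul_left_cancel₀ (pow_ne_zero _ hs0.ne') h3]; ring
      · simp [hG, inner_pole, indicator_of_notMem hs]
    simp only [h1]
    rw [integral_mul_const, integral_indicator measurableSet_Ioo, ← integral_Ioc_eq_integral_Ioo,
      ← intervalIntegral.integral_of_le (by norm_num), integral_inv_of_pos (by norm_num) (by norm_num)]
    norm_num
  exact mul_left_cancel₀ hlog (e1.symm.trans e2)

end Splitting

end Gnomonic

/-! ### The divergence theorem on a subgraph of small slope -/

section Graph

variable {W : Type*} [NormedAddCommGroup W] [InnerProductSpace ℝ W]
  [MeasurableSpace W] [BorelSpace W] [FiniteDimensional ℝ W]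

instance isAddHaarMeasure_volume_prod_real : (volume : Measure (W × ℝ)).IsAddHaarMeasure := by
  rw [Measure.volume_eq_prod]; infer_instance

/-- In the box of radius `r`, the set `Ω` is the strict subgraph of `h`. -/
structure IsSubgraph (Ω : Set (W × ℝ)) (h : W → ℝ) (r : ℝ) : Prop where
  measurableSet : MeasurableSet Ω
  mem_iff : ∀ y t, ‖y‖ < r → |t| < r → ((y, t) ∈ Ω ↔ t < h y)

theorem norm_le_iff_prod {z : W × ℝ} {r : ℝ} : ‖z‖ ≤ r ↔ ‖z.1‖ ≤ r ∧ |z.2| ≤ r := by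
  rw [Prod.norm_def, max_le_iff, Real.norm_eq_abs]

theorem tsupport_subset_closedBall {X F : Type*} [NormedAddCommGroup X] [NormedAddCommGroup F]
    {u : X → F} {r : ℝ} (hu : ∀ z, u z ≠ 0 → ‖z‖ ≤ r) : tsupport u ⊆ closedBall 0 r :=
  closure_minimal (fun z hz => by simpa using hu z hz) isClosed_closedBall

theorem hasCompactSupport_of_norm_le {X F : Type*} [NormedAddCommGroup X] [ProperSpace X]
    [NormedAddCommGroup F] {u : X → F} {r : ℝ} (hu : ∀ z, u z ≠ 0 → ‖z‖ ≤ r) :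
    HasCompactSupport u :=
  (isCompact_closedBall 0 r).of_isClosed_subset isClosed_closure (tsupport_subset_closedBall hu)

theorem fderiv_eq_zero_of_norm_lt {X F : Type*} [NormedAddCommGroup X] [NormedSpace ℝ X]
    [NormedAddCommGroup F] [NormedSpace ℝ F] {u : X → F} {r : ℝ} (hu : ∀ z, u z ≠ 0 → ‖z‖ ≤ r)
    {z : X} (hz : r < ‖z‖) : fderiv ℝ u z = 0 := by
  by_contra h
  have := tsupport_subset_closedBall hu (support_fderiv_subset ℝ h)
  rw [mem_closedBall_zero_iff] at this
  linarith

theorem integrable_fderiv_apply {X F : Type*} [NormedAddCommGroup X] [NormedSpace ℝ X]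
    [ProperSpace X] [MeasurableSpace X] [BorelSpace X]
    [NormedAddCommGroup F] [NormedSpace ℝ F] [SecondCountableTopology F]
    {μ : Measure X} [IsFiniteMeasureOnCompacts μ] {u : X → F}
    (hu : ContDiff ℝ 1 u) (hc : HasCompactSupport u) (v : X) :
    Integrable (fun z => fderiv ℝ u z v) μ := by
  have h1 : Continuous fun z => fderiv ℝ u z v :=
    (hu.continuous_fderiv one_ne_zero).clm_apply continuous_const
  exact h1.integrable_of_hasCompactSupport (hc.fderiv_apply (𝕜 := ℝ) v)

/-- The divergence theorem on a subgraph, in the direction of the axis. -/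
theorem IsSubgraph.integral_fderiv_axis {Ω : Set (W × ℝ)} {h : W → ℝ} {r r' : ℝ}
    (hΩ : IsSubgraph Ω h r) (hr : r' < r) {u : W × ℝ → ℝ}
    (hu : ContDiff ℝ 1 u) (hs : ∀ z, u z ≠ 0 → ‖z‖ ≤ r') :
    ∫ z in Ω, fderiv ℝ u z (0, 1) = ∫ y, u (y, h y) := by
  have hc := hasCompactSupport_of_norm_le hs
  have hi : Integrable (fun z => fderiv ℝ u z (0, 1)) (volume : Measure (W × ℝ)) :=
    integrable_fderiv_apply hu hc _
  rw [← integral_indicator hΩ.measurableSet, Measure.volume_eq_prod, integral_prod _ (by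
    rw [← Measure.volume_eq_prod]
    exact hi.indicator hΩ.measurableSet)]
  refine integral_congr_ae (Eventually.of_forall fun y => ?_)
  simp only
  have hd : ∀ t, HasDerivAt (fun t => u (y, t)) (fderiv ℝ u (y, t) (0, 1)) t := by
    intro t
    have h1 : HasDerivAt (fun t : ℝ => (y, t)) ((0, 1) : W × ℝ) t :=
      (hasDerivAt_const t y).prodMk (hasDerivAt_id t)
    exact ((hu.differentiable one_ne_zero (y, t)).hasFDerivAt).comp_hasDerivAt t h1
  by_cases hy : ‖y‖ < r
  -- Where `|t| ≥ r` the derivative vanishes, so on this column the set may be replaced by the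
  -- half-line below `h y`, although it is only known to be a subgraph inside the box.
  · have h1 : ∀ t, Ω.indicator (fun z => fderiv ℝ u z (0, 1)) (y, t) =
        (Iio (h y)).indicator (deriv fun t => u (y, t)) t := by
      intro t
      by_cases ht : |t| < r
      · by_cases hm : t < h y
        · rw [indicator_of_mem ((hΩ.mem_iff y t hy ht).2 hm), indicator_of_mem (mem_Iio.2 hm),
            (hd t).deriv]
        · rw [indicator_of_notMem (fun hh => hm ((hΩ.mem_iff y t hy ht).1 hh)),
            indicator_of_notMem (by simpa using hm)]
      · have h0 : fderiv ℝ u (y, t) = 0 := by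
          refine fderiv_eq_zero_of_norm_lt hs (z := (y, t)) ?_
          by_contra hle
          have := (norm_le_iff_prod.1 (not_lt.1 hle)).2
          simp only at this
          linarith
        have h2 : deriv (fun t => u (y, t)) t = 0 := by rw [(hd t).deriv, h0]; simp
        simp [indicator, h0, h2]
    simp only [h1]
    rw [integral_indicator measurableSet_Iio, ← integral_Iic_eq_integral_Iio]
    refine HasCompactSupport.integral_Iic_deriv_eq ?_ ?_ (h y)
    · exact hu.comp (contDiff_const.prodMk contDiff_id)
    · refine hasCompactSupport_of_norm_le (r := r') fun t ht => ?_
      exact (norm_le_iff_prod.1 (hs _ ht)).2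
  · have hz : ∀ t : ℝ, r' < ‖(y, t)‖ := by
      intro t
      by_contra hle
      have := (norm_le_iff_prod.1 (not_lt.1 hle)).1
      simp only at this
      linarith
    have h1 : ∀ t, Ω.indicator (fun z => fderiv ℝ u z (0, 1)) (y, t) = 0 := by
      intro t
      simp [indicator, fderiv_eq_zero_of_norm_lt hs (hz t)]
    simp only [h1, integral_zero]
    by_contra h2
    exact absurd (hs _ (Ne.symm h2)) (not_le.2 (hz _))

/-- If a set recedes along `-v` near the support of a non-negative function, then the integral of
the derivative along `v` is non-negative. -/
theorem setIntegral_fderiv_nonneg {X : Type*} [NormedAddCommGroup X] [NormedSpace ℝ X]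
    [FiniteDimensional ℝ X] [MeasurableSpace X] [BorelSpace X] {μ : Measure X} [μ.IsAddHaarMeasure]
    {Ω : Set X} (hΩ : MeasurableSet Ω) {u : X → ℝ} {r : ℝ} (hu : ContDiff ℝ 1 u)
    (hs : ∀ z, u z ≠ 0 → ‖z‖ ≤ r) (h0 : ∀ z, 0 ≤ u z) {v : X}
    (hv : ∀ᶠ s : ℝ in 𝓝[>] 0, ∀ z ∈ Ω, ‖z‖ ≤ r → z - s • v ∈ Ω) :
    0 ≤ ∫ z in Ω, fderiv ℝ u z v ∂μ := by
  have hc := hasCompactSupport_of_norm_le hs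
  obtain ⟨C, hC⟩ := ContDiff.lipschitzWith_of_hasCompactSupport hc hu one_ne_zero
  -- The ball makes the indicator integrable; its radius leaves room for translates of the support
  -- of `u` by vectors of norm at most 1.
  set g : X → ℝ := (Ω ∩ closedBall 0 (r + 1)).indicator 1 with hg
  have hgm : MeasurableSet (Ω ∩ closedBall (0 : X) (r + 1)) := hΩ.inter measurableSet_closedBall
  have hgi : Integrable g μ := by
    rw [hg, integrable_indicator_iff hgm]
    refine IntegrableOn.mono_set ?_ inter_subset_right
    exact integrableOn_const (isCompact_closedBall _ _).measure_lt_top.ne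
  -- No regularity of `Ω` is needed: the integral is the limit of difference quotients of `u`
  -- against the indicator `g`. Moving the translation onto `g` leaves `u x * (g (x - s • v) - g
  -- x)`, which is non-negative because `Ω` recedes along `-v`.
  have hlim := LipschitzWith.integral_inv_smul_sub_mul_tendsto_integral_lineDeriv_mul (μ := μ) hC hgi v
  have e1 : ∫ x, lineDeriv ℝ u x v * g x ∂μ = ∫ z in Ω, fderiv ℝ u z v ∂μ := by
    rw [← integral_indicator hΩ]
    refine integral_congr_ae (Eventually.of_forall fun x => ?_)
    simp only
    rw [(hu.differentiable one_ne_zero x).lineDeriv_eq_fderiv]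
    by_cases hx : ‖x‖ ≤ r + 1
    · by_cases hxΩ : x ∈ Ω <;> simp [hg, indicator, hx, hxΩ]
    · have : fderiv ℝ u x = 0 := fderiv_eq_zero_of_norm_lt hs (by linarith)
      simp [this, indicator]
  rw [e1] at hlim
  refine ge_of_tendsto hlim ?_
  have hsmall : ∀ᶠ s : ℝ in 𝓝[>] 0, ‖s • v‖ ≤ 1 := by
    have : Tendsto (fun s : ℝ => ‖s • v‖) (𝓝[>] 0) (𝓝 0) := by
      have : Tendsto (fun s : ℝ => ‖s • v‖) (𝓝 0) (𝓝 ‖(0 : ℝ) • v‖) :=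
        Continuous.tendsto (by fun_prop) 0
      rw [zero_smul, norm_zero] at this
      exact this.mono_left nhdsWithin_le_nhds
    exact (this.eventually (gt_mem_nhds one_pos)).mono fun _ h => le_of_lt h
  filter_upwards [hv, hsmall, self_mem_nhdsWithin] with s hsv hs1 hs0
  have hs0 : 0 < s := hs0
  simp only [smul_eq_mul, mul_assoc]
  rw [integral_const_mul]
  refine mul_nonneg (inv_nonneg.2 hs0.le) ?_
  have i1 : Integrable (fun x => u x * g x) μ :=
    hgi.bdd_mul hu.continuous.aestronglyMeasurable
      (c := (hu.continuous.bounded_above_of_compact_support hc).choose)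
      (Eventually.of_forall (hu.continuous.bounded_above_of_compact_support hc).choose_spec)
  have i2 : Integrable (fun x => u (x + s • v) * g x) μ :=
    hgi.bdd_mul (by fun_prop)
      (c := (hu.continuous.bounded_above_of_compact_support hc).choose)
      (Eventually.of_forall fun x =>
        (hu.continuous.bounded_above_of_compact_support hc).choose_spec _)
  have i3 : Integrable (fun x => u x * g (x - s • v)) μ := by
    have := i2.comp_sub_right (s • v)
    simpa using this
  simp only [sub_mul]
  rw [integral_sub i2 i1, sub_nonneg]
  have e2 : ∫ x, u (x + s • v) * g x ∂μ = ∫ x, u x * g (x - s • v) ∂μ := by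
    rw [← integral_sub_right_eq_self (fun x => u (x + s • v) * g x) (s • v)]
    simp
  rw [e2]
  refine integral_mono i1 i3 fun x => ?_
  simp only
  by_cases hx : u x = 0
  · simp [hx]
  refine mul_le_mul_of_nonneg_left ?_ (h0 x)
  by_cases hxΩ : x ∈ Ω
  · have hxr := hs x hx
    have m2 : x - s • v ∈ Ω ∩ closedBall 0 (r + 1) := by
      refine ⟨hsv x hxΩ hxr, ?_⟩
      rw [mem_closedBall_zero_iff]
      linarith [norm_sub_le x (s • v)]
    rw [hg, indicator_of_mem m2]
    exact indicator_le_self' (fun _ _ => zero_le_one) x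
  · rw [hg, indicator_of_notMem (fun h => hxΩ h.1)]
    exact indicator_nonneg (fun _ _ => zero_le_one) _

/-- On a subgraph with small slope, derivatives along the base integrate to almost zero. -/
theorem IsSubgraph.abs_integral_fderiv_base_le {Ω : Set (W × ℝ)} {h : W → ℝ} {r r' L : ℝ}
    (hΩ : IsSubgraph Ω h r) (hr : r' < r)
    (hL : ∀ y y', ‖y‖ < r → ‖y'‖ < r → |h y - h y'| ≤ L * ‖y - y'‖) {u : W × ℝ → ℝ}
    (hu : ContDiff ℝ 1 u) (hs : ∀ z, u z ≠ 0 → ‖z‖ ≤ r') (h0 : ∀ z, 0 ≤ u z) (e : W) :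
    |∫ z in Ω, fderiv ℝ u z (e, 0)| ≤ L * ‖e‖ * ∫ y, u (y, h y) := by
  have hc := hasCompactSupport_of_norm_le hs
  -- A move by `-s • e'` in the base lowers `h` by at most `s L ‖e‖`, so the subgraph is locally
  -- stable under small moves along `-(e', L ‖e‖)`. The vertical part of the derivative is known
  -- exactly from `integral_fderiv_axis`; the choices `e' = e` and `e' = -e` give the two sides of
  -- the estimate.
  have key : ∀ e' : W, ‖e'‖ = ‖e‖ → 0 ≤ ∫ z in Ω, fderiv ℝ u z (e', L * ‖e‖) := by
    intro e' he'
    refine setIntegral_fderiv_nonneg hΩ.measurableSet hu hs h0 ?_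
    have : Tendsto (fun s : ℝ => ‖s • ((e', L * ‖e‖) : W × ℝ)‖) (𝓝[>] 0) (𝓝 0) := by
      have : Tendsto (fun s : ℝ => ‖s • ((e', L * ‖e‖) : W × ℝ)‖) (𝓝 0)
          (𝓝 ‖(0 : ℝ) • ((e', L * ‖e‖) : W × ℝ)‖) :=
        Continuous.tendsto (by fun_prop) 0
      rw [zero_smul, norm_zero] at this
      exact this.mono_left nhdsWithin_le_nhds
    filter_upwards [this.eventually (gt_mem_nhds (sub_pos.2 hr)), self_mem_nhdsWithin] with s hs1 hs0
    have hs0 : 0 < s := hs0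
    rintro ⟨y, t⟩ hz hzr
    have hlt : ‖((y, t) : W × ℝ) - s • ((e', L * ‖e‖) : W × ℝ)‖ < r := by
      linarith [norm_sub_le ((y, t) : W × ℝ) (s • ((e', L * ‖e‖) : W × ℝ))]
    have hz1 := norm_le_iff_prod.1 hzr
    simp only at hz1
    rw [Prod.norm_def, max_lt_iff] at hlt
    obtain ⟨hy2, ht2⟩ := hlt
    simp only [Prod.smul_mk, Prod.mk_sub_mk, smul_eq_mul, Real.norm_eq_abs] at hy2 ht2
    have h1 := (hΩ.mem_iff y t (by linarith) (by linarith)).1 hz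
    refine (hΩ.mem_iff _ _ hy2 ht2).2 ?_
    have h2 := hL y (y - s • e') (by linarith) hy2
    rw [sub_sub_cancel, norm_smul, Real.norm_eq_abs, abs_of_pos hs0, he'] at h2
    have := (abs_le.1 h2).2
    nlinarith
  have hadd : ∀ e' : W, ∫ z in Ω, fderiv ℝ u z (e', L * ‖e‖) =
      (∫ z in Ω, fderiv ℝ u z (e', 0)) + L * ‖e‖ * ∫ y, u (y, h y) := by
    intro e'
    rw [← hΩ.integral_fderiv_axis hr hu hs, ← integral_const_mul, ← integral_add]
    · refine integral_congr_ae (Eventually.of_forall fun z => ?_)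
      simp only
      rw [← smul_eq_mul (L * ‖e‖), ← map_smul, ← map_add]
      simp
    · exact (integrable_fderiv_apply hu hc _).integrableOn
    · exact ((integrable_fderiv_apply hu hc _).integrableOn).const_mul _
  have k1 := key e rfl
  have k2 := key (-e) (norm_neg e)
  rw [hadd] at k1 k2
  have hneg : ∫ z in Ω, fderiv ℝ u z (-e, 0) = - ∫ z in Ω, fderiv ℝ u z (e, 0) := by
    rw [← integral_neg]
    refine integral_congr_ae (Eventually.of_forall fun z => ?_)
    simp only
    rw [← map_neg]; simp
  rw [hneg] at k2
  rw [abs_le]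
  constructor <;> linarith

theorem integrable_graph {h : W → ℝ} {r r' : ℝ} (hr : r' < r)
    (hh : ContinuousOn h (ball 0 r)) {u : W × ℝ → ℝ} (hu : Continuous u)
    (hs : ∀ z, u z ≠ 0 → ‖z‖ ≤ r') : Integrable fun y => u (y, h y) := by
  have hi : IntegrableOn (fun y => u (y, h y)) (closedBall 0 r') := by
    refine ContinuousOn.integrableOn_compact (isCompact_closedBall _ _) ?_
    exact hu.comp_continuousOn (continuousOn_id.prodMk
      (hh.mono (closedBall_subset_ball hr)))
  refine (integrableOn_iff_integrable_of_support_subset fun y hy => ?_).1 hi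
  exact mem_closedBall_zero_iff.2 (norm_le_iff_prod.1 (hs _ hy)).1

/-- The variant of `abs_integral_fderiv_base_le` for a signed function bounded by a multiple of a
non-negative one. -/
theorem IsSubgraph.abs_integral_fderiv_base_le_of_abs_le {Ω : Set (W × ℝ)} {h : W → ℝ}
    {r r' L δ : ℝ} (hΩ : IsSubgraph Ω h r) (hr : r' < r) (hL0 : 0 ≤ L)
    (hL : ∀ y y', ‖y‖ < r → ‖y'‖ < r → |h y - h y'| ≤ L * ‖y - y'‖) {u q : W × ℝ → ℝ}
    (hu : ContDiff ℝ 1 u) (hs : ∀ z, u z ≠ 0 → ‖z‖ ≤ r') (h0 : ∀ z, 0 ≤ u z)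
    (hq : ContDiff ℝ 1 q) (hδ : 0 ≤ δ) (hqu : ∀ z, |q z| ≤ δ * u z) (e : W) :
    |∫ z in Ω, fderiv ℝ q z (e, 0)| ≤ 3 * δ * (L * ‖e‖ * ∫ y, u (y, h y)) := by
  have hcont : ContinuousOn h (ball 0 r) := by
    have : LipschitzOnWith L.toNNReal h (ball 0 r) := by
      refine LipschitzOnWith.of_dist_le_mul fun y hy y' hy' => ?_
      rw [Real.coe_toNNReal _ hL0, Real.dist_eq, dist_eq_norm]
      exact hL _ _ (by simpa using hy) (by simpa using hy')
    exact this.continuousOn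
  have hqs : ∀ z, q z ≠ 0 → u z ≠ 0 := fun z hz hu0 => hz (by simpa [hu0] using hqu z)
  -- The sum lies between `0` and `2 δ u`. The estimate for non-negative functions applies to `p`
  -- and to `u`, and the constant is `2 δ + δ = 3 δ`.
  set p : W × ℝ → ℝ := fun z => q z + δ * u z with hp
  have hpc : ContDiff ℝ 1 p := hq.add (contDiff_const.mul hu)
  have hps : ∀ z, p z ≠ 0 → ‖z‖ ≤ r' := fun z hz => by
    by_contra h1
    have hu0 : u z = 0 := by by_contra h2; exact h1 (hs z h2)
    have hq0 : q z = 0 := by by_contra h2; exact hqs z h2 hu0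
    exact hz (by simp [hp, hu0, hq0])
  have hp0 : ∀ z, 0 ≤ p z := fun z => by
    have := (abs_le.1 (hqu z)).1
    simp only [hp]; linarith
  have b1 := hΩ.abs_integral_fderiv_base_le hr hL hpc hps hp0 e
  have b2 := hΩ.abs_integral_fderiv_base_le hr hL hu hs h0 e
  have hiu := (integrable_fderiv_apply (μ := volume) hu (hasCompactSupport_of_norm_le hs)
    (e, (0 : ℝ))).integrableOn (s := Ω)
  have hip := (integrable_fderiv_apply (μ := volume) hpc (hasCompactSupport_of_norm_le hps)
    (e, (0 : ℝ))).integrableOn (s := Ω)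
  have e1 : ∫ z in Ω, fderiv ℝ q z (e, 0) =
      (∫ z in Ω, fderiv ℝ p z (e, 0)) - δ * ∫ z in Ω, fderiv ℝ u z (e, 0) := by
    rw [← integral_const_mul, ← integral_sub hip (hiu.const_mul δ)]
    refine integral_congr_ae (Eventually.of_forall fun z => ?_)
    have h1 := hq.differentiable one_ne_zero z
    have h2 := hu.differentiable one_ne_zero z
    simp only [hp]
    rw [fderiv_fun_add h1 (h2.const_mul δ), fderiv_const_mul h2]
    simp
  have hiu' := integrable_graph hr hcont hu.continuous hs
  have e2 : ∫ y, p (y, h y) ≤ 2 * δ * ∫ y, u (y, h y) := by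
    rw [← integral_const_mul]
    refine integral_mono (integrable_graph hr hcont hpc.continuous hps) (hiu'.const_mul _) fun y => ?_
    have := (abs_le.1 (hqu (y, h y))).2
    simp only [hp]; linarith
  rw [e1]
  have hQ : 0 ≤ L * ‖e‖ := by positivity
  calc _ ≤ |∫ z in Ω, fderiv ℝ p z (e, 0)| + δ * |∫ z in Ω, fderiv ℝ u z (e, 0)| := by
        rw [← abs_of_nonneg hδ, ← abs_mul, abs_of_nonneg hδ]; exact abs_sub _ _
    _ ≤ L * ‖e‖ * (2 * δ * ∫ y, u (y, h y)) + δ * (L * ‖e‖ * ∫ y, u (y, h y)) := by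
        gcongr
        exact b1.trans (mul_le_mul_of_nonneg_left e2 hQ)
    _ = _ := by ring

end Graph

/-! ### Functions of negative degree of homogeneity -/

section Homogeneous

variable {N F : Type*} [NormedAddCommGroup N] [NormedSpace ℝ N]
  [NormedAddCommGroup F] [NormedSpace ℝ F]

/-- `φ` is positively homogeneous of degree `-d`. -/
def NegHomogeneous (d : ℕ) (φ : N → F) : Prop :=
  ∀ r : ℝ, 0 < r → ∀ x, φ (r • x) = (r ^ d)⁻¹ • φ x

theorem NegHomogeneous.fderiv_apply {d : ℕ} {φ : N → F} (hφ : NegHomogeneous d φ) (v : N) :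
    NegHomogeneous (d + 1) fun x => fderiv ℝ φ x v := by
  intro r hr x
  have h1 : (fun x => φ (r • x)) = fun x => (r ^ d)⁻¹ • φ x := funext (hφ r hr)
  have h2 := congrArg (fun f => fderiv ℝ f x v) h1
  have h3 : fderiv ℝ (fun x => (r ^ d)⁻¹ • φ x) = (r ^ d)⁻¹ • fderiv ℝ φ :=
    fderiv_const_smul_field _
  simp only [fderiv_comp_smul, h3, Pi.smul_apply, _root_.smul_apply] at h2
  simp only
  rw [pow_succ, mul_inv, mul_comm, mul_smul, ← h2, smul_smul, inv_mul_cancel₀ hr.ne', one_smul]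

/-- Euler's identity, from differentiating `r ↦ φ (r • x)` at `r = 1`. -/
theorem NegHomogeneous.fderiv_self {d : ℕ} {φ : N → F} (hφ : NegHomogeneous d φ) {x : N}
    (hx : DifferentiableAt ℝ φ x) : fderiv ℝ φ x x = -(d : ℝ) • φ x := by
  have h1 : HasDerivAt (fun r : ℝ => φ (r • x)) (fderiv ℝ φ x x) 1 := by
    have h2 : HasDerivAt (fun r : ℝ => r • x) x 1 := by
      simpa using (hasDerivAt_id (1 : ℝ)).smul_const x
    have h3 : HasFDerivAt φ (fderiv ℝ φ x) ((1 : ℝ) • x) := by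
      rw [one_smul]; exact hx.hasFDerivAt
    exact h3.comp_hasDerivAt 1 h2
  have h4 : HasDerivAt (fun r : ℝ => (r ^ d)⁻¹ • φ x) (-(d : ℝ) • φ x) 1 := by
    have h5 : HasDerivAt (fun r : ℝ => (r ^ d)⁻¹) (-(d : ℝ)) 1 := by
      have := (hasDerivAt_pow d (1 : ℝ)).inv (by simp)
      simp only [one_pow, mul_one, div_one] at this
      exact this
    exact h5.smul_const (φ x)
  refine h1.unique (h4.congr_of_eventuallyEq ?_)
  filter_upwards [lt_mem_nhds (zero_lt_one' ℝ)] with r hr using hφ r hr x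

end Homogeneous

/-! ### The divergence estimate for cones in gnomonic coordinates -/

namespace Splitting

variable {N W : Type*} [NormedAddCommGroup N] [InnerProductSpace ℝ N] [MeasurableSpace N]
  [BorelSpace N] [FiniteDimensional ℝ N] [NormedAddCommGroup W] [InnerProductSpace ℝ W]
  [MeasurableSpace W] [BorelSpace W] [FiniteDimensional ℝ W]

/-- The coordinate map as a continuous linear map. -/
def pointL (T : Splitting N W) : ℝ × (W × ℝ) →L[ℝ] N :=
  LinearMap.toContinuousLinearMap
    { toFun := fun q => T.point q.1 q.2
      map_add' := fun _ _ => T.point_add _ _ _ _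
      map_smul' := fun _ _ => T.point_smul _ _ _ }

theorem hasStrictFDerivAt_point (T : Splitting N W) (z : W × ℝ) :
    HasStrictFDerivAt (T.point 1) (T.pointL.comp (ContinuousLinearMap.inr ℝ ℝ (W × ℝ))) z := by
  have h := T.pointL.hasStrictFDerivAt (x := ((1 : ℝ), z))
  exact h.comp z ((hasStrictFDerivAt_const (1 : ℝ) z).prodMk (hasStrictFDerivAt_id z))

theorem contDiff_point (T : Splitting N W) (s : ℝ) {k : WithTop ℕ∞} : ContDiff ℝ k (T.point s) :=
  T.pointL.contDiff.comp (contDiff_const.prodMk contDiff_id)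

theorem point_ne_zero (T : Splitting N W) (z : W × ℝ) : T.point 1 z ≠ 0 := by
  intro h
  have := T.norm_point_sq 1 z
  rw [h, norm_zero] at this
  nlinarith [sq_nonneg ‖z.1‖, sq_nonneg z.2]

theorem one_le_norm_point (T : Splitting N W) (z : W × ℝ) : 1 ≤ ‖T.point 1 z‖ := by
  have := T.norm_point_sq 1 z
  nlinarith [sq_nonneg ‖z.1‖, sq_nonneg z.2, norm_nonneg (T.point 1 z)]

theorem norm_point_le_two (T : Splitting N W) {z : W × ℝ} (hz : ‖z‖ ≤ 1) : ‖T.point 1 z‖ ≤ 2 := by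
  have := T.norm_point_sq 1 z
  have h1 := norm_le_iff_prod.1 hz
  have h2 : ‖z.1‖ ^ 2 ≤ 1 := by nlinarith [norm_nonneg z.1]
  have h3 : z.2 ^ 2 ≤ 1 := by rw [← sq_abs]; nlinarith [abs_nonneg z.2]
  nlinarith [norm_nonneg (T.point 1 z)]

/-- `φ` vanishes outside the cone over the image of the closed box of radius `r`. -/
def SupportedIn (T : Splitting N W) (r : ℝ) (φ : N → ℝ) : Prop :=
  ∀ x, φ x ≠ 0 → ∃ s : ℝ, 0 < s ∧ ∃ z : W × ℝ, ‖z‖ ≤ r ∧ x = s • T.point 1 z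

theorem SupportedIn.norm_le {T : Splitting N W} {r : ℝ} {φ : N → ℝ} (h : T.SupportedIn r φ)
    {z : W × ℝ} (hz : φ (T.point 1 z) ≠ 0) : ‖z‖ ≤ r := by
  obtain ⟨s, hs, z', hz', he⟩ := h _ hz
  rw [← T.point_smul, mul_one] at he
  have h1 : s = 1 := by
    have := congrArg (inner ℝ T.pole) he
    rw [inner_pole, inner_pole] at this
    exact this.symm
  subst h1
  rw [one_smul] at he
  have : z = z' := by
    have := T.injective he
    simpa using this
  rwa [this]

theorem SupportedIn.inner_pole_ge {T : Splitting N W} {r : ℝ} (hr : r ≤ 1) {φ : N → ℝ}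
    (h : T.SupportedIn r φ) {x : N} (hx : φ x ≠ 0) : 1 / 2 * ‖x‖ ≤ inner ℝ T.pole x := by
  obtain ⟨s, hs, z', hz', rfl⟩ := h _ hx
  rw [inner_smul_right, inner_pole, norm_smul, Real.norm_eq_abs, abs_of_pos hs]
  have := T.norm_point_le_two (hz'.trans hr)
  nlinarith

theorem contDiff_comp_point (T : Splitting N W) {φ : N → ℝ} (hφ : ContDiffOn ℝ 1 φ {0}ᶜ) :
    ContDiff ℝ 1 fun z => φ (T.point 1 z) := by
  have := hφ.comp (T.contDiff_point 1).contDiffOn (s := univ) (fun z _ => T.point_ne_zero z)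
  exact contDiffOn_univ.1 this

theorem differentiableAt_of_contDiffOn {φ : N → ℝ} (hφ : ContDiffOn ℝ 1 φ {0}ᶜ) {x : N}
    (hx : x ≠ 0) : DifferentiableAt ℝ φ x :=
  (hφ.contDiffAt (isOpen_compl_singleton.mem_nhds hx)).differentiableAt one_ne_zero

theorem fderiv_comp_point (T : Splitting N W) {φ : N → ℝ} (hφ : ContDiffOn ℝ 1 φ {0}ᶜ)
    (z z' : W × ℝ) :
    fderiv ℝ (fun z => φ (T.point 1 z)) z z' = fderiv ℝ φ (T.point 1 z) (T.point 0 z') := by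
  have h1 := (differentiableAt_of_contDiffOn hφ (T.point_ne_zero z)).hasFDerivAt.comp z
    (T.hasStrictFDerivAt_point z).hasFDerivAt
  have h2 : fderiv ℝ (fun z => φ (T.point 1 z)) z = _ := h1.fderiv
  rw [h2]
  rfl

/-- The surface integral of a directional derivative over a cone, in gnomonic coordinates. -/
theorem setIntegral_sphere_fderiv (T : Splitting N W) {φ : N → ℝ} (hφ : ContDiffOn ℝ 1 φ {0}ᶜ)
    (hh : NegHomogeneous (finrank ℝ W + 1) φ) {r : ℝ} (hr : r ≤ 1) (hs : T.SupportedIn r φ)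
    {V : Set N} (hV : MeasurableSet V) (hVc : ∀ r : ℝ, 0 < r → ∀ x, r • x ∈ V ↔ x ∈ V) (v : N) :
    ∫ w in ((↑) : sphere (0 : N) 1 → N) ⁻¹' V, fderiv ℝ φ w v ∂(volume : Measure N).toSphere =
      ∫ z in T.point 1 ⁻¹' V, fderiv ℝ φ (T.point 1 z) v := by
  rw [← integral_indicator (measurable_subtype_coe hV),
    ← integral_indicator ((T.contDiff_point 1 (k := 0)).continuous.measurable hV)]
  have hcont : ContinuousOn (fun x => fderiv ℝ φ x v) {0}ᶜ :=
    (hφ.continuousOn_fderiv_of_isOpen isOpen_compl_singleton le_rfl).clm_apply continuousOn_const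
  obtain ⟨C, hC⟩ := (isCompact_sphere (0 : N) 1).exists_bound_of_continuousOn
    (hcont.mono fun x hx h0 => by
      rw [mem_singleton_iff.1 h0] at hx; simp at hx)
  -- A derivative of `φ` has degree `-(finrank W + 2) = -finrank N`, the one required here. The
  -- constant `1 / 2` comes from `norm_point_le_two`, since the support lies over the box of radius
  -- at most 1.
  refine T.integral_sphere_eq (H := V.indicator fun x => fderiv ℝ φ x v) (C := C) (c := 1 / 2)
    ((measurable_fderiv_apply_const ℝ φ v).indicator hV) ?_ (by norm_num) ?_ ?_
  · intro r hr x
    have h1 := hh.fderiv_apply v r hr x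
    rw [T.finrank_eq]
    by_cases hx : x ∈ V
    · rw [indicator_of_mem ((hVc r hr x).2 hx), indicator_of_mem hx]
      exact h1
    · rw [indicator_of_notMem (fun h => hx ((hVc r hr x).1 h)), indicator_of_notMem hx, mul_zero]
  · intro x hx
    have h1 := hC x (by simpa using hx)
    rw [Real.norm_eq_abs] at h1
    by_cases hxV : x ∈ V
    · rwa [indicator_of_mem hxV]
    · rw [indicator_of_notMem hxV, abs_zero]
      exact (abs_nonneg _).trans h1
  · intro x hx
    have h1 : fderiv ℝ φ x ≠ 0 := by
      intro h0
      apply hx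
      simp [indicator, h0]
    have h2 : tsupport φ ⊆ {x | 1 / 2 * ‖x‖ ≤ inner ℝ T.pole x} :=
      closure_minimal (fun x hx => hs.inner_pole_ge hr hx)
        (isClosed_le (by fun_prop) (by fun_prop))
    exact h2 (support_fderiv_subset ℝ h1)

/-- The divergence theorem on a spherical domain that is almost a half-space in gnomonic
coordinates, with a controlled error. -/
theorem abs_integral_sphere_fderiv_sub_le (T : Splitting N W) {φ : N → ℝ}
    (hφ : ContDiffOn ℝ 1 φ {0}ᶜ) (h0 : ∀ x, 0 ≤ φ x)
    (hh : NegHomogeneous (finrank ℝ W + 1) φ) {r r' L η : ℝ} (hr : r ≤ 1) (hr' : r' < r)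
    (hs : T.SupportedIn r' φ)
    {V : Set N} (hV : MeasurableSet V) (hVc : ∀ r : ℝ, 0 < r → ∀ x, r • x ∈ V ↔ x ∈ V)
    {h : W → ℝ} (hΩ : IsSubgraph (T.point 1 ⁻¹' V) h r) (hL0 : 0 ≤ L)
    (hL : ∀ y y', ‖y‖ < r → ‖y'‖ < r → |h y - h y'| ≤ L * ‖y - y'‖)
    (hη : ∀ y, ‖y‖ < r → |h y| ≤ η) (α β : ℝ) (e : W) :
    |(∫ w in ((↑) : sphere (0 : N) 1 → N) ⁻¹' V, fderiv ℝ φ w (T.point α (e, β))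
        ∂(volume : Measure N).toSphere) - β * ∫ y, φ (T.point 1 (y, h y))| ≤
      (|α| * (finrank ℝ W * (3 * L) + η) + L * ‖e‖) * ∫ y, φ (T.point 1 (y, h y)) := by
  set Ω := T.point 1 ⁻¹' V with hΩd
  set u : W × ℝ → ℝ := fun z => φ (T.point 1 z) with hu
  have huc : ContDiff ℝ 1 u := T.contDiff_comp_point hφ
  have hus : ∀ z, u z ≠ 0 → ‖z‖ ≤ r' := fun z hz => hs.norm_le hz
  have hu0 : ∀ z, 0 ≤ u z := fun z => h0 _
  have hsc := hasCompactSupport_of_norm_le hus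
  rw [T.setIntegral_sphere_fderiv hφ hh (hr'.le.trans hr) hs hV hVc]
  set Q := ∫ y, φ (T.point 1 (y, h y)) with hQ
  have hQ0 : 0 ≤ Q := integral_nonneg fun y => h0 _
  let b := stdOrthonormalBasis ℝ W
  let Y : Fin (finrank ℝ W) → W × ℝ → ℝ := fun i z => inner ℝ (b i) z.1 * u z
  let Z : W × ℝ → ℝ := fun z => z.2 * u z
  have hYc : ∀ i, ContDiff ℝ 1 (Y i) := fun i =>
    (contDiff_const.inner ℝ contDiff_fst).mul huc
  have hZc : ContDiff ℝ 1 Z := contDiff_snd.mul huc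
  have hYs : ∀ i z, Y i z ≠ 0 → ‖z‖ ≤ r' := fun i z hz => hus z (right_ne_zero_of_mul hz)
  have hZs : ∀ z, Z z ≠ 0 → ‖z‖ ≤ r' := fun z hz => hus z (right_ne_zero_of_mul hz)
  -- The pole is `T.point 1 z - T.point 0 z`. By Euler the first vector contributes `-(finrank W +
  -- 1) u`, and the second subtracts the derivative of `u` along `z`. Together they are minus the
  -- divergence of the field `z ↦ u z • z`, whose components are `Y i` and `Z`. Thus every term is a
  -- flat derivative of a compactly supported function.
  have hpt : ∀ z, fderiv ℝ φ (T.point 1 z) (T.point α (e, β)) =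
      -α * ((∑ i, fderiv ℝ (Y i) z (b i, 0)) + fderiv ℝ Z z (0, 1)) +
        (fderiv ℝ u z (e, 0) + β * fderiv ℝ u z (0, 1)) := by
    intro z
    have hd := huc.differentiable one_ne_zero z
    have hx := differentiableAt_of_contDiffOn hφ (T.point_ne_zero z)
    have e1 : T.point α (e, β) = α • (T.point 1 z - T.point 0 z) + T.point 0 (e, β) := by
      have : T.point 1 z = T.point 1 0 + T.point 0 z := by
        rw [← T.point_add]; simp
      rw [this, add_sub_cancel_right, ← T.point_smul, ← T.point_add]
      simp
    have e2 : fderiv ℝ u z (e, β) = fderiv ℝ u z (e, 0) + β * fderiv ℝ u z (0, 1) := by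
      rw [← smul_eq_mul, ← map_smul, ← map_add]; simp
    have e3 : ∀ i, fderiv ℝ (Y i) z (b i, 0) =
        u z + inner ℝ (b i) z.1 * fderiv ℝ u z (b i, 0) := by
      intro i
      have h1 : HasFDerivAt (fun z : W × ℝ => inner ℝ (b i) z.1)
          ((innerSL ℝ (b i)).comp (ContinuousLinearMap.fst ℝ W ℝ)) z :=
        ((innerSL ℝ (b i)).comp (ContinuousLinearMap.fst ℝ W ℝ)).hasFDerivAt
      have h2 : fderiv ℝ (Y i) z = _ := (h1.mul hd.hasFDerivAt).fderiv
      rw [h2]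
      simp
      ring
    have e4 : fderiv ℝ Z z (0, 1) = u z + z.2 * fderiv ℝ u z (0, 1) := by
      have h1 : HasFDerivAt (fun z : W × ℝ => z.2) (ContinuousLinearMap.snd ℝ W ℝ) z :=
        hasFDerivAt_snd
      have h2 : fderiv ℝ Z z = _ := (h1.mul hd.hasFDerivAt).fderiv
      rw [h2]
      simp
      ring
    have e5 : fderiv ℝ u z z = (∑ i, inner ℝ (b i) z.1 * fderiv ℝ u z (b i, 0)) +
        z.2 * fderiv ℝ u z (0, 1) := by
      have : z = (∑ i, inner ℝ (b i) z.1 • ((b i, 0) : W × ℝ)) + z.2 • ((0, 1) : W × ℝ) := by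
        refine Prod.ext ?_ ?_
        · simp [Prod.fst_sum, b.sum_repr']
        · simp [Prod.snd_sum]
      have h2 := congrArg (fderiv ℝ u z) this
      rw [map_add, map_sum] at h2
      simpa only [map_smul, smul_eq_mul] using h2
    rw [e1, map_add, map_smul, map_sub, hh.fderiv_self hx, ← T.fderiv_comp_point hφ,
      ← T.fderiv_comp_point hφ, e2, e5, e4, Finset.sum_congr rfl fun i _ => e3 i,
      Finset.sum_add_distrib, Finset.sum_const, Finset.card_univ, Fintype.card_fin]
    simp only [smul_eq_mul, nsmul_eq_mul, Nat.cast_add, Nat.cast_one]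
    simp only [hu]
    ring
  have iY : ∀ i, Integrable (fun z => fderiv ℝ (Y i) z (b i, 0)) (volume.restrict Ω) := fun i =>
    (integrable_fderiv_apply (hYc i) (hasCompactSupport_of_norm_le (hYs i)) _).integrableOn
  have iZ : Integrable (fun z => fderiv ℝ Z z (0, 1)) (volume.restrict Ω) :=
    (integrable_fderiv_apply hZc (hasCompactSupport_of_norm_le hZs) _).integrableOn
  have iu : ∀ v, Integrable (fun z => fderiv ℝ u z v) (volume.restrict Ω) := fun v =>
    (integrable_fderiv_apply huc hsc v).integrableOn
  have hcalc : ∫ z in Ω, fderiv ℝ φ (T.point 1 z) (T.point α (e, β)) =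
      -α * ((∑ i, ∫ z in Ω, fderiv ℝ (Y i) z (b i, 0)) + ∫ z in Ω, fderiv ℝ Z z (0, 1)) +
        ((∫ z in Ω, fderiv ℝ u z (e, 0)) + β * ∫ z in Ω, fderiv ℝ u z (0, 1)) := by
    simp only [hpt]
    rw [integral_add, integral_const_mul, integral_add, integral_finsetSum _ fun i _ => iY i,
      integral_add (iu _) ((iu _).const_mul _), integral_const_mul]
    · exact integrable_finsetSum _ fun i _ => iY i
    · exact iZ
    · exact ((integrable_finsetSum _ fun i _ => iY i).add iZ).const_mul _
    · exact (iu _).add ((iu _).const_mul _)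
  -- On the support of `u` the base coordinate has norm at most 1, so `|Y i| ≤ u` and the signed
  -- estimate applies with `δ = 1`.
  have bY : ∀ i, |∫ z in Ω, fderiv ℝ (Y i) z (b i, 0)| ≤ 3 * L * Q := by
    intro i
    have := hΩ.abs_integral_fderiv_base_le_of_abs_le hr' hL0 hL huc hus hu0 (hYc i) (δ := 1)
      zero_le_one ?_ (b i)
    · rw [b.norm_eq_one] at this
      linarith
    · intro z
      by_cases hz : u z = 0
      · simp [Y, hz]
      · have h1 := (norm_le_iff_prod.1 (hus z hz)).1
        have h2 := abs_real_inner_le_norm (b i) z.1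
        rw [b.norm_eq_one] at h2
        rw [abs_mul, abs_of_nonneg (hu0 z)]
        exact mul_le_mul_of_nonneg_right (by linarith) (hu0 z)
  -- The axis formula turns this into the integral of `h y * u (y, h y)`, and `|h| ≤ η`.
  have bZ : |∫ z in Ω, fderiv ℝ Z z (0, 1)| ≤ η * Q := by
    have hcont : ContinuousOn h (ball 0 r) := by
      have : LipschitzOnWith L.toNNReal h (ball 0 r) := by
        refine LipschitzOnWith.of_dist_le_mul fun y hy y' hy' => ?_
        rw [Real.coe_toNNReal _ hL0, Real.dist_eq, dist_eq_norm]
        exact hL _ _ (by simpa using hy) (by simpa using hy')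
      exact this.continuousOn
    rw [hΩ.integral_fderiv_axis hr' hZc hZs, hQ, ← integral_const_mul]
    refine abs_integral_le_integral_abs.trans (integral_mono ?_ ?_ fun y => ?_)
    · exact (integrable_graph hr' hcont hZc.continuous hZs).abs
    · exact (integrable_graph hr' hcont huc.continuous hus).const_mul η
    · simp only [Z]
      by_cases hz : u (y, h y) = 0
      · have hz' : φ (T.point 1 (y, h y)) = 0 := hz
        simp [hz, hz']
      · have h1 := (norm_le_iff_prod.1 (hus _ hz)).1
        simp only at h1
        rw [abs_mul, abs_of_nonneg (hu0 _)]
        exact mul_le_mul_of_nonneg_right (hη y (by linarith)) (hu0 _)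
  have be := hΩ.abs_integral_fderiv_base_le hr' hL huc hus hu0 e
  have bν := hΩ.integral_fderiv_axis hr' huc hus
  change _ = Q at bν
  change _ ≤ L * ‖e‖ * Q at be
  rw [hcalc, bν]
  have bS : |∑ i, ∫ z in Ω, fderiv ℝ (Y i) z (b i, 0)| ≤ finrank ℝ W * (3 * L * Q) := by
    refine (Finset.abs_sum_le_sum_abs _ _).trans ((Finset.sum_le_sum fun i _ => bY i).trans ?_)
    simp
  have e6 : ∀ A B C : ℝ, -α * (A + B) + (C + β * Q) - β * Q = -α * (A + B) + C := by
    intros; ring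
  rw [e6]
  calc _ ≤ |α| * (|∑ i, ∫ z in Ω, fderiv ℝ (Y i) z (b i, 0)| + |∫ z in Ω, fderiv ℝ Z z (0, 1)|) +
        |∫ z in Ω, fderiv ℝ u z (e, 0)| := by
        refine (abs_add_le _ _).trans ?_
        rw [abs_mul, abs_neg]
        gcongr
        exact abs_add_le _ _
    _ ≤ |α| * (finrank ℝ W * (3 * L * Q) + η * Q) + L * ‖e‖ * Q := by gcongr
    _ = _ := by ring

end Splitting

/-! ### Surface measure of an almost isometric image -/

section Hausdorff

variable {W X : Type*} [NormedAddCommGroup W] [InnerProductSpace ℝ W]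
  [MeasurableSpace W] [BorelSpace W] [FiniteDimensional ℝ W]
  [MetricSpace X] [MeasurableSpace X] [BorelSpace X]

theorem LipschitzOnWith.euclideanHausdorffMeasure_image_le {Y Z : Type*} [MetricSpace Y]
    [MeasurableSpace Y] [BorelSpace Y] [MetricSpace Z] [MeasurableSpace Z] [BorelSpace Z]
    {K : ℝ≥0} {f : Y → Z} {s : Set Y} (hf : LipschitzOnWith K f s) (d : ℕ) :
    Measure.euclideanHausdorffMeasure d (f '' s) ≤
      (K : ℝ≥0∞) ^ d * Measure.euclideanHausdorffMeasure d s := by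
  have h := hf.hausdorffMeasure_image_le (d := (d : ℝ)) (Nat.cast_nonneg d)
  rw [ENNReal.rpow_natCast] at h
  simp only [Measure.euclideanHausdorffMeasure_def, Measure.smul_apply, ENNReal.smul_def,
    smul_eq_mul]
  calc _ ≤ _ := mul_le_mul_right h _
    _ = _ := by ring

theorem volume_eq_euclideanHausdorffMeasure (s : Set W) :
    volume s = Measure.euclideanHausdorffMeasure (finrank ℝ W) s := by
  rw [InnerProductSpace.euclideanHausdorffMeasure_eq_volume]

/-- An almost isometric parametrization almost preserves integrals over surfaces. -/
theorem integral_image_of_almost_isometry {B : Set W} (hB : MeasurableSet B)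
    (hBf : volume B ≠ ⊤) {f : W → X} {ε : ℝ} (hε0 : 0 ≤ ε) (hε1 : ε < 1)
    (hf : ∀ y ∈ B, ∀ y' ∈ B, |dist (f y) (f y') - ‖y - y'‖| ≤ ε * ‖y - y'‖)
    {F : X → ℝ} (hF : Continuous F) (hF0 : ∀ x, 0 ≤ F x) {C : ℝ} (hC : ∀ x, F x ≤ C) :
    Measure.euclideanHausdorffMeasure (finrank ℝ W) (f '' B) < ⊤ ∧
    ∫ x in f '' B, F x ∂Measure.euclideanHausdorffMeasure (finrank ℝ W) ≤
      (1 + ε) ^ finrank ℝ W * ∫ y in B, F (f y) ∧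
    ∫ y in B, F (f y) ≤ ((1 - ε)⁻¹) ^ finrank ℝ W *
      ∫ x in f '' B, F x ∂Measure.euclideanHausdorffMeasure (finrank ℝ W) := by
  set d := finrank ℝ W with hd
  set μ : Measure X := Measure.euclideanHausdorffMeasure d with hμ
  set K : ℝ≥0 := ⟨1 + ε, by linarith⟩ with hK
  have h1ε : 0 < 1 - ε := by linarith
  set K' : ℝ≥0 := ⟨(1 - ε)⁻¹, by positivity⟩ with hK'
  have hlip : LipschitzOnWith K f B := LipschitzOnWith.of_dist_le_mul fun y hy y' hy' => by
    have := (abs_le.1 (hf y hy y' hy')).2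
    rw [dist_eq_norm y y']
    change _ ≤ (1 + ε) * _
    linarith
  have hanti : ∀ y ∈ B, ∀ y' ∈ B, dist y y' ≤ K' * dist (f y) (f y') := fun y hy y' hy' => by
    have := (abs_le.1 (hf y hy y' hy')).1
    rw [dist_eq_norm y y']
    change _ ≤ (1 - ε)⁻¹ * _
    rw [inv_mul_eq_div, le_div_iff₀ h1ε]
    linarith
  have hinj : InjOn f B := fun y hy y' hy' h => by
    have := hanti y hy y' hy'
    rw [h, dist_self, mul_zero] at this
    exact dist_le_zero.1 this
  have up : ∀ s ⊆ B, μ (f '' s) ≤ (K : ℝ≥0∞) ^ d * volume s := fun s hs => by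
    rw [volume_eq_euclideanHausdorffMeasure]
    exact (hlip.mono hs).euclideanHausdorffMeasure_image_le d
  have down : ∀ s ⊆ B, volume s ≤ (K' : ℝ≥0∞) ^ d * μ (f '' s) := fun s hs => by
    rcases isEmpty_or_nonempty W with hW | hW
    · rw [Subsingleton.elim s ∅]; simp
    have hl : LipschitzOnWith K' (Function.invFunOn f B) (f '' s) := by
      refine LipschitzOnWith.of_dist_le_mul ?_
      rintro _ ⟨y, hy, rfl⟩ _ ⟨y', hy', rfl⟩
      rw [hinj.leftInvOn_invFunOn (hs hy), hinj.leftInvOn_invFunOn (hs hy')]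
      exact hanti y (hs hy) y' (hs hy')
    have him : Function.invFunOn f B '' (f '' s) = s :=
      (hinj.leftInvOn_invFunOn.mono hs).image_image
    have := hl.euclideanHausdorffMeasure_image_le d
    rwa [him, ← volume_eq_euclideanHausdorffMeasure] at this
  have hcont : ContinuousOn f B := hlip.continuousOn
  have hmeas : AEMeasurable f (volume.restrict B) := hcont.aemeasurable hB
  set m := (volume.restrict B).map f with hm
  have hmapp : ∀ A, MeasurableSet A → m A = volume (f ⁻¹' A ∩ B) := fun A hA => by
    rw [hm, Measure.map_apply_of_aemeasurable hmeas hA, Measure.restrict_apply' hB]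
  have him : ∀ A, A ∩ f '' B = f '' (f ⁻¹' A ∩ B) := fun A => by
    rw [inter_comm (f ⁻¹' A), image_inter_preimage, inter_comm]
  -- The Lipschitz bounds for `f` and for its inverse, applied to all measurable subsets, become two
  -- inequalities between the surface measure on the image and the pushforward of Lebesgue measure.
  -- As `F ≥ 0`, they can be integrated.
  have le1 : μ.restrict (f '' B) ≤ (K : ℝ≥0∞) ^ d • m := Measure.le_iff.2 fun A hA => by
    rw [Measure.restrict_apply hA, Measure.smul_apply, hmapp A hA, him, smul_eq_mul]
    exact up _ inter_subset_right
  have le2 : m ≤ (K' : ℝ≥0∞) ^ d • μ.restrict (f '' B) := Measure.le_iff.2 fun A hA => by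
    rw [Measure.smul_apply, Measure.restrict_apply hA, hmapp A hA, him, smul_eq_mul]
    exact down _ inter_subset_right
  have hfin : μ (f '' B) < ⊤ := (up B Subset.rfl).trans_lt
    (ENNReal.mul_lt_top (by finiteness) hBf.lt_top)
  have hbd : ∀ x, ‖F x‖ ≤ C := fun x => by rw [Real.norm_eq_abs, abs_of_nonneg (hF0 x)]; exact hC x
  have hfm : IsFiniteMeasure (μ.restrict (f '' B)) := ⟨by rwa [Measure.restrict_apply_univ]⟩
  have hfB : IsFiniteMeasure (volume.restrict B) := ⟨by
    rw [Measure.restrict_apply_univ]; exact hBf.lt_top⟩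
  have hfm' : IsFiniteMeasure m := by rw [hm]; infer_instance
  have i1 : Integrable F (μ.restrict (f '' B)) :=
    Integrable.of_bound hF.aestronglyMeasurable C (Eventually.of_forall hbd)
  have i2 : Integrable F m :=
    Integrable.of_bound hF.aestronglyMeasurable C (Eventually.of_forall hbd)
  have emap : ∫ x, F x ∂m = ∫ y in B, F (f y) := integral_map hmeas hF.aestronglyMeasurable
  refine ⟨hfin, ?_, ?_⟩
  · calc _ ≤ ∫ x, F x ∂((K : ℝ≥0∞) ^ d • m) :=
          integral_mono_measure le1 (Eventually.of_forall hF0) (i2.smul_measure (by finiteness))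
      _ = _ := by
          rw [integral_smul_measure, emap, smul_eq_mul, ENNReal.toReal_pow]; rfl
  · rw [← emap]
    calc _ ≤ ∫ x, F x ∂((K' : ℝ≥0∞) ^ d • μ.restrict (f '' B)) :=
          integral_mono_measure le2 (Eventually.of_forall hF0) (i1.smul_measure (by finiteness))
      _ = _ := by
          rw [integral_smul_measure, smul_eq_mul, ENNReal.toReal_pow]; rfl

end Hausdorff

/-! ### A quantitative implicit function theorem -/

section ZeroSet

variable {W : Type*} [NormedAddCommGroup W] [NormedSpace ℝ W]

/-- Near a zero at which the derivative is vertical, the zero set of a strictly differentiable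
function is a graph of small slope. -/
theorem HasStrictFDerivAt.exists_graph {R : W × ℝ → ℝ} {a : ℝ} (ha : 0 < a)
    (hR : HasStrictFDerivAt R (a • ContinuousLinearMap.snd ℝ W ℝ) 0) (h0 : R 0 = 0)
    {ε : ℝ} (hε : 0 < ε) (hε1 : ε ≤ 1 / 2) :
    ∃ r > 0, ∃ h : W → ℝ, (∀ y t, ‖y‖ < r → |t| < r → (R (y, t) < 0 ↔ t < h y)) ∧
      (∀ y t, ‖y‖ < r → |t| < r → (R (y, t) = 0 ↔ t = h y)) ∧
      (∀ y y', ‖y‖ < r → ‖y'‖ < r → |h y - h y'| ≤ 2 * ε * ‖y - y'‖) ∧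
      ∀ y, ‖y‖ < r → |h y| ≤ 2 * ε * ‖y‖ := by
  have hb := hR.isLittleO.bound (c := a * ε) (by positivity)
  rw [← Prod.zero_eq_mk, Metric.eventually_nhds_iff] at hb
  obtain ⟨r, hr, hb⟩ := hb
  have hest : ∀ z z' : W × ℝ, ‖z.1‖ < r → |z.2| < r → ‖z'.1‖ < r → |z'.2| < r →
      |R z - R z' - a * (z.2 - z'.2)| ≤ a * ε * max ‖z.1 - z'.1‖ |z.2 - z'.2| := by
    intro z z' h1 h2 h3 h4
    have := @hb (z, z') (by
      rw [dist_zero_right, Prod.norm_def, Prod.norm_def, Prod.norm_def]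
      simp [h1, h2, h3, h4])
    simpa [Prod.norm_def] using this
  -- `R` increases along every move that climbs at least `2 ε` times its horizontal length: the
  -- error of the linear approximation is then at most half of the gain `a (t - t')`. Existence,
  -- uniqueness and the Lipschitz bound for the zero in each column all follow from this
  -- monotonicity.
  have mono : ∀ y t y' t', ‖y‖ < r → |t| < r → ‖y'‖ < r → |t'| < r →
      t' < t → 2 * ε * ‖y - y'‖ ≤ t - t' → R (y', t') < R (y, t) := by
    intro y t y' t' h1 h2 h3 h4 h5 h6
    have h7 := (abs_le.1 (hest (y, t) (y', t') h1 h2 h3 h4)).1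
    simp only at h7
    have h8 : ε * max ‖y - y'‖ |t - t'| ≤ (t - t') / 2 := by
      rw [mul_max_of_nonneg _ _ hε.le, _root_.abs_of_pos (sub_pos.2 h5)]
      refine max_le (by linarith) ?_
      nlinarith
    nlinarith [mul_le_mul_of_nonneg_left h8 ha.le, mul_pos ha (sub_pos.2 h5)]
  have hcont : ∀ y, ‖y‖ < r → ContinuousOn (fun t => R (y, t)) {t | |t| < r} := by
    intro y hy
    have : LipschitzOnWith (a * (1 + ε)).toNNReal (fun t => R (y, t)) {t | |t| < r} := by
      refine LipschitzOnWith.of_dist_le_mul fun t ht t' ht' => ?_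
      rw [Real.coe_toNNReal _ (by positivity), Real.dist_eq, Real.dist_eq]
      have h1 := hest (y, t) (y, t') hy ht hy ht'
      simp only [sub_self, norm_zero] at h1
      rw [max_eq_right (abs_nonneg _)] at h1
      have h2 := abs_sub_abs_le_abs_sub (R (y, t) - R (y, t')) (a * (t - t'))
      rw [abs_mul, _root_.abs_of_pos ha] at h2
      linarith
    exact this.continuousOn
  -- The value `R 0 = 0` is compared with the values at heights `± 2 ε ‖y‖` over `y`, which have
  -- opposite signs; `ε ≤ 1 / 2` keeps these heights inside the box.
  have hex : ∀ y, ‖y‖ < r → ∃ t, |t| ≤ 2 * ε * ‖y‖ ∧ |t| < r ∧ R (y, t) = 0 := by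
    intro y hy
    have hle : 2 * ε * ‖y‖ ≤ ‖y‖ := by nlinarith [norm_nonneg y]
    have hnn : 0 ≤ 2 * ε * ‖y‖ := by positivity
    rcases hnn.eq_or_lt with h1 | h1
    · have hy0 : y = 0 := by
        by_contra h
        have := norm_pos_iff.2 h
        have : 0 < 2 * ε * ‖y‖ := by positivity
        linarith
      subst hy0
      exact ⟨0, by simp, by simpa using hr, h0⟩
    have habs : |2 * ε * ‖y‖| < r := by rw [abs_of_nonneg hnn]; linarith
    have hpos := mono y (2 * ε * ‖y‖) 0 0 hy habs (by simpa using hr) (by simpa using hr) h1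
      (by simp)
    have hneg := mono 0 0 y (-(2 * ε * ‖y‖)) (by simpa using hr) (by simpa using hr) hy
      (by rwa [abs_neg]) (by linarith) (by simp)
    have hz : R ((0 : W), (0 : ℝ)) = 0 := h0
    rw [hz] at hpos hneg
    have hsub : Icc (-(2 * ε * ‖y‖)) (2 * ε * ‖y‖) ⊆ {t | |t| < r} := fun t ht =>
      lt_of_le_of_lt (abs_le.2 ht) (by linarith)
    obtain ⟨t, ht, ht0⟩ := intermediate_value_Icc (by linarith)
      ((hcont y hy).mono hsub) (show (0 : ℝ) ∈ Icc _ _ from ⟨hneg.le, hpos.le⟩)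
    exact ⟨t, abs_le.2 ht, hsub ht, ht0⟩
  classical
  let h : W → ℝ := fun y => if hy : ‖y‖ < r then (hex y hy).choose else 0
  have hh : ∀ y, ‖y‖ < r → |h y| ≤ 2 * ε * ‖y‖ ∧ |h y| < r ∧ R (y, h y) = 0 := by
    intro y hy
    simp only [h, hy, dite_true]
    exact (hex y hy).choose_spec
  have mono' : ∀ y t t', ‖y‖ < r → |t| < r → |t'| < r → t' < t → R (y, t') < R (y, t) :=
    fun y t t' hy ht ht' hlt => mono y t y t' hy ht hy ht' hlt (by simp; linarith)
  refine ⟨r, hr, h, ?_, ?_, ?_, fun y hy => (hh y hy).1⟩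
  · intro y t hy ht
    obtain ⟨-, h1, h2⟩ := hh y hy
    constructor
    · intro h3
      by_contra h4
      rcases (not_lt.1 h4).eq_or_lt with h5 | h5
      · rw [← h5, h2] at h3; exact lt_irrefl _ h3
      · have := mono' y t (h y) hy ht h1 h5
        rw [h2] at this; linarith
    · intro h3
      have := mono' y (h y) t hy h1 ht h3
      rwa [h2] at this
  · intro y t hy ht
    obtain ⟨-, h1, h2⟩ := hh y hy
    constructor
    · intro h3
      rcases lt_trichotomy t (h y) with h4 | h4 | h4
      · have := mono' y (h y) t hy h1 ht h4; linarith
      · exact h4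
      · have := mono' y t (h y) hy ht h1 h4; linarith
    · rintro rfl; exact h2
  · intro y y' hy hy'
    obtain ⟨-, h1, h2⟩ := hh y hy
    obtain ⟨-, h1', h2'⟩ := hh y' hy'
    by_contra hlt
    rw [not_le] at hlt
    have hnn : 0 ≤ 2 * ε * ‖y - y'‖ := by positivity
    rcases lt_abs.1 hlt with h3 | h3
    · have := mono y (h y) y' (h y') hy h1 hy' h1' (by linarith) h3.le
      linarith
    · have := mono y' (h y') y (h y) hy' h1' hy h1 (by linarith) (by rw [norm_sub_rev]; linarith)
      linarith

end ZeroSet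

/-! ### Radial projection to first order -/

section Normalize

variable {N X : Type*} [NormedAddCommGroup N] [InnerProductSpace ℝ N]
  [NormedAddCommGroup X] [NormedSpace ℝ X]

theorem norm_inv_smul_mem_sphere {x : N} (hx : x ≠ 0) : ‖x‖⁻¹ • x ∈ sphere (0 : N) 1 := by
  rw [mem_sphere_zero_iff_norm, norm_smul, norm_inv, norm_norm,
    inv_mul_cancel₀ (norm_ne_zero_iff.mpr hx)]

theorem norm_add_sq_of_inner_eq_zero {p v : N} (hp : ‖p‖ = 1) (hv : inner ℝ p v = 0) :
    ‖p + v‖ ^ 2 = 1 + ‖v‖ ^ 2 := by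
  rw [norm_add_sq_real, hv, hp]; ring

theorem one_le_norm_add_of_inner_eq_zero {p v : N} (hp : ‖p‖ = 1) (hv : inner ℝ p v = 0) :
    1 ≤ ‖p + v‖ := by
  have := norm_add_sq_of_inner_eq_zero hp hv
  nlinarith [norm_nonneg (p + v), sq_nonneg ‖v‖]

/-- Radial projection to the sphere is tangentially an isometry to first order. -/
theorem hasStrictFDerivAt_normalize {p : N} (hp : ‖p‖ = 1) (A : X →L[ℝ] N)
    (hA : ∀ x, inner ℝ p (A x) = 0) :
    HasStrictFDerivAt (fun x => ‖p + A x‖⁻¹ • (p + A x)) A 0 := by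
  have hp0 : p ≠ 0 := by rintro rfl; simp at hp
  have h1 : ContDiffAt ℝ 1 (fun x => ‖p + A x‖⁻¹) (0 : X) := by
    have : ContDiffAt ℝ 1 (fun x => ‖p + A x‖) (0 : X) :=
      (contDiff_const.add A.contDiff).contDiffAt.norm ℝ (by simpa using hp0)
    exact this.inv (by simp [hp])
  -- The norm of `p + A x` is least at `x = 0`, so the scalar factor has zero derivative and only
  -- `A` survives in the product rule.
  have hmax : IsLocalMax (fun x => ‖p + A x‖⁻¹) (0 : X) := by
    refine Eventually.of_forall fun x => ?_
    have := one_le_norm_add_of_inner_eq_zero hp (hA x)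
    simpa [hp] using inv_le_one_of_one_le₀ this
  have h2 := h1.hasStrictFDerivAt one_ne_zero
  rw [hmax.fderiv_eq_zero] at h2
  have h3 := h2.smul ((hasStrictFDerivAt_const p (0 : X)).add A.hasStrictFDerivAt)
  convert! h3 using 1
  ext x
  simp [hp]

end Normalize

/-! ### The gnomonic chart of the sphere -/

namespace Splitting

variable {N W : Type*} [NormedAddCommGroup N] [InnerProductSpace ℝ N] [MeasurableSpace N]
  [BorelSpace N] [FiniteDimensional ℝ N] [NormedAddCommGroup W] [InnerProductSpace ℝ W]
  [MeasurableSpace W] [BorelSpace W] [FiniteDimensional ℝ W]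

theorem exists_of_orthonormal {p v : N} (hp : ‖p‖ = 1) (hv : ‖v‖ = 1) (hpv : inner ℝ p v = 0) :
    ∃ T : Splitting N ((Submodule.span ℝ {p, v})ᗮ : Submodule ℝ N), T.pole = p ∧ T.axis = v := by
  set W : Submodule ℝ N := (Submodule.span ℝ {p, v})ᗮ
  have hvp : inner ℝ v p = 0 := by rw [real_inner_comm]; exact hpv
  have hW1 : ∀ y : W, inner ℝ p (y : N) = 0 := fun y =>
    Submodule.mem_orthogonal _ _ |>.1 y.2 p (Submodule.subset_span (by simp))
  have hW2 : ∀ y : W, inner ℝ v (y : N) = 0 := fun y =>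
    Submodule.mem_orthogonal _ _ |>.1 y.2 v (Submodule.subset_span (by simp))
  let L : WithLp 2 (ℝ × WithLp 2 (W × ℝ)) →ₗᵢ[ℝ] N :=
    { toFun := fun q => q.fst • p + ((q.snd.fst : N) + q.snd.snd • v)
      map_add' := fun a b => by simp [add_smul]; abel
      map_smul' := fun c a => by simp [mul_smul]
      norm_map' := fun q => by
        simp only [LinearMap.coe_mk, AddHom.coe_mk]
        rw [← sq_eq_sq₀ (norm_nonneg _) (norm_nonneg _), WithLp.prod_norm_sq_eq_of_L2,
          WithLp.prod_norm_sq_eq_of_L2, ← real_inner_self_eq_norm_sq]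
        simp only [inner_add_left, inner_add_right, inner_smul_left, inner_smul_right, hpv, hvp,
          real_inner_self_eq_norm_sq, hp, hv, hW1, hW2, real_inner_comm p, real_inner_comm v]
        simp
        ring }
  have hsurj : Function.Surjective L := by
    intro x
    have hy : x - (inner ℝ p x • p + inner ℝ v x • v) ∈ W := by
      rw [Submodule.mem_orthogonal]
      intro w hw
      rw [Submodule.mem_span_pair] at hw
      obtain ⟨a, b, rfl⟩ := hw
      simp only [inner_add_left, inner_sub_right, inner_add_right, inner_smul_left,
        inner_smul_right, real_inner_self_eq_norm_sq, hp, hv, hpv, hvp]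
      simp
      ring
    refine ⟨WithLp.toLp 2 (inner ℝ p x, WithLp.toLp 2 (⟨_, hy⟩, inner ℝ v x)), ?_⟩
    change inner ℝ p x • p + ((x - (inner ℝ p x • p + inner ℝ v x • v)) + inner ℝ v x • v) = x
    abel
  refine ⟨LinearIsometryEquiv.ofSurjective L hsurj, ?_, ?_⟩
  · change (1 : ℝ) • p + (((0 : W) : N) + (0 : ℝ) • v) = p
    simp
  · change (0 : ℝ) • p + (((0 : W) : N) + (1 : ℝ) • v) = v
    simp

theorem point_one (T : Splitting N W) (z : W × ℝ) : T.point 1 z = T.pole + T.point 0 z := by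
  rw [pole, ← T.point_add]; simp

theorem inner_pole_point_zero (T : Splitting N W) (z : W × ℝ) :
    inner ℝ T.pole (T.point 0 z) = 0 := T.inner_pole 0 z

theorem inner_axis (T : Splitting N W) (s : ℝ) (z : W × ℝ) :
    inner ℝ T.axis (T.point s z) = z.2 := by
  simp [axis, inner_point]

/-- The gnomonic chart, with values in the unit sphere. -/
def proj (T : Splitting N W) (z : W × ℝ) : sphere (0 : N) 1 :=
  ⟨‖T.point 1 z‖⁻¹ • T.point 1 z, norm_inv_smul_mem_sphere (T.point_ne_zero z)⟩

theorem coe_proj (T : Splitting N W) (z : W × ℝ) :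
    (T.proj z : N) = ‖T.point 1 z‖⁻¹ • T.point 1 z := rfl

theorem continuous_proj (T : Splitting N W) : Continuous T.proj := by
  have h := (T.contDiff_point 1 (k := 0)).continuous
  exact ((h.norm.inv₀ fun z => norm_ne_zero_iff.2 (T.point_ne_zero z)).smul h).subtype_mk _

theorem coe_proj_zero (T : Splitting N W) : (T.proj 0 : N) = T.pole := by
  rw [coe_proj]
  change ‖T.pole‖⁻¹ • T.pole = T.pole
  rw [norm_pole]; simp

/-- The linear part of the gnomonic chart. -/
def pointZeroL (T : Splitting N W) : W × ℝ →L[ℝ] N :=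
  T.pointL.comp (ContinuousLinearMap.inr ℝ ℝ (W × ℝ))

theorem pointZeroL_apply (T : Splitting N W) (z : W × ℝ) : T.pointZeroL z = T.point 0 z := rfl

theorem hasStrictFDerivAt_proj (T : Splitting N W) :
    HasStrictFDerivAt (fun z => (T.proj z : N)) T.pointZeroL 0 := by
  have := hasStrictFDerivAt_normalize T.norm_pole T.pointZeroL T.inner_pole_point_zero
  simp only [pointZeroL_apply, ← point_one] at this
  exact this

theorem norm_point_zero_sq (T : Splitting N W) (z : W × ℝ) :
    ‖T.point 0 z‖ ^ 2 = ‖z.1‖ ^ 2 + z.2 ^ 2 := by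
  rw [norm_point_sq]; ring

theorem norm_fst_le_norm_point (T : Splitting N W) (z : W × ℝ) : ‖z.1‖ ≤ ‖T.point 0 z‖ := by
  have := T.norm_point_zero_sq z
  exact (sq_le_sq₀ (norm_nonneg _) (norm_nonneg _)).1 (by nlinarith [sq_nonneg z.2])

theorem norm_point_zero_le (T : Splitting N W) (z : W × ℝ) :
    ‖T.point 0 z‖ ≤ ‖z.1‖ + |z.2| := by
  have := T.norm_point_zero_sq z
  refine (sq_le_sq₀ (norm_nonneg _) (by positivity)).1 ?_
  rw [this, ← sq_abs z.2]
  nlinarith [norm_nonneg z.1, abs_nonneg z.2, mul_nonneg (norm_nonneg z.1) (abs_nonneg z.2)]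

/-- The inverse of the gnomonic chart. -/
def coord (T : Splitting N W) (x : N) : W × ℝ :=
  (inner ℝ T.pole x)⁻¹ • (T.symm x).ofLp.2.ofLp

theorem coord_smul_point (T : Splitting N W) {s : ℝ} (hs : s ≠ 0) (z : W × ℝ) :
    T.coord (s • T.point 1 z) = z := by
  unfold coord
  rw [inner_smul_right, inner_pole, mul_one, map_smul]
  change s⁻¹ • s • (T.symm (T.point 1 z)).ofLp.2.ofLp = z
  rw [smul_smul, inv_mul_cancel₀ hs, one_smul, point, T.symm_apply_apply]

theorem coord_proj (T : Splitting N W) (z : W × ℝ) : T.coord (T.proj z) = z :=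
  T.coord_smul_point (inv_ne_zero (norm_ne_zero_iff.2 (T.point_ne_zero z))) z

theorem smul_point_coord (T : Splitting N W) {x : N} (hx : inner ℝ T.pole x ≠ 0) :
    inner ℝ T.pole x • T.point 1 (T.coord x) = x := by
  obtain ⟨s, z, rfl⟩ := T.exists_point x
  rw [inner_pole] at *
  have h1 : T.point s z = s • T.point 1 (s⁻¹ • z) := by
    rw [← T.point_smul, smul_smul, mul_inv_cancel₀ hx, one_smul, mul_one]
  rw [h1, T.coord_smul_point hx]

theorem proj_coord (T : Splitting N W) {w : sphere (0 : N) 1} (hw : 0 < inner ℝ T.pole (w : N)) :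
    T.proj (T.coord w) = w := by
  have h1 := T.smul_point_coord hw.ne'
  have h2 : ‖T.point 1 (T.coord w)‖⁻¹ = inner ℝ T.pole (w : N) := by
    have := congrArg norm h1
    rw [norm_smul, norm_eq_of_mem_sphere, Real.norm_eq_abs, abs_of_pos hw] at this
    exact (eq_inv_of_mul_eq_one_left this).symm
  ext1
  rw [coe_proj, h2, h1]

theorem continuousOn_coord (T : Splitting N W) :
    ContinuousOn T.coord {x | 0 < inner ℝ T.pole x} := by
  unfold coord
  refine ContinuousOn.smul (M := ℝ) (X := W × ℝ) ?_ ?_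
  · exact ContinuousOn.inv₀ (by fun_prop) fun x hx => (ne_of_gt hx)
  · have h1 : Continuous fun x => (T.symm x).ofLp.2.ofLp := by
      have h2 : Continuous fun x => T.symm x := T.symm.continuous
      have h3 := (WithLp.prod_continuous_ofLp 2 ℝ (WithLp 2 (W × ℝ))).comp h2
      exact (WithLp.prod_continuous_ofLp 2 W ℝ).comp (continuous_snd.comp h3)
    exact h1.continuousOn

/-- The image in the sphere of the open box of radius `r`. -/
def box (T : Splitting N W) (r : ℝ) : Set (sphere (0 : N) 1) := T.proj '' ball 0 r

theorem inner_pole_proj_pos (T : Splitting N W) (z : W × ℝ) :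
    0 < inner ℝ T.pole (T.proj z : N) := by
  rw [coe_proj, inner_smul_right, inner_pole, mul_one]
  exact inv_pos.2 (norm_pos_iff.2 (T.point_ne_zero z))

theorem isOpen_box (T : Splitting N W) (r : ℝ) : IsOpen (T.box r) := by
  have h1 : T.box r = ((↑) : sphere (0 : N) 1 → N) ⁻¹'
      ({x | 0 < inner ℝ T.pole x} ∩ T.coord ⁻¹' ball 0 r) := by
    ext w
    constructor
    · rintro ⟨z, hz, rfl⟩
      exact ⟨T.inner_pole_proj_pos z, by rw [mem_preimage, coord_proj]; exact hz⟩
    · rintro ⟨h1, h2⟩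
      exact ⟨T.coord w, h2, T.proj_coord h1⟩
  rw [h1]
  refine IsOpen.preimage continuous_subtype_val ?_
  exact T.continuousOn_coord.isOpen_inter_preimage
    (isOpen_lt continuous_const (by fun_prop)) isOpen_ball

/-- Compactness: the chart norm attains on `K` a maximum strictly below `r`, which is the gap
between support and box that the subgraph estimates need. The degree `-(d + 1)` is non-zero, which
forces `φ 0 = 0`, so every point of the support lies on a ray through `K`. -/
theorem exists_supportedIn (T : Splitting N W) {r : ℝ} {d : ℕ} {φ : N → ℝ}
    (hφ : NegHomogeneous (d + 1) φ) {K : Set (sphere (0 : N) 1)} (hK : IsCompact K)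
    (hKr : K ⊆ T.box r) (hs : ∀ w : sphere (0 : N) 1, φ w ≠ 0 → w ∈ K) :
    ∃ r' < r, T.SupportedIn r' φ := by
  have hφ0 : φ 0 = 0 := by
    have h := hφ 2 two_pos 0
    rw [smul_zero, smul_eq_mul] at h
    have h2 : ((2 : ℝ) ^ (d + 1))⁻¹ ≠ 1 := by
      rw [Ne, inv_eq_one]
      exact (one_lt_pow₀ one_lt_two (by omega)).ne'
    by_contra h3
    exact h2 (mul_right_cancel₀ h3 (by rw [one_mul]; exact h.symm))
  have hred : ∀ x, φ x ≠ 0 → ∃ w ∈ K, ∃ s : ℝ, 0 < s ∧ x = s • (w : N) := by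
    intro x hx
    have hx0 : x ≠ 0 := by rintro rfl; exact hx hφ0
    have hn : 0 < ‖x‖ := norm_pos_iff.2 hx0
    refine ⟨⟨_, norm_inv_smul_mem_sphere hx0⟩, hs _ ?_, ‖x‖, hn, ?_⟩
    · simp only
      rw [hφ _ (inv_pos.2 hn)]
      exact smul_ne_zero (by positivity) hx
    · simp [smul_smul, hn.ne']
  rcases K.eq_empty_or_nonempty with rfl | hne
  · refine ⟨r - 1, by linarith, fun x hx => ?_⟩
    obtain ⟨w, hw, -⟩ := hred x hx
    exact absurd hw (notMem_empty _)
  have hpos : ∀ w ∈ K, 0 < inner ℝ T.pole (w : N) := by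
    intro w hw
    obtain ⟨z, -, rfl⟩ := hKr hw
    exact T.inner_pole_proj_pos z
  have hc : ContinuousOn (fun w : sphere (0 : N) 1 => ‖T.coord w‖) K :=
    (T.continuousOn_coord.comp continuous_subtype_val.continuousOn hpos).norm
  obtain ⟨w₀, hw₀, hmax⟩ := hK.exists_isMaxOn hne hc
  refine ⟨‖T.coord w₀‖, ?_, ?_⟩
  · obtain ⟨z, hz, rfl⟩ := hKr hw₀
    rw [coord_proj]; simpa using hz
  · intro x hx
    obtain ⟨w, hw, s, hs, rfl⟩ := hred x hx
    refine ⟨s * inner ℝ T.pole (w : N), mul_pos hs (hpos w hw), T.coord w, hmax hw, ?_⟩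
    rw [mul_smul, T.smul_point_coord (hpos w hw).ne']

end Splitting

/-! ### Cones over subsets of the sphere -/

section Cone

variable {N : Type*} [NormedAddCommGroup N] [InnerProductSpace ℝ N]

/-- The open cone over a subset of the sphere. -/
def coneOver (V : Set (sphere (0 : N) 1)) : Set N :=
  {x | ∃ hx : x ≠ 0, (⟨‖x‖⁻¹ • x, norm_inv_smul_mem_sphere hx⟩ : sphere (0 : N) 1) ∈ V}

theorem smul_mem_coneOver_iff {V : Set (sphere (0 : N) 1)} (r : ℝ) (hr : 0 < r) (x : N) :
    r • x ∈ coneOver V ↔ x ∈ coneOver V := by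
  have h : ‖r • x‖⁻¹ • r • x = ‖x‖⁻¹ • x := by
    rw [norm_smul, Real.norm_eq_abs, abs_of_pos hr, mul_inv, smul_smul, mul_right_comm,
      inv_mul_cancel₀ hr.ne', one_mul]
  unfold coneOver
  simp only [mem_ofPred_eq, h, ne_eq, smul_eq_zero, hr.ne', false_or]

theorem coe_mem_coneOver_iff {V : Set (sphere (0 : N) 1)} (w : sphere (0 : N) 1) :
    (w : N) ∈ coneOver V ↔ w ∈ V := by
  have h0 : (w : N) ≠ 0 := ne_zero_of_mem_unit_sphere w
  simp [coneOver, h0]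

theorem isOpen_coneOver {V : Set (sphere (0 : N) 1)} (hV : IsOpen V) : IsOpen (coneOver V) := by
  rw [isOpen_iff_mem_nhds]
  rintro x ⟨hx, hxV⟩
  obtain ⟨O, hO, rfl⟩ := isOpen_induced_iff.1 hV
  have hc : ContinuousAt (fun x : N => ‖x‖⁻¹ • x) x :=
    (continuousAt_id.norm.inv₀ (norm_ne_zero_iff.2 hx)).smul continuousAt_id
  filter_upwards [hc (hO.mem_nhds hxV), isOpen_compl_singleton.mem_nhds hx] with y hy hy0
  exact ⟨hy0, hy⟩

theorem Splitting.point_mem_coneOver_iff {W : Type*} [MeasurableSpace N] [BorelSpace N]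
    [FiniteDimensional ℝ N] [NormedAddCommGroup W] [InnerProductSpace ℝ W] [MeasurableSpace W]
    [BorelSpace W] [FiniteDimensional ℝ W] (T : Splitting N W) {V : Set (sphere (0 : N) 1)} (z : W × ℝ) :
    T.point 1 z ∈ coneOver V ↔ T.proj z ∈ V :=
  ⟨fun h => h.2, fun h => ⟨T.point_ne_zero z, h⟩⟩

end Cone

/-! ### The outer normal -/

namespace RS

variable {n : ℕ} {V : Set (S n)}

theorem inner_tangGrad (ρ : E (n + 1) → ℝ) (p : S n) :
    inner ℝ (p : E (n + 1)) (tangGrad n ρ p) = 0 := by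
  simp [tangGrad, inner_sub_right, inner_smul_right]

theorem inner_gradient_eq_fderiv (ρ : E (n + 1) → ℝ) (x v : E (n + 1)) :
    inner ℝ (gradient ρ x) v = fderiv ℝ ρ x v := by
  simp [gradient]

theorem inner_tangGrad_left {ρ : E (n + 1) → ℝ} {p : S n} {v : E (n + 1)}
    (hv : inner ℝ (p : E (n + 1)) v = 0) : inner ℝ (tangGrad n ρ p) v = fderiv ℝ ρ p v := by
  rw [tangGrad, inner_sub_left, inner_smul_left, hv, mul_zero, sub_zero, inner_gradient_eq_fderiv]

namespace IsDefiningFunction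

theorem hasDerivAt_comp_normalize {p : S n} {ρ : E (n + 1) → ℝ} (h : IsDefiningFunction n V p ρ)
    {v : E (n + 1)} (hv : inner ℝ (p : E (n + 1)) v = 0) :
    HasDerivAt (fun τ : ℝ => ρ (‖(p : E (n + 1)) + τ • v‖⁻¹ • ((p : E (n + 1)) + τ • v)))
      (inner ℝ (tangGrad n ρ p) v) 0 := by
  have h1 := (hasStrictFDerivAt_normalize (norm_eq_of_mem_sphere p)
    (ContinuousLinearMap.toSpanSingleton ℝ v)
    (fun τ => by simp [inner_smul_right, hv])).hasFDerivAt
  have h2 : HasFDerivAt ρ (fderiv ℝ ρ p) (‖(p : E (n + 1)) +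
      ContinuousLinearMap.toSpanSingleton ℝ v 0‖⁻¹ • ((p : E (n + 1)) +
      ContinuousLinearMap.toSpanSingleton ℝ v 0)) := by
    rw [map_zero, add_zero, norm_eq_of_mem_sphere, inv_one, one_smul]
    exact (h.contDiffAt.differentiableAt one_ne_zero).hasFDerivAt
  have h3 := (h2.comp (0 : ℝ) h1).hasDerivAt
  rw [inner_tangGrad_left hv]
  convert! h3 using 1
  simp

/-- Suppose the unit tangential gradients `a` and `a'` differ, so `⟨a, a'⟩ < 1`. To first order,
moving along `a' - a` decreases `ρ` and increases `ρ'`. Some nearby point of the sphere then has `ρ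
< 0 < ρ'` and would lie both inside and outside `V`. -/
theorem normalized_eq {p : S n} {ρ ρ' : E (n + 1) → ℝ} (h : IsDefiningFunction n V p ρ)
    (h' : IsDefiningFunction n V p ρ') :
    ‖tangGrad n ρ p‖⁻¹ • tangGrad n ρ p = ‖tangGrad n ρ' p‖⁻¹ • tangGrad n ρ' p := by
  set g := tangGrad n ρ p with hg
  set g' := tangGrad n ρ' p with hg'
  have hg0 : 0 < ‖g‖ := norm_pos_iff.2 h.tangGrad_ne_zero
  have hg0' : 0 < ‖g'‖ := norm_pos_iff.2 h'.tangGrad_ne_zero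
  set a := ‖g‖⁻¹ • g with ha
  set a' := ‖g'‖⁻¹ • g' with ha'
  by_contra hne
  have hna : ‖a‖ = 1 := by rw [ha, norm_smul, norm_inv, norm_norm, inv_mul_cancel₀ hg0.ne']
  have hna' : ‖a'‖ = 1 := by rw [ha', norm_smul, norm_inv, norm_norm, inv_mul_cancel₀ hg0'.ne']
  have hlt : inner ℝ a a' < 1 := inner_lt_one_iff_real_of_norm_eq_one hna hna' |>.2 hne
  have hpv : inner ℝ (p : E (n + 1)) (a' - a) = 0 := by
    rw [inner_sub_right, ha, ha', inner_smul_right, inner_smul_right, inner_tangGrad,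
      inner_tangGrad]; simp
  have d1 : inner ℝ g (a' - a) < 0 := by
    have : g = ‖g‖ • a := by rw [ha, smul_smul, mul_inv_cancel₀ hg0.ne', one_smul]
    rw [this, inner_smul_left, inner_sub_right, real_inner_self_eq_norm_sq, hna]
    simp only [conj_trivial]
    nlinarith
  have d2 : 0 < inner ℝ g' (a' - a) := by
    have : g' = ‖g'‖ • a' := by rw [ha', smul_smul, mul_inv_cancel₀ hg0'.ne', one_smul]
    rw [this, inner_smul_left, inner_sub_right, real_inner_self_eq_norm_sq, hna',
      real_inner_comm]
    simp only [conj_trivial]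
    nlinarith
  let c : ℝ → S n := fun τ => if hx : (p : E (n + 1)) + τ • (a' - a) = 0 then p else
    ⟨_, norm_inv_smul_mem_sphere hx⟩
  have hcne : ∀ τ : ℝ, (p : E (n + 1)) + τ • (a' - a) ≠ 0 := fun τ h0 => by
    have := one_le_norm_add_of_inner_eq_zero (v := τ • (a' - a)) (norm_eq_of_mem_sphere p)
      (by rw [inner_smul_right, hpv, mul_zero])
    rw [h0, norm_zero] at this
    linarith
  have hc : ∀ τ, ((c τ : S n) : E (n + 1)) =
      ‖(p : E (n + 1)) + τ • (a' - a)‖⁻¹ • ((p : E (n + 1)) + τ • (a' - a)) := fun τ => by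
    simp only [c, hcne τ, dite_false]
  have hcc : Continuous c := by
    rw [continuous_induced_rng]
    have : (Subtype.val ∘ c) = fun τ : ℝ =>
      ‖(p : E (n + 1)) + τ • (a' - a)‖⁻¹ • ((p : E (n + 1)) + τ • (a' - a)) := funext hc
    rw [this]
    exact Continuous.smul (Continuous.inv₀ (by fun_prop) fun τ => norm_ne_zero_iff.2 (hcne τ))
      (by fun_prop)
  have hc0 : c 0 = p := by
    ext1
    rw [hc, zero_smul, add_zero, norm_eq_of_mem_sphere, inv_one, one_smul]
  have hct : Tendsto c (𝓝[>] 0) (𝓝 p) := by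
    have := hcc.tendsto 0
    rw [hc0] at this
    exact this.mono_left nhdsWithin_le_nhds
  have e1 := h.hasDerivAt_comp_normalize hpv
  have e2 := h'.hasDerivAt_comp_normalize hpv
  simp only [← hc] at e1 e2
  have s1 := (hasDerivAt_iff_tendsto_slope.1 e1).mono_left (nhdsGT_le_nhdsNE 0)
  have s2 := (hasDerivAt_iff_tendsto_slope.1 e2).mono_left (nhdsGT_le_nhdsNE 0)
  obtain ⟨τ, ⟨⟨⟨⟨h1, h2⟩, h3⟩, h4⟩, h5⟩⟩ := ((((s1.eventually (gt_mem_nhds d1)).and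
    (s2.eventually (lt_mem_nhds d2))).and (hct.eventually h.mem_iff)).and
    (hct.eventually h'.mem_iff)).and self_mem_nhdsWithin |>.exists
  have h5 : 0 < τ := h5
  rw [slope_def_field, hc0, h.eq_zero, sub_zero, sub_zero, div_neg_iff] at h1
  rw [slope_def_field, hc0, h'.eq_zero, sub_zero, sub_zero, div_pos_iff] at h2
  have k1 : ρ (c τ) < 0 := by
    rcases h1 with h1 | h1
    · linarith [h1.2]
    · exact h1.1
  have k2 : 0 < ρ' (c τ) := by
    rcases h2 with h2 | h2
    · exact h2.1
    · linarith [h2.2]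
  have := h4.1 (h3.2 k1)
  linarith

theorem outerNormal_eq {p : S n} {ρ : E (n + 1) → ℝ} (h : IsDefiningFunction n V p ρ) :
    outerNormal n V p = ‖tangGrad n ρ p‖⁻¹ • tangGrad n ρ p := by
  have hex : ∃ ρ : E (n + 1) → ℝ, IsDefiningFunction n V p ρ := ⟨ρ, h⟩
  rw [outerNormal, dif_pos hex]
  exact hex.choose_spec.normalized_eq h

theorem norm_outerNormal {p : S n} {ρ : E (n + 1) → ℝ} (h : IsDefiningFunction n V p ρ) :
    ‖outerNormal n V p‖ = 1 := by
  rw [h.outerNormal_eq, norm_smul, norm_inv, norm_norm,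
    inv_mul_cancel₀ (norm_ne_zero_iff.2 h.tangGrad_ne_zero)]

theorem inner_outerNormal {p : S n} {ρ : E (n + 1) → ℝ} (h : IsDefiningFunction n V p ρ) :
    inner ℝ (p : E (n + 1)) (outerNormal n V p) = 0 := by
  rw [h.outerNormal_eq, inner_smul_right, inner_tangGrad, mul_zero]

theorem continuousAt_tangGrad {p : S n} {ρ : E (n + 1) → ℝ} (h : IsDefiningFunction n V p ρ) :
    ContinuousAt (tangGrad n ρ) p := by
  have h1 : ContinuousAt (fun q : S n => gradient ρ (q : E (n + 1))) p := by
    have h2 : ContinuousAt (fderiv ℝ ρ) (p : E (n + 1)) :=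
      (h.contDiffAt.fderiv_right (m := 0) le_rfl).continuousAt
    have h3 : ContinuousAt (gradient ρ) (p : E (n + 1)) :=
      ((InnerProductSpace.toDual ℝ (E (n + 1))).symm.continuous.continuousAt).comp h2
    exact ContinuousAt.comp (f := ((↑) : S n → E (n + 1))) h3 continuous_subtype_val.continuousAt
  have h4 : ContinuousAt (fun q : S n => (q : E (n + 1))) p := continuous_subtype_val.continuousAt
  exact h1.sub ((h4.inner (𝕜 := ℝ) h1).smul h4)

/-- One `ρ` serves all boundary points near `p`, which makes the outer normal continuous there. Only
`ρ q = 0` needs an argument: if `ρ q > 0`, a neighbourhood of `q` misses `V`; if `ρ q < 0`, then `q`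
lies in the open set `V`. Neither is possible on the frontier. -/
theorem eventually_isDefiningFunction (hV : IsOpen V) {p : S n} {ρ : E (n + 1) → ℝ}
    (h : IsDefiningFunction n V p ρ) :
    ∀ᶠ q in 𝓝 p, q ∈ frontier V → IsDefiningFunction n V q ρ := by
  have h1 : ∀ᶠ q : S n in 𝓝 p, ContDiffAt ℝ 1 ρ (q : E (n + 1)) :=
    continuous_subtype_val.continuousAt.eventually (h.contDiffAt.eventually (by simp))
  have h2 : ∀ᶠ q in 𝓝 p, tangGrad n ρ q ≠ 0 :=
    h.continuousAt_tangGrad.eventually_ne h.tangGrad_ne_zero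
  filter_upwards [h1, h2, h.mem_iff.eventually_nhds] with q hq1 hq2 hq3 hqf
  refine ⟨hq1, ?_, hq2, hq3⟩
  have hcont : ContinuousAt (fun x : S n => ρ x) q :=
    ContinuousAt.comp (f := ((↑) : S n → E (n + 1))) hq1.continuousAt
      continuous_subtype_val.continuousAt
  rw [hV.frontier_eq] at hqf
  refine le_antisymm ?_ ?_
  · have hcl := mem_closure_iff_frequently.1 hqf.1
    by_contra hlt
    have h5 : ∀ᶠ x : S n in 𝓝 q, 0 < ρ x := hcont.eventually (lt_mem_nhds (not_le.1 hlt))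
    obtain ⟨x, hx, hx2, hx3⟩ := (hcl.and_eventually (h5.and hq3)).exists
    linarith [hx3.1 hx]
  · by_contra hlt
    exact hqf.2 (hq3.self_of_nhds.2 (not_le.1 hlt))

end IsDefiningFunction

theorem continuousOn_outerNormal (hV : IsOpen V) (hb : HasC1Boundary n V) :
    ContinuousOn (outerNormal n V) (frontier V) := by
  intro p hp
  obtain ⟨ρ, h⟩ := hb p hp
  have h1 : ContinuousAt (fun q => ‖tangGrad n ρ q‖⁻¹ • tangGrad n ρ q) p :=
    (h.continuousAt_tangGrad.norm.inv₀ (norm_ne_zero_iff.2 h.tangGrad_ne_zero)).smul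
      h.continuousAt_tangGrad
  refine h1.continuousWithinAt.congr_of_eventuallyEq ?_ h.outerNormal_eq
  filter_upwards [nhdsWithin_le_nhds (h.eventually_isDefiningFunction hV), self_mem_nhdsWithin]
    with q hq hqf using (hq hqf).outerNormal_eq

/-! ### Graph charts at the boundary, and the local estimate off the boundary -/

variable {n : ℕ} {V : Set (S n)}
  {W : Type*} [NormedAddCommGroup W] [InnerProductSpace ℝ W]
  [MeasurableSpace W] [BorelSpace W] [FiniteDimensional ℝ W]

/-- In gnomonic coordinates adapted to a boundary point, the domain is the subgraph of a function
of small slope and the boundary is its almost isometrically parametrized graph. -/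
theorem exists_graph_chart (hV : IsOpen V) {p : S n}
    {ρ : E (n + 1) → ℝ} (hρ : IsDefiningFunction n V p ρ) (T : Splitting (E (n + 1)) W)
    (hT : T.pole = p) (hT' : T.axis = outerNormal n V p) {O : Set (S n)} (hO : O ∈ 𝓝 p)
    {ε : ℝ} (hε : 0 < ε) (hε1 : ε ≤ 1 / 2) :
    ∃ r > 0, r ≤ ε ∧ ∃ h : W → ℝ, IsSubgraph (T.point 1 ⁻¹' coneOver V) h r ∧
      (∀ y t, ‖y‖ < r → |t| < r → (T.proj (y, t) ∈ frontier V ↔ t = h y)) ∧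
      (∀ y y', ‖y‖ < r → ‖y'‖ < r → |h y - h y'| ≤ 2 * ε * ‖y - y'‖) ∧
      (∀ y, ‖y‖ < r → |h y| ≤ 2 * ε * ‖y‖) ∧
      (∀ y ∈ ball (0 : W) r, ∀ y' ∈ ball (0 : W) r,
        |dist (T.proj (y, h y)) (T.proj (y', h y')) - ‖y - y'‖| ≤ 3 * ε * ‖y - y'‖) ∧
      ∀ z ∈ ball (0 : W × ℝ) r, T.proj z ∈ O := by
  have hproj0 : T.proj 0 = p := by ext1; rw [T.coe_proj_zero, hT]
  set a := ‖tangGrad n ρ p‖ with ha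
  have ha0 : 0 < a := norm_pos_iff.2 hρ.tangGrad_ne_zero
  -- The tangential gradient at `p` is `a` times the last axis of the splitting, and the chart has
  -- derivative `T.point 0`, so the derivative of the pulled back `ρ` is vertical.
  have hR : HasStrictFDerivAt (fun z => ρ (T.proj z)) (a • ContinuousLinearMap.snd ℝ W ℝ) 0 := by
    have h1 : HasStrictFDerivAt ρ (fderiv ℝ ρ p) ((T.proj 0 : S n) : E (n + 1)) := by
      rw [hproj0]; exact hρ.contDiffAt.hasStrictFDerivAt one_ne_zero
    have h2 := h1.comp (0 : W × ℝ) T.hasStrictFDerivAt_proj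
    convert! h2 using 1
    refine ContinuousLinearMap.ext fun z => ?_
    rw [ContinuousLinearMap.comp_apply, T.pointZeroL_apply, ← inner_tangGrad_left
      (by rw [← hT]; exact T.inner_pole_point_zero z)]
    have h3 : tangGrad n ρ p = a • T.axis := by
      rw [hT', hρ.outerNormal_eq, smul_smul, mul_inv_cancel₀ ha0.ne', one_smul]
    rw [h3, inner_smul_left, T.inner_axis]
    simp
  obtain ⟨r₁, hr₁, h, hneg, hzero, hlip, hbd⟩ := hR.exists_graph ha0
    (by simpa [hproj0] using hρ.eq_zero) hε hε1
  have hb := T.hasStrictFDerivAt_proj.isLittleO.bound hε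
  rw [← Prod.zero_eq_mk, Metric.eventually_nhds_iff] at hb
  obtain ⟨r₂, hr₂, hb⟩ := hb
  have hcp : Tendsto T.proj (𝓝 0) (𝓝 p) := by
    have := T.continuous_proj.tendsto 0
    rwa [hproj0] at this
  have hev := (hcp.eventually hρ.mem_iff).and ((hcp.eventually
    (hρ.eventually_isDefiningFunction hV)).and (hcp.eventually_mem hO))
  rw [Metric.eventually_nhds_iff] at hev
  obtain ⟨r₃, hr₃, hev⟩ := hev
  set r := min ε (min r₁ (min r₂ r₃)) with hr
  have hr0 : 0 < r := by positivity
  have hrε : r ≤ ε := min_le_left _ _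
  have hrr₁ : r ≤ r₁ := (min_le_right _ _).trans (min_le_left _ _)
  have hrr₂ : r ≤ r₂ := (min_le_right _ _).trans ((min_le_right _ _).trans (min_le_left _ _))
  have hrr₃ : r ≤ r₃ := (min_le_right _ _).trans ((min_le_right _ _).trans (min_le_right _ _))
  have hbox : ∀ y t, ‖y‖ < r → |t| < r → ‖((y, t) : W × ℝ)‖ < r := fun y t hy ht => by
    rw [Prod.norm_def]; exact max_lt hy ht
  have hVmem : ∀ y t, ‖y‖ < r → |t| < r → (T.proj (y, t) ∈ V ↔ t < h y) := fun y t hy ht => by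
    have h1 := (@hev (y, t) (by rw [dist_zero_right]; exact (hbox y t hy ht).trans_le hrr₃)).1
    rw [h1]
    exact hneg y t (hy.trans_le hrr₁) (ht.trans_le hrr₁)
  have hhr : ∀ y, ‖y‖ < r → |h y| < r := fun y hy =>
    (hbd y (hy.trans_le hrr₁)).trans_lt (by nlinarith [norm_nonneg y])
  refine ⟨r, hr0, hrε, h, ⟨?_, ?_⟩, ?_, ?_, ?_, ?_, ?_⟩
  · exact (isOpen_coneOver hV).measurableSet.preimage (T.contDiff_point 1 (k := 0)).continuous.measurable
  · intro y t hy ht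
    rw [mem_preimage, T.point_mem_coneOver_iff]
    exact hVmem y t hy ht
  · intro y t hy ht
    have h1 := @hev (y, t) (by rw [dist_zero_right]; exact (hbox y t hy ht).trans_le hrr₃)
    constructor
    · intro hf
      exact (hzero y t (hy.trans_le hrr₁) (ht.trans_le hrr₁)).1 (h1.2.1 hf).eq_zero
    · rintro rfl
      rw [hV.frontier_eq]
      refine ⟨?_, fun hm => lt_irrefl _ ((hVmem y _ hy ht).1 hm)⟩
      have hc : Tendsto (fun t => T.proj (y, t)) (𝓝[<] (h y)) (𝓝 (T.proj (y, h y))) :=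
        ((T.continuous_proj.comp (by fun_prop : Continuous fun t : ℝ => (y, t))).tendsto
          (h y)).mono_left nhdsWithin_le_nhds
      refine mem_closure_of_tendsto hc ?_
      have h2 : ∀ᶠ t in 𝓝[<] (h y), |t| < r :=
        nhdsWithin_le_nhds ((continuous_abs.tendsto (h y)).eventually (gt_mem_nhds ht))
      filter_upwards [h2, self_mem_nhdsWithin] with t ht2 ht3
      exact (hVmem y t hy ht2).2 ht3
  · exact fun y y' hy hy' => hlip y y' (hy.trans_le hrr₁) (hy'.trans_le hrr₁)
  · exact fun y hy => hbd y (hy.trans_le hrr₁)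
  · intro y hy y' hy'
    rw [mem_ball_zero_iff] at hy hy'
    have h1 := hlip y y' (hy.trans_le hrr₁) (hy'.trans_le hrr₁)
    have h2 := @hb ((y, h y), (y', h y')) (by
      rw [dist_zero_right, Prod.norm_def, max_lt_iff]
      exact ⟨(hbox _ _ hy (hhr y hy)).trans_le hrr₂, (hbox _ _ hy' (hhr y' hy')).trans_le hrr₂⟩)
    simp only [Prod.mk_sub_mk, T.pointZeroL_apply] at h2
    -- As `2 ε ≤ 1`, the sup norm of the displacement is attained by its base part. The constant `3
    -- ε` is `ε` from the chart plus `2 ε` from the change of height.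
    have h3 : ‖((y - y', h y - h y') : W × ℝ)‖ ≤ ‖y - y'‖ := by
      rw [norm_le_iff_prod]
      exact ⟨le_rfl, h1.trans (by nlinarith [norm_nonneg (y - y')])⟩
    have h4 := T.norm_fst_le_norm_point (y - y', h y - h y')
    have h5 := T.norm_point_zero_le (y - y', h y - h y')
    simp only at h4 h5
    rw [Subtype.dist_eq, dist_eq_norm]
    have h6 := abs_norm_sub_norm_le ((T.proj (y, h y) : E (n + 1)) - T.proj (y', h y'))
      (T.point 0 (y - y', h y - h y'))
    have h7 := h6.trans (h2.trans (mul_le_mul_of_nonneg_left h3 hε.le))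
    rw [abs_le] at h7 ⊢
    constructor <;> linarith
  · intro z hz
    rw [mem_ball_zero_iff] at hz
    exact (@hev z (by rw [dist_zero_right]; exact hz.trans_le hrr₃)).2.2

/-- The divergence theorem near a point of the sphere, up to a small relative error. -/
def LocalEstimate (V : Set (S n)) (v : E (n + 1)) (δ : ℝ) (O : Set (S n)) : Prop :=
  ∀ φ : E (n + 1) → ℝ, ContDiffOn ℝ 1 φ {0}ᶜ → NegHomogeneous n φ → (∀ x, 0 ≤ φ x) →
    ∀ K : Set (S n), IsCompact K → K ⊆ O → (∀ w : S n, φ w ≠ 0 → w ∈ K) →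
    |(∫ w in V, fderiv ℝ φ w v ∂areaMeasure n) -
      ∫ w in frontier V, inner ℝ v (outerNormal n V w) * φ w ∂hypersurfaceMeasure n| ≤
      δ * ∫ w in frontier V, φ w ∂hypersurfaceMeasure n

theorem coe_preimage_coneOver : ((↑) : S n → E (n + 1)) ⁻¹' coneOver V = V := by
  ext w; exact coe_mem_coneOver_iff w

theorem integral_eq_zero_of_forall_mem {X : Type*} [MeasurableSpace X] {μ : Measure X} {A : Set X}
    (hA : MeasurableSet A) {F : X → ℝ} (hF : ∀ x ∈ A, F x = 0) : ∫ x in A, F x ∂μ = 0 := by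
  rw [setIntegral_congr_fun hA (g := fun _ => (0 : ℝ)) hF, integral_zero]

/-- Near `p` the domain is everything or nothing, so in the chart it is the subgraph of the constant
`r` or `-r`. The slope is zero and the graph misses the support of `φ`, so both the boundary term
and the error term of the general estimate vanish. -/
theorem exists_localEstimate_of_notMem_frontier (hn : 1 ≤ n) (hV : IsOpen V) {p : S n}
    (hp : p ∉ frontier V) (v : E (n + 1)) {δ : ℝ} :
    ∃ O : Set (S n), IsOpen O ∧ p ∈ O ∧ hypersurfaceMeasure n (frontier V ∩ O) < ⊤ ∧
      LocalEstimate V v δ O := by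
  -- The last axis is an arbitrary unit tangent vector; `n ≥ 1` supplies one.
  obtain ⟨ν, hν, hpν⟩ : ∃ ν : E (n + 1), ‖ν‖ = 1 ∧ inner ℝ (p : E (n + 1)) ν = 0 := by
    have h1 : 0 < finrank ℝ ((ℝ ∙ (p : E (n + 1)))ᗮ : Submodule ℝ (E (n + 1))) := by
      have h2 := Submodule.finrank_add_finrank_orthogonal (ℝ ∙ (p : E (n + 1)))
      rw [finrank_span_singleton (ne_zero_of_mem_unit_sphere p), finrank_euclideanSpace,
        Fintype.card_fin] at h2
      omega
    have : Nontrivial ((ℝ ∙ (p : E (n + 1)))ᗮ : Submodule ℝ (E (n + 1))) :=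
      Module.nontrivial_of_finrank_pos h1
    obtain ⟨ν, hν⟩ := exists_norm_eq ((ℝ ∙ (p : E (n + 1)))ᗮ : Submodule ℝ (E (n + 1))) zero_le_one
    exact ⟨ν, by simpa using hν,
      Submodule.mem_orthogonal _ _ |>.1 ν.2 _ (Submodule.mem_span_singleton_self _)⟩
  obtain ⟨T, hT, -⟩ := Splitting.exists_of_orthonormal (norm_eq_of_mem_sphere p) hν hpν
  have hfr : finrank ℝ ((Submodule.span ℝ {(p : E (n + 1)), ν})ᗮ : Submodule ℝ (E (n + 1))) + 1
      = n := by
    have := T.finrank_eq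
    rw [finrank_euclideanSpace, Fintype.card_fin] at this
    omega
  have hproj0 : T.proj 0 = p := by ext1; rw [T.coe_proj_zero, hT]
  have hcp : Tendsto T.proj (𝓝 0) (𝓝 p) := by
    have := T.continuous_proj.tendsto 0
    rwa [hproj0] at this
  have hmeas : MeasurableSet (T.point 1 ⁻¹' coneOver V) :=
    (isOpen_coneOver hV).measurableSet.preimage (T.contDiff_point 1 (k := 0)).continuous.measurable
  have key : ∃ r > 0, r ≤ 1 ∧ ∃ h : ((Submodule.span ℝ {(p : E (n + 1)), ν})ᗮ : Submodule ℝ (E (n + 1))) → ℝ,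
      IsSubgraph (T.point 1 ⁻¹' coneOver V) h r ∧ (∀ y y', h y = h y') ∧ (∀ y, |h y| = r) ∧
      T.box r ∩ frontier V = ∅ := by
    have hsplit : (V ∈ 𝓝 p ∨ (closure V)ᶜ ∈ 𝓝 p) := by
      by_cases hpV : p ∈ V
      · exact Or.inl (hV.mem_nhds hpV)
      · refine Or.inr (isClosed_closure.isOpen_compl.mem_nhds fun hc => hp ?_)
        rw [hV.frontier_eq]; exact ⟨hc, hpV⟩
    rcases hsplit with hsp | hsp
    all_goals
      have hev := hcp.eventually_mem hsp
      rw [Metric.eventually_nhds_iff] at hev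
      obtain ⟨r₀, hr₀, hev⟩ := hev
      have hmem : ∀ z : ((Submodule.span ℝ {(p : E (n + 1)), ν})ᗮ : Submodule ℝ (E (n + 1))) × ℝ,
        ‖z‖ < min 1 r₀ → _ := fun z hz =>
          @hev z (by rw [dist_zero_right]; exact hz.trans_le (min_le_right _ _))
      have hpos : 0 < min 1 r₀ := by positivity
    · refine ⟨min 1 r₀, hpos, min_le_left _ _, fun _ => min 1 r₀, ⟨hmeas, ?_⟩,
        fun _ _ => rfl, fun _ => abs_of_pos hpos, ?_⟩
      · intro y t hy ht
        rw [mem_preimage, T.point_mem_coneOver_iff]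
        refine iff_of_true (hmem (y, t) ?_) (lt_of_abs_lt ht)
        rw [Prod.norm_def]; exact max_lt hy ht
      · rw [eq_empty_iff_forall_notMem]
        rintro _ ⟨⟨z, hz, rfl⟩, hf⟩
        rw [hV.frontier_eq] at hf
        exact hf.2 (hmem z (by simpa using hz))
    · refine ⟨min 1 r₀, hpos, min_le_left _ _, fun _ => -min 1 r₀, ⟨hmeas, ?_⟩,
        fun _ _ => rfl, fun _ => by rw [abs_neg, abs_of_pos hpos], ?_⟩
      · intro y t hy ht
        rw [mem_preimage, T.point_mem_coneOver_iff]
        refine iff_of_false (fun hm => hmem (y, t) ?_ (subset_closure hm)) ?_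
        · rw [Prod.norm_def]; exact max_lt hy ht
        · have := neg_lt_of_abs_lt ht; linarith
      · rw [eq_empty_iff_forall_notMem]
        rintro _ ⟨⟨z, hz, rfl⟩, hf⟩
        exact hmem z (by simpa using hz) hf.1
  obtain ⟨r, hr0, hr1, h, hΩ, hconst, habs, hdisj⟩ := key
  refine ⟨T.box r, T.isOpen_box r, ⟨0, by simpa using hr0, hproj0⟩, ?_, ?_⟩
  · rw [inter_comm, hdisj, measure_empty]; exact ENNReal.zero_lt_top
  intro φ hφ hφh hφ0 K hK hKO hsK
  replace hφh : NegHomogeneous (finrank ℝ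
      ((Submodule.span ℝ {(p : E (n + 1)), ν})ᗮ : Submodule ℝ (E (n + 1))) + 1) φ := by
    rwa [hfr]
  obtain ⟨r', hr', hsupp⟩ := T.exists_supportedIn hφh hK hKO hsK
  have hmf : MeasurableSet (frontier V) := isClosed_frontier.measurableSet
  have hzero : ∀ w ∈ frontier V, φ w = 0 := fun w hw => by
    by_contra h0
    have : w ∈ T.box r ∩ frontier V := ⟨hKO (hsK w h0), hw⟩
    rw [hdisj] at this; exact this
  rw [integral_eq_zero_of_forall_mem hmf hzero,
    integral_eq_zero_of_forall_mem hmf fun w hw => by rw [hzero w hw, mul_zero], mul_zero, sub_zero]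
  obtain ⟨α, ⟨e, β⟩, rfl⟩ := T.exists_point v
  have hQ : ∫ y, φ (T.point 1 (y, h y)) = 0 := by
    rw [← integral_zero _ ℝ]
    congr 1
    funext y
    by_contra h0
    have h1 := (norm_le_iff_prod.1 (hsupp.norm_le h0)).2
    simp only [habs] at h1
    linarith
  have hest := T.abs_integral_sphere_fderiv_sub_le hφ hφ0 hφh hr1 hr' hsupp
    (isOpen_coneOver hV).measurableSet smul_mem_coneOver_iff hΩ le_rfl
    (fun y y' _ _ => by rw [hconst y y']; simp) (fun y _ => (habs y).le) α β e
  rw [hQ, mul_zero, mul_zero, sub_zero] at hest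
  exact (le_of_eq (by rw [coe_preimage_coneOver]; rfl)).trans hest

/-! ### The local estimate at boundary points -/

variable {n : ℕ} {V : Set (S n)}

/-- All three quantities depend continuously on `ε` and have the right limits at 0. In the
application they measure the distortion of the surface measure, that distortion combined with the
radial factor between plane and sphere, and the error of the flat divergence theorem. -/
theorem exists_small_slope (d m : ℕ) (C : ℝ) {δ : ℝ} (hδ : 0 < δ) :
    ∃ ε : ℝ, 0 < ε ∧ ε ≤ 1 / 6 ∧ ((1 - 3 * ε)⁻¹) ^ d ≤ 1 + δ ∧
      1 - δ ≤ ((1 + 2 * ε) ^ m * (1 + 3 * ε) ^ d)⁻¹ ∧ C * ε ≤ δ := by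
  have t1 : Tendsto (fun ε : ℝ => ((1 - 3 * ε)⁻¹) ^ d) (𝓝[>] 0) (𝓝 1) := by
    have : ContinuousAt (fun ε : ℝ => ((1 - 3 * ε)⁻¹) ^ d) 0 :=
      (ContinuousAt.inv₀ (by fun_prop) (by simp)).pow d
    have h := this.tendsto
    simp only [mul_zero, sub_zero, inv_one, one_pow] at h
    exact h.mono_left nhdsWithin_le_nhds
  have t2 : Tendsto (fun ε : ℝ => ((1 + 2 * ε) ^ m * (1 + 3 * ε) ^ d)⁻¹) (𝓝[>] 0) (𝓝 1) := by
    have : ContinuousAt (fun ε : ℝ => ((1 + 2 * ε) ^ m * (1 + 3 * ε) ^ d)⁻¹) 0 :=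
      ContinuousAt.inv₀ (by fun_prop) (by simp)
    have h := this.tendsto
    simp only [mul_zero, add_zero, inv_one, one_pow, mul_one] at h
    exact h.mono_left nhdsWithin_le_nhds
  have t3 : Tendsto (fun ε : ℝ => C * ε) (𝓝[>] 0) (𝓝 0) := by
    have : ContinuousAt (fun ε : ℝ => C * ε) 0 := by fun_prop
    have h := this.tendsto
    rw [mul_zero] at h
    exact h.mono_left nhdsWithin_le_nhds
  have t4 : ∀ᶠ ε : ℝ in 𝓝[>] 0, ε < 1 / 6 := nhdsWithin_le_nhds (gt_mem_nhds (by norm_num))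
  obtain ⟨ε, ⟨⟨⟨⟨h1, h2⟩, h3⟩, h4⟩, h5⟩⟩ := ((((t1.eventually (gt_mem_nhds (by linarith :
    (1 : ℝ) < 1 + δ))).and (t2.eventually (lt_mem_nhds (by linarith : 1 - δ < (1 : ℝ))))).and
    (t3.eventually (gt_mem_nhds hδ))).and t4).and self_mem_nhdsWithin |>.exists
  exact ⟨ε, h5, h4.le, h1.le, h2.le, h3.le⟩

-- With `σ` the surface integral of `φ` and `Q` its flat counterpart over the tangent plane, three
-- errors are added: at most `2 δ' σ` from the divergence estimate with boundary term `β Q`, at most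
-- `‖v‖ δ' σ` from replacing `Q` by `σ`, and at most `δ' σ` from replacing `⟨v, ν⟩` by its value `β`
-- at `p`.
set_option maxHeartbeats 1000000 in
theorem exists_localEstimate_of_mem_frontier (hV : IsOpen V) (hb : HasC1Boundary n V)
    {p : S n} (hp : p ∈ frontier V) (v : E (n + 1)) {δ : ℝ} (hδ : 0 < δ) :
    ∃ O : Set (S n), IsOpen O ∧ p ∈ O ∧ hypersurfaceMeasure n (frontier V ∩ O) < ⊤ ∧
      LocalEstimate V v δ O := by
  obtain ⟨ρ, hρ⟩ := hb p hp
  obtain ⟨W, T, hT, hT'⟩ : ∃ (W : Submodule ℝ (E (n + 1))) (T : Splitting (E (n + 1)) W),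
      T.pole = p ∧ T.axis = outerNormal n V p :=
    ⟨_, Splitting.exists_of_orthonormal (norm_eq_of_mem_sphere p)
      hρ.norm_outerNormal hρ.inner_outerNormal⟩
  set d := finrank ℝ W with hd
  have hfr : d + 1 = n := by
    have := T.finrank_eq
    rw [finrank_euclideanSpace, Fintype.card_fin] at this
    omega
  have hfr' : n - 1 = d := by omega
  set δ' := min 1 (δ / (3 + ‖v‖)) with hδ'
  have hv0 := norm_nonneg v
  have hδ'0 : 0 < δ' := by positivity
  have hδ'1 : δ' ≤ 1 := min_le_left _ _
  have hδ'2 : (3 + ‖v‖) * δ' ≤ δ := by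
    have : δ' ≤ δ / (3 + ‖v‖) := min_le_right _ _
    rw [le_div_iff₀ (by positivity)] at this
    linarith
  -- The divergence estimate is used with slope and height bounded by `2 ε`, and `|α|`, `‖e‖` at
  -- most `‖v‖`: this gives `‖v‖ (6 d + 2) ε + 2 ε ‖v‖`.
  obtain ⟨ε, hε, hε6, hA, hB, hC⟩ := exists_small_slope d n (‖v‖ * (6 * d + 4)) hδ'0
  obtain ⟨α, ⟨e, β⟩, hv⟩ := T.exists_point v
  have hβ : inner ℝ v (outerNormal n V p) = β := by
    rw [← hv, ← hT', real_inner_comm, T.inner_axis]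
  have hvsq := T.norm_point_sq α (e, β)
  rw [hv] at hvsq
  simp only at hvsq
  have hα' : |α| ≤ ‖v‖ := abs_le_of_sq_le_sq (by nlinarith [sq_nonneg ‖e‖, sq_nonneg β]) hv0
  have hβ' : |β| ≤ ‖v‖ := abs_le_of_sq_le_sq (by nlinarith [sq_nonneg ‖e‖, sq_nonneg α]) hv0
  have he' : ‖e‖ ≤ ‖v‖ :=
    (sq_le_sq₀ (norm_nonneg _) hv0).1 (by nlinarith [sq_nonneg α, sq_nonneg β])
  -- the normal is almost constant near `p`
  have hnc := (continuousOn_outerNormal hV hb p hp).inner (𝕜 := ℝ)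
    (continuousWithinAt_const (b := v))
  have hnev : ∀ᶠ w in 𝓝 p, w ∈ frontier V → |inner ℝ v (outerNormal n V w) - β| < δ' := by
    rw [← eventually_nhdsWithin_iff]
    have h1 := Metric.tendsto_nhds.1 hnc δ' hδ'0
    filter_upwards [h1] with w hw
    rwa [Real.dist_eq, real_inner_comm, real_inner_comm v, hβ] at hw
  obtain ⟨r, hr0, hrε, h, hΩ, hfront, hlip, hbd, hiso, hO⟩ :=
    exists_graph_chart hV hρ T hT hT' hnev hε (by linarith)
  set B : Set W := ball 0 r with hBd
  set f : W → S n := fun y => T.proj (y, h y) with hf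
  have hhr : ∀ y ∈ B, |h y| < r := fun y hy => by
    rw [mem_ball_zero_iff] at hy
    exact (hbd y hy).trans_lt (by nlinarith [norm_nonneg y])
  have himage : f '' B = frontier V ∩ T.box r := by
    ext w
    constructor
    · rintro ⟨y, hy, rfl⟩
      have h1 := hhr y hy
      rw [mem_ball_zero_iff] at hy
      refine ⟨(hfront y _ hy h1).2 rfl, (y, h y), ?_, rfl⟩
      rw [mem_ball_zero_iff, Prod.norm_def]
      exact max_lt hy h1
    · rintro ⟨hw, ⟨⟨y, t⟩, hz, rfl⟩⟩
      rw [mem_ball_zero_iff, Prod.norm_def, max_lt_iff] at hz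
      have h1 := (hfront y t hz.1 hz.2).1 hw
      exact ⟨y, by simpa [hBd] using hz.1, by simp [hf, h1]⟩
  have hproj0 : T.proj 0 = p := by ext1; rw [T.coe_proj_zero, hT]
  have hgen := fun {F : S n → ℝ} (hF : Continuous F) (hF0 : ∀ x, 0 ≤ F x) {C : ℝ}
    (hC : ∀ x, F x ≤ C) => integral_image_of_almost_isometry (B := B) (f := f) (ε := 3 * ε)
      measurableSet_ball measure_ball_lt_top.ne (by positivity) (by linarith) hiso hF hF0 hC
  refine ⟨T.box r, T.isOpen_box r, ⟨0, by simpa using hr0, hproj0⟩, ?_, ?_⟩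
  · rw [hypersurfaceMeasure, hfr', ← himage]
    exact (hgen continuous_zero (fun _ => le_rfl) (C := 0) (fun _ => le_rfl)).1
  intro φ hφ hφh hφ0 K hK hKO hsK
  have hφh' : NegHomogeneous (d + 1) φ := by rwa [hfr]
  obtain ⟨r', hr', hsupp⟩ := T.exists_supportedIn hφh' hK hKO hsK
  have hφc : Continuous fun w : S n => φ w := by
    rw [← continuousOn_univ]
    exact hφ.continuousOn.comp continuous_subtype_val.continuousOn
      (fun w _ => ne_zero_of_mem_unit_sphere w)
  obtain ⟨C, hCb⟩ : ∃ C, ∀ w : S n, φ w ≤ C := by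
    obtain ⟨C, hC⟩ := isCompact_univ.exists_bound_of_continuousOn hφc.continuousOn
    exact ⟨C, fun w => (le_abs_self _).trans (hC w (mem_univ w))⟩
  obtain ⟨hfin, hle1, hle2⟩ := hgen hφc (fun w => hφ0 w) hCb
  have hmf : MeasurableSet (frontier V) := isClosed_frontier.measurableSet
  have hmb : MeasurableSet (T.box r) := (T.isOpen_box r).measurableSet
  have hvan : ∀ w ∈ frontier V \ (f '' B), φ w = 0 := fun w hw => by
    by_contra h0
    exact hw.2 (by rw [himage]; exact ⟨hw.1, hKO (hsK w h0)⟩)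
  have hsub : f '' B ⊆ frontier V := by rw [himage]; exact inter_subset_left
  set μ := hypersurfaceMeasure n with hμ
  have hμd : μ = Measure.euclideanHausdorffMeasure d := by rw [hμ, hypersurfaceMeasure, hfr']
  rw [← hμd] at hfin hle1 hle2
  set σ := ∫ w in frontier V, φ w ∂μ with hσ
  have hσ' : σ = ∫ w in f '' B, φ w ∂μ := setIntegral_eq_of_subset_of_forall_sdiff_eq_zero hmf hsub hvan
  have hσn : ∫ w in frontier V, inner ℝ v (outerNormal n V w) * φ w ∂μ =
      ∫ w in f '' B, inner ℝ v (outerNormal n V w) * φ w ∂μ :=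
    setIntegral_eq_of_subset_of_forall_sdiff_eq_zero hmf hsub
      fun w hw => by rw [hvan w hw, mul_zero]
  have hσ0 : 0 ≤ σ := integral_nonneg fun w => hφ0 _
  set q := ∫ y in B, φ (f y) with hq
  rw [← hσ'] at hle1 hle2
  have hmim : MeasurableSet (f '' B) := by rw [himage]; exact hmf.inter hmb
  have hfinm : IsFiniteMeasure (μ.restrict (f '' B)) := ⟨by rwa [Measure.restrict_apply_univ]⟩
  have hbound : ∀ w, ‖φ (w : S n)‖ ≤ C := fun w => by
    rw [Real.norm_eq_abs, abs_of_nonneg (hφ0 _)]; exact hCb w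
  have iσ : Integrable (fun w : S n => φ w) (μ.restrict (f '' B)) :=
    Integrable.of_bound hφc.aestronglyMeasurable C (Eventually.of_forall hbound)
  -- comparison of the flat and the curved boundary integrals
  set Q := ∫ y, φ (T.point 1 (y, h y)) with hQ
  have hQ0 : 0 ≤ Q := integral_nonneg fun y => hφ0 _
  have hhcont : ContinuousOn h B := by
    have : LipschitzOnWith (2 * ε).toNNReal h B := by
      refine LipschitzOnWith.of_dist_le_mul fun y hy y' hy' => ?_
      rw [Real.coe_toNNReal _ (by positivity), Real.dist_eq, dist_eq_norm]
      exact hlip _ _ (by simpa [hBd] using hy) (by simpa [hBd] using hy')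
    exact this.continuousOn
  have hQB : Q = ∫ y in B, φ (T.point 1 (y, h y)) := by
    refine (setIntegral_eq_integral_of_forall_compl_eq_zero fun y hy => ?_).symm
    by_contra h0
    have := (norm_le_iff_prod.1 (hsupp.norm_le h0)).1
    simp only at this
    exact hy (by rw [hBd, mem_ball_zero_iff]; linarith)
  -- Homogeneity relates the values on the tangent plane to those on the sphere; on the graph the
  -- norm of the point lies between `1` and `1 + 2 ε`.
  have hφP : ∀ z, φ (T.point 1 z) = (‖T.point 1 z‖ ^ n)⁻¹ * φ (T.proj z) := fun z => by
    have hpos : 0 < ‖T.point 1 z‖ := norm_pos_iff.2 (T.point_ne_zero z)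
    rw [← smul_eq_mul, ← hφh _ hpos, T.coe_proj, smul_smul, mul_inv_cancel₀ hpos.ne', one_smul]
  have hPn : ∀ y ∈ B, ‖T.point 1 (y, h y)‖ ≤ 1 + 2 * ε := fun y hy => by
    have h1 := hhr y hy
    rw [mem_ball_zero_iff] at hy
    rw [T.point_one]
    have h2 := T.norm_point_zero_le (y, h y)
    simp only at h2
    calc _ ≤ ‖T.pole‖ + ‖T.point 0 (y, h y)‖ := norm_add_le _ _
      _ ≤ 1 + 2 * ε := by rw [T.norm_pole]; linarith
  have hBfin : IsFiniteMeasure (volume.restrict B) := ⟨by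
    rw [Measure.restrict_apply_univ]; exact measure_ball_lt_top⟩
  have hfc : ContinuousOn f B :=
    T.continuous_proj.comp_continuousOn (continuousOn_id.prodMk hhcont)
  have iq : Integrable (fun y => φ (f y)) (volume.restrict B) :=
    Integrable.of_bound ((hφc.comp_continuousOn hfc).aestronglyMeasurable measurableSet_ball) C
      (Eventually.of_forall fun y => hbound _)
  have iQ : Integrable (fun y => φ (T.point 1 (y, h y))) (volume.restrict B) :=
    (integrable_graph hr' hhcont (T.contDiff_comp_point hφ).continuous
      (fun z hz => hsupp.norm_le hz)).integrableOn
  have hQq : Q ≤ q := by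
    rw [hQB]
    refine integral_mono iQ iq fun y => ?_
    simp only
    rw [hφP]
    have : (‖T.point 1 (y, h y)‖ ^ n)⁻¹ ≤ 1 :=
      inv_le_one_of_one_le₀ (one_le_pow₀ (T.one_le_norm_point _))
    calc _ ≤ 1 * φ (T.proj (y, h y)) := mul_le_mul_of_nonneg_right this (hφ0 _)
      _ = _ := one_mul _
  have hqQ : ((1 + 2 * ε) ^ n)⁻¹ * q ≤ Q := by
    rw [hQB, hq, ← integral_const_mul]
    refine setIntegral_mono_on (iq.const_mul _) iQ measurableSet_ball fun y hy => ?_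
    rw [hφP]
    refine mul_le_mul_of_nonneg_right ?_ (hφ0 _)
    have : 0 < ‖T.point 1 (y, h y)‖ := norm_pos_iff.2 (T.point_ne_zero _)
    gcongr
    exact hPn y hy
  have hQσ1 : Q ≤ (1 + δ') * σ :=
    hQq.trans (hle2.trans (mul_le_mul_of_nonneg_right hA hσ0))
  have hQσ2 : (1 - δ') * σ ≤ Q := by
    refine (mul_le_mul_of_nonneg_right hB hσ0).trans (le_trans ?_ hqQ)
    rw [mul_inv, mul_assoc]
    refine mul_le_mul_of_nonneg_left ?_ (by positivity)
    rw [inv_mul_le_iff₀ (by positivity)]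
    exact hle1
  -- assembling
  have hmain := T.abs_integral_sphere_fderiv_sub_le hφ hφ0 hφh' (by linarith) hr' hsupp
    (isOpen_coneOver hV).measurableSet smul_mem_coneOver_iff hΩ (by positivity : 0 ≤ 2 * ε)
    hlip (η := 2 * ε) (fun y hy => (hbd y hy).trans (by nlinarith [norm_nonneg y])) α β e
  rw [hv] at hmain
  change |(∫ w in ((↑) : S n → E (n + 1)) ⁻¹' coneOver V, fderiv ℝ φ w v ∂areaMeasure n) - β * Q| ≤
    (|α| * (d * (3 * (2 * ε)) + 2 * ε) + 2 * ε * ‖e‖) * Q at hmain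
  rw [coe_preimage_coneOver] at hmain
  have hcoef : |α| * (d * (3 * (2 * ε)) + 2 * ε) + 2 * ε * ‖e‖ ≤ δ' := by
    refine le_trans ?_ hC
    have hd0 : (0 : ℝ) ≤ d := Nat.cast_nonneg d
    calc _ ≤ ‖v‖ * (d * (3 * (2 * ε)) + 2 * ε) + 2 * ε * ‖v‖ := by gcongr
      _ = _ := by ring
  have hnorm : |(∫ w in f '' B, inner ℝ v (outerNormal n V w) * φ w ∂μ) - β * σ| ≤ δ' * σ := by
    have hon : ContinuousOn (fun w => inner ℝ v (outerNormal n V w)) (f '' B) :=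
      continuousOn_const.inner ((continuousOn_outerNormal hV hb).mono hsub)
    have hclose : ∀ w ∈ f '' B, |inner ℝ v (outerNormal n V w) - β| ≤ δ' := by
      intro w hw
      have hw' := hw
      rw [himage] at hw'
      obtain ⟨hwf, z, hz, rfl⟩ := hw'
      exact (hO z hz hwf).le
    have i1 : Integrable (fun w => inner ℝ v (outerNormal n V w) * φ w) (μ.restrict (f '' B)) := by
      refine iσ.bdd_mul (hon.aestronglyMeasurable hmim) (c := |β| + δ') ?_
      refine (ae_restrict_iff' hmim).2 (Eventually.of_forall fun w hw => ?_)
      have := abs_sub_abs_le_abs_sub (inner ℝ v (outerNormal n V w)) β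
      rw [Real.norm_eq_abs]
      linarith [hclose w hw]
    rw [hσ', ← integral_const_mul, ← integral_const_mul, ← integral_sub i1 (iσ.const_mul _)]
    refine abs_integral_le_integral_abs.trans ?_
    refine setIntegral_mono_on (i1.sub (iσ.const_mul _)).abs (iσ.const_mul _) hmim fun w hw => ?_
    rw [← sub_mul, abs_mul, abs_of_nonneg (hφ0 w)]
    exact mul_le_mul_of_nonneg_right (hclose w hw) (hφ0 w)
  rw [hσn]
  have hQ2 : Q ≤ 2 * σ := hQσ1.trans (mul_le_mul_of_nonneg_right (by linarith) hσ0)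
  have hβQ : |β * Q - β * σ| ≤ ‖v‖ * (δ' * σ) := by
    rw [← mul_sub, abs_mul]
    refine mul_le_mul hβ' ?_ (abs_nonneg _) hv0
    rw [abs_le]; constructor <;> linarith
  have h1 : |(∫ w in V, fderiv ℝ φ w v ∂areaMeasure n) - β * Q| ≤ δ' * (2 * σ) :=
    hmain.trans (mul_le_mul hcoef hQ2 hQ0 hδ'0.le)
  have h2 : (3 + ‖v‖) * δ' * σ ≤ δ * σ := mul_le_mul_of_nonneg_right hδ'2 hσ0
  rw [abs_le] at h1 hβQ hnorm ⊢
  constructor <;> linarith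

/-! ### The divergence theorem on the sphere -/

variable {n : ℕ} {V : Set (S n)}

theorem exists_localEstimate (hn : 1 ≤ n) (hV : IsOpen V) (hb : HasC1Boundary n V)
    (p : S n) (v : E (n + 1)) {δ : ℝ} (hδ : 0 < δ) :
    ∃ O : Set (S n), IsOpen O ∧ p ∈ O ∧ hypersurfaceMeasure n (frontier V ∩ O) < ⊤ ∧
      LocalEstimate V v δ O := by
  by_cases hp : p ∈ frontier V
  · exact exists_localEstimate_of_mem_frontier hV hb hp v hδ
  · exact exists_localEstimate_of_notMem_frontier hn hV hp v

theorem hypersurfaceMeasure_frontier_lt_top (hn : 1 ≤ n) (hV : IsOpen V)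
    (hb : HasC1Boundary n V) : hypersurfaceMeasure n (frontier V) < ⊤ := by
  refine isClosed_frontier.isCompact.measure_lt_top_of_nhdsWithin fun p _ => ?_
  obtain ⟨O, hO, hpO, hfin, -⟩ := exists_localEstimate hn hV hb p 0 one_pos
  exact ⟨frontier V ∩ O, inter_mem_nhdsWithin _ (hO.mem_nhds hpO), hfin⟩

theorem integrableOn_of_continuousOn_compact {X F : Type*} [TopologicalSpace X]
    [T2Space X] [SecondCountableTopology X] [MeasurableSpace X] [BorelSpace X]
    [NormedAddCommGroup F] {μ : Measure X} {K : Set X} (hK : IsCompact K) (hμ : μ K < ⊤) {g : X → F}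
    (hg : ContinuousOn g K) : IntegrableOn g K μ := by
  obtain ⟨C, hC⟩ := hK.exists_bound_of_continuousOn hg
  have : IsFiniteMeasure (μ.restrict K) := ⟨by rwa [Measure.restrict_apply_univ]⟩
  refine Integrable.of_bound (hg.aestronglyMeasurable_of_isCompact hK hK.isClosed.measurableSet) C ?_
  exact (ae_restrict_iff' hK.isClosed.measurableSet).2 (Eventually.of_forall hC)

theorem integrableOn_frontier {F : Type*} [NormedAddCommGroup F] (hn : 1 ≤ n) (hV : IsOpen V)
    (hb : HasC1Boundary n V) {g : S n → F} (hg : ContinuousOn g (frontier V)) :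
    IntegrableOn g (frontier V) (hypersurfaceMeasure n) :=
  integrableOn_of_continuousOn_compact isClosed_frontier.isCompact
    (hypersurfaceMeasure_frontier_lt_top hn hV hb) hg

theorem integrable_area {F : Type*} [NormedAddCommGroup F] {g : S n → F} (hg : Continuous g) :
    Integrable g (areaMeasure n) := by
  rw [← integrableOn_univ]
  have : IsFiniteMeasure (areaMeasure n) := by unfold areaMeasure; infer_instance
  exact integrableOn_of_continuousOn_compact isCompact_univ (measure_lt_top _ _) hg.continuousOn

section

variable {F : Type*} [NormedAddCommGroup F] [NormedSpace ℝ F]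

theorem continuous_sphere_of_contDiffOn {φ : E (n + 1) → F} (hφ : ContDiffOn ℝ 1 φ {0}ᶜ) :
    Continuous fun w : S n => φ w := by
  rw [← continuousOn_univ]
  exact hφ.continuousOn.comp continuous_subtype_val.continuousOn
    (fun w _ => ne_zero_of_mem_unit_sphere w)

theorem continuous_sphere_fderiv {φ : E (n + 1) → F} (hφ : ContDiffOn ℝ 1 φ {0}ᶜ)
    (v : E (n + 1)) : Continuous fun w : S n => fderiv ℝ φ w v := by
  rw [← continuousOn_univ]
  exact ((hφ.continuousOn_fderiv_of_isOpen isOpen_compl_singleton le_rfl).clm_apply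
    continuousOn_const).comp continuous_subtype_val.continuousOn
    (fun w _ => ne_zero_of_mem_unit_sphere w)

end

theorem NegHomogeneous.map_zero {φ : E (n + 1) → ℝ} (hn : 1 ≤ n)
    (hφ : NegHomogeneous n φ) : φ 0 = 0 := by
  have h := hφ 2 two_pos 0
  rw [smul_zero, smul_eq_mul] at h
  have h2 : ((2 : ℝ) ^ n)⁻¹ ≠ 1 := by
    rw [Ne, inv_eq_one]
    exact (one_lt_pow₀ one_lt_two (by omega)).ne'
  by_contra h3
  exact h2 (mul_right_cancel₀ h3 (by rw [one_mul]; exact h.symm))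

theorem contDiffOn_normalize {k : WithTop ℕ∞} :
    ContDiffOn ℝ k (fun x : E (n + 1) => ‖x‖⁻¹ • x) {0}ᶜ := by
  intro x hx
  have hx : x ≠ 0 := hx
  exact (((contDiffAt_norm ℝ hx).inv (norm_ne_zero_iff.2 hx)).smul
    contDiffAt_id).contDiffWithinAt

theorem normalize_smul {r : ℝ} (hr : 0 < r) (x : E (n + 1)) :
    ‖r • x‖⁻¹ • r • x = ‖x‖⁻¹ • x := by
  rw [norm_smul, Real.norm_eq_abs, abs_of_pos hr, mul_inv, smul_smul, mul_right_comm,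
    inv_mul_cancel₀ hr.ne', one_mul]

/-- The divergence theorem on the sphere for non-negative functions. -/
theorem integral_fderiv_eq_of_nonneg (hn : 1 ≤ n) (hV : IsOpen V) (hb : HasC1Boundary n V)
    {φ : E (n + 1) → ℝ} (hφ : ContDiffOn ℝ 1 φ {0}ᶜ) (hh : NegHomogeneous n φ)
    (h0 : ∀ x, 0 ≤ φ x) (v : E (n + 1)) :
    ∫ w in V, fderiv ℝ φ w v ∂areaMeasure n =
      ∫ w in frontier V, inner ℝ v (outerNormal n V w) * φ w ∂hypersurfaceMeasure n := by
  set σ := ∫ w in frontier V, φ w ∂hypersurfaceMeasure n with hσ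
  have hσ0 : 0 ≤ σ := integral_nonneg fun w => h0 _
  -- An arbitrarily small relative error suffices because `σ` does not depend on `δ`; dividing by `σ
  -- + 1` covers `σ = 0`.
  suffices h : ∀ δ > 0, |(∫ w in V, fderiv ℝ φ w v ∂areaMeasure n) -
      ∫ w in frontier V, inner ℝ v (outerNormal n V w) * φ w ∂hypersurfaceMeasure n| ≤ δ * σ by
    rw [← sub_eq_zero, ← abs_nonpos_iff]
    refine le_of_forall_pos_le_add fun η hη => ?_
    refine (h (η / (σ + 1)) (by positivity)).trans ?_
    rw [zero_add, div_mul_eq_mul_div, div_le_iff₀ (by positivity)]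
    nlinarith
  intro δ hδ
  choose O hO hpO _ hest using fun p => exists_localEstimate hn hV hb p v hδ
  obtain ⟨t, ht⟩ := isCompact_univ.elim_finite_subcover O hO
    (fun p _ => mem_iUnion.2 ⟨p, hpO p⟩)
  obtain ⟨χ, hχ⟩ := SmoothPartitionOfUnity.exists_isSubordinate 𝓘(ℝ, E (n + 1))
    (isClosed_sphere (x := (0 : E (n + 1))) (ε := 1)) (fun i : t => coneOver (O i))
    (fun i => isOpen_coneOver (hO i)) (by
      intro x hx
      obtain ⟨p, hp⟩ := mem_iUnion.1 (ht (mem_univ (⟨x, hx⟩ : S n)))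
      obtain ⟨hpt, hp⟩ := mem_iUnion.1 hp
      exact mem_iUnion.2 ⟨⟨p, hpt⟩, (coe_mem_coneOver_iff (⟨x, hx⟩ : S n)).2 hp⟩)
  -- Composing the partition of unity with radial projection keeps the pieces homogeneous of degree
  -- `-n`. They are non-negative with sum `φ` off the origin, so their relative errors add up to `δ
  -- σ`.
  let Φ : t → E (n + 1) → ℝ := fun i x => χ i (‖x‖⁻¹ • x) * φ x
  have hΦc : ∀ i, ContDiffOn ℝ 1 (Φ i) {0}ᶜ := fun i =>
    (((χ i).contMDiff.contDiff.of_le (by exact_mod_cast le_top)).comp_contDiffOn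
      contDiffOn_normalize).mul hφ
  have hΦh : ∀ i, NegHomogeneous n (Φ i) := fun i r hr x => by
    simp only [Φ, normalize_smul hr, hh r hr, smul_eq_mul]; ring
  have hΦ0 : ∀ i x, 0 ≤ Φ i x := fun i x => mul_nonneg (χ.nonneg i _) (h0 x)
  have hΦw : ∀ i (w : S n), Φ i w = χ i w * φ w := fun i w => by
    have h1 : ‖(w : E (n + 1))‖⁻¹ • (w : E (n + 1)) = w := by rw [norm_eq_of_mem_sphere]; simp
    simp only [Φ, h1]
  have hsum : ∀ x ≠ 0, ∑ i, Φ i x = φ x := fun x hx => by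
    have h1 := χ.sum_eq_one (norm_inv_smul_mem_sphere hx)
    rw [finsum_eq_sum_of_fintype] at h1
    simp only [Φ]
    rw [← Finset.sum_mul, h1, one_mul]
  have hΦest : ∀ i, |(∫ w in V, fderiv ℝ (Φ i) w v ∂areaMeasure n) -
      ∫ w in frontier V, inner ℝ v (outerNormal n V w) * Φ i w ∂hypersurfaceMeasure n| ≤
      δ * ∫ w in frontier V, Φ i w ∂hypersurfaceMeasure n := fun i => by
    refine hest i (Φ i) (hΦc i) (hΦh i) (hΦ0 i) (((↑) : S n → E (n + 1)) ⁻¹' tsupport (χ i))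
      ((isClosed_tsupport _).preimage continuous_subtype_val).isCompact ?_ ?_
    · intro w hw
      exact (coe_mem_coneOver_iff w).1 (hχ i hw)
    · intro w hw
      rw [hΦw] at hw
      exact subset_closure (left_ne_zero_of_mul hw)
  have hfd : ∀ w : S n, fderiv ℝ φ w v = ∑ i, fderiv ℝ (Φ i) w v := fun w => by
    have hw := ne_zero_of_mem_unit_sphere w
    have h1 : φ =ᶠ[𝓝 (w : E (n + 1))] fun x => ∑ i, Φ i x := by
      filter_upwards [isOpen_compl_singleton.mem_nhds hw] with x hx using (hsum x hx).symm
    rw [h1.fderiv_eq, fderiv_fun_sum fun i _ =>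
      ((hΦc i).contDiffAt (isOpen_compl_singleton.mem_nhds hw)).differentiableAt one_ne_zero]
    simp
  have eA : ∫ w in V, fderiv ℝ φ w v ∂areaMeasure n =
      ∑ i, ∫ w in V, fderiv ℝ (Φ i) w v ∂areaMeasure n := by
    simp only [hfd]
    exact integral_finsetSum _ fun i _ => (integrable_area (continuous_sphere_fderiv (hΦc i) v)).integrableOn
  have hNc : ContinuousOn (fun w => inner ℝ v (outerNormal n V w)) (frontier V) :=
    continuousOn_const.inner (continuousOn_outerNormal hV hb)
  have eB : ∫ w in frontier V, inner ℝ v (outerNormal n V w) * φ w ∂hypersurfaceMeasure n =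
      ∑ i, ∫ w in frontier V, inner ℝ v (outerNormal n V w) * Φ i w ∂hypersurfaceMeasure n := by
    have hint : ∀ i, IntegrableOn (fun w : S n => inner ℝ v (outerNormal n V w) * Φ i w)
        (frontier V) (hypersurfaceMeasure n) := fun i => integrableOn_frontier hn hV hb
      (hNc.mul (continuous_sphere_of_contDiffOn (hΦc i)).continuousOn)
    rw [← integral_finsetSum _ fun i _ => hint i]
    refine integral_congr_ae (Eventually.of_forall fun w => ?_)
    simp only
    rw [← Finset.mul_sum, hsum _ (ne_zero_of_mem_unit_sphere w)]
  have eC : σ = ∑ i, ∫ w in frontier V, Φ i w ∂hypersurfaceMeasure n := by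
    rw [← integral_finsetSum _ fun i _ => integrableOn_frontier hn hV hb
      (continuous_sphere_of_contDiffOn (hΦc i)).continuousOn]
    refine integral_congr_ae (Eventually.of_forall fun w => ?_)
    simp only
    rw [hsum _ (ne_zero_of_mem_unit_sphere w)]
  rw [eA, eB, eC, ← Finset.sum_sub_distrib, Finset.mul_sum]
  exact (Finset.abs_sum_le_sum_abs _ _).trans (Finset.sum_le_sum fun i _ => hΦest i)

/-- The divergence theorem on the sphere for real functions. -/
theorem integral_fderiv_eq_real (hn : 1 ≤ n) (hV : IsOpen V) (hb : HasC1Boundary n V)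
    {φ : E (n + 1) → ℝ} (hφ : ContDiffOn ℝ 1 φ {0}ᶜ) (hh : NegHomogeneous n φ) (v : E (n + 1)) :
    ∫ w in V, fderiv ℝ φ w v ∂areaMeasure n =
      ∫ w in frontier V, inner ℝ v (outerNormal n V w) * φ w ∂hypersurfaceMeasure n := by
  obtain ⟨M, hM⟩ := isCompact_univ.exists_bound_of_continuousOn
    (continuous_sphere_of_contDiffOn hφ).continuousOn
  -- A non-negative function of the same degree that dominates `|φ|` on the sphere. The theorem for
  -- `φ` is the difference of those for `φ + ψ` and `ψ`.
  let ψ : E (n + 1) → ℝ := fun x => |M| * (‖x‖ ^ n)⁻¹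
  have hψc : ContDiffOn ℝ 1 ψ {0}ᶜ := fun x hx => by
    have hx : x ≠ 0 := hx
    exact (contDiffAt_const.mul (((contDiffAt_norm ℝ hx).pow n).inv
      (pow_ne_zero _ (norm_ne_zero_iff.2 hx)))).contDiffWithinAt
  have hψh : NegHomogeneous n ψ := fun r hr x => by
    simp only [ψ, norm_smul, Real.norm_eq_abs, abs_of_pos hr, mul_pow, mul_inv, smul_eq_mul]; ring
  have hψ0 : ∀ x, 0 ≤ ψ x := fun x => by simp only [ψ]; positivity
  have hsum0 : ∀ x, 0 ≤ φ x + ψ x := fun x => by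
    by_cases hx : x = 0
    · rw [hx, NegHomogeneous.map_zero hn hh, zero_add]; exact hψ0 0
    have hn0 : 0 < ‖x‖ := norm_pos_iff.2 hx
    have h1 := hh ‖x‖ hn0 (‖x‖⁻¹ • x)
    rw [smul_smul, mul_inv_cancel₀ hn0.ne', one_smul, smul_eq_mul] at h1
    have h2 := hM ⟨_, norm_inv_smul_mem_sphere hx⟩ (mem_univ _)
    rw [Real.norm_eq_abs] at h2
    have h3 := (abs_le.1 (h2.trans (le_abs_self M))).1
    simp only at h3
    rw [h1]
    simp only [ψ]
    have h4 : 0 < (‖x‖ ^ n)⁻¹ := by positivity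
    nlinarith
  have hs := integral_fderiv_eq_of_nonneg hn hV hb (φ := fun x => φ x + ψ x) (hφ.add hψc)
    (fun r hr x => by simp only [hh r hr, hψh r hr, smul_add]) hsum0 v
  have hp := integral_fderiv_eq_of_nonneg hn hV hb hψc hψh hψ0 v
  have hNc : ContinuousOn (fun w => inner ℝ v (outerNormal n V w)) (frontier V) :=
    continuousOn_const.inner (continuousOn_outerNormal hV hb)
  have hd : ∀ {θ : E (n + 1) → ℝ}, ContDiffOn ℝ 1 θ {0}ᶜ → ∀ w : S n,
      DifferentiableAt ℝ θ (w : E (n + 1)) := fun hθ w =>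
    (hθ.contDiffAt (isOpen_compl_singleton.mem_nhds
      (ne_zero_of_mem_unit_sphere w))).differentiableAt one_ne_zero
  have e1 : ∀ w : S n, fderiv ℝ (fun x => φ x + ψ x) w v = fderiv ℝ φ w v + fderiv ℝ ψ w v :=
    fun w => by rw [fderiv_fun_add (hd hφ w) (hd hψc w)]; rfl
  have hint : ∀ {θ : E (n + 1) → ℝ}, ContDiffOn ℝ 1 θ {0}ᶜ →
      IntegrableOn (fun w : S n => inner ℝ v (outerNormal n V w) * θ w)
        (frontier V) (hypersurfaceMeasure n) := fun hθ => integrableOn_frontier hn hV hb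
      (hNc.mul (continuous_sphere_of_contDiffOn hθ).continuousOn)
  simp only [e1, mul_add] at hs
  rw [integral_add (integrable_area (continuous_sphere_fderiv hφ v)).integrableOn
      (integrable_area (continuous_sphere_fderiv hψc v)).integrableOn,
    integral_add (hint hφ) (hint hψc), hp] at hs
  exact add_right_cancel hs

/-- The divergence theorem on the sphere. -/
theorem integral_fderiv_eq {F : Type*} [NormedAddCommGroup F] [NormedSpace ℝ F] [CompleteSpace F]
    (hn : 1 ≤ n) (hV : IsOpen V) (hb : HasC1Boundary n V)
    {φ : E (n + 1) → F} (hφ : ContDiffOn ℝ 1 φ {0}ᶜ) (hh : NegHomogeneous n φ) (v : E (n + 1)) :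
    ∫ w in V, fderiv ℝ φ w v ∂areaMeasure n =
      ∫ w in frontier V, inner ℝ v (outerNormal n V w) • φ w ∂hypersurfaceMeasure n := by
  rw [SeparatingDual.eq_iff_forall_dual_eq (R := ℝ)]
  intro ℓ
  have hNc : ContinuousOn (fun w => inner ℝ v (outerNormal n V w)) (frontier V) :=
    continuousOn_const.inner (continuousOn_outerNormal hV hb)
  have hint : IntegrableOn (fun w : S n => inner ℝ v (outerNormal n V w) • φ w)
      (frontier V) (hypersurfaceMeasure n) := integrableOn_frontier hn hV hb
    (hNc.smul (continuous_sphere_of_contDiffOn hφ).continuousOn)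
  rw [← ℓ.integral_comp_comm (integrable_area (continuous_sphere_fderiv hφ v)).integrableOn,
    ← ℓ.integral_comp_comm hint]
  have h1 := integral_fderiv_eq_real hn hV hb (φ := fun x => ℓ (φ x))
    (ℓ.contDiff.comp_contDiffOn hφ) (fun r hr x => by simp only [hh r hr, map_smul]) v
  have h2 : ∀ w : S n, fderiv ℝ (fun x => ℓ (φ x)) w v = ℓ (fderiv ℝ φ w v) := fun w => by
    have hd : DifferentiableAt ℝ φ (w : E (n + 1)) :=
      (hφ.contDiffAt (isOpen_compl_singleton.mem_nhds
        (ne_zero_of_mem_unit_sphere w))).differentiableAt one_ne_zero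
    have := (ℓ.hasFDerivAt.comp (w : E (n + 1)) hd.hasFDerivAt).fderiv
    change fderiv ℝ (fun x => ℓ (φ x)) w = _ at this
    rw [this]; rfl
  simp only [h2] at h1
  simpa only [map_smul, smul_eq_mul] using h1

/-! ### Clifford multiplication, reversal and derivatives -/

section Clifford

variable {n : ℕ}

theorem vec_mul_add_swap (a b : E (n + 1)) :
    vec n a * vec n b + vec n b * vec n a = algebraMap ℝ (Cl n) (-2 * inner ℝ a b) := by
  rw [vec, CliffordAlgebra.ι_mul_ι_add_swap]
  congr 1
  rw [QuadraticMap.polar, negQ_apply, negQ_apply, negQ_apply, norm_add_sq_real]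
  ring

theorem vec_mul_comm (a b : E (n + 1)) (c : Cl n) :
    vec n a * (vec n b * c) = -(vec n b * (vec n a * c)) - (2 * inner ℝ a b : ℝ) • c := by
  have h := congrArg (· * c) (vec_mul_add_swap a b)
  simp only [add_mul, mul_assoc, ← Algebra.smul_def] at h
  rw [eq_sub_iff_add_eq, eq_neg_iff_add_eq_zero, add_right_comm, h, ← add_smul]
  simp

theorem vec_eq_sum (a : E (n + 1)) : vec n a = ∑ i, a i • e n i := by
  conv_lhs => rw [← (EuclideanSpace.basisFun (Fin (n + 1)) ℝ).sum_repr a]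
  simp [e]

/-- The inclusion `ℝⁿ ⊆ ℝⁿ⁺¹`. -/
def embed (n : ℕ) : E n →ₗ[ℝ] E (n + 1) :=
  ∑ j : Fin n, (LinearMap.toSpanSingleton ℝ (E (n + 1)) (EuclideanSpace.single j.castSucc 1)).comp
    (EuclideanSpace.projₗ j)

theorem embed_apply (u : E n) :
    embed n u = ∑ j : Fin n, u j • EuclideanSpace.single j.castSucc (1 : ℝ) := by
  simp [embed]

theorem vec_embed (u : E n) : vec n (embed n u) = uvec n u := by
  simp [embed_apply, uvec, e]

theorem inner_single_embed (j : Fin n) (u : E n) :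
    inner ℝ (EuclideanSpace.single j.castSucc (1 : ℝ)) (embed n u) = u j := by
  simp [embed_apply, EuclideanSpace.inner_single_left, Pi.single_apply]

theorem embed_single (j : Fin n) :
    embed n (EuclideanSpace.single j 1) = EuclideanSpace.single j.castSucc 1 := by
  simp [embed_apply]

/-- The multiplication of the Clifford algebra as a continuous bilinear map. -/
def mulL (n : ℕ) : Cl n →L[ℝ] Cl n →L[ℝ] Cl n := (LinearMap.mul ℝ (Cl n)).toContinuousBilinearMap

theorem mulL_apply (a b : Cl n) : mulL n a b = a * b := rfl

instance continuousMul_cl (n : ℕ) : ContinuousMul (Cl n) :=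
  ⟨((mulL n).continuous.comp continuous_fst).clm_apply continuous_snd⟩

/-- Reversal of the Clifford algebra as a continuous linear map. -/
def revL (n : ℕ) : Cl n →L[ℝ] Cl n :=
  LinearMap.toContinuousLinearMap (CliffordAlgebra.reverse (Q := negQ n))

theorem revL_mul (a b : Cl n) : revL n (a * b) = revL n b * revL n a :=
  CliffordAlgebra.reverse.map_mul a b

theorem revL_revL (a : Cl n) : revL n (revL n a) = a := CliffordAlgebra.reverse_reverse a

theorem revL_vec (a : E (n + 1)) : revL n (vec n a) = vec n a := CliffordAlgebra.reverse_ι a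

theorem revL_e (i : Fin (n + 1)) : revL n (e n i) = e n i := revL_vec _

variable {X : Type*} [NormedAddCommGroup X] [NormedSpace ℝ X] {f g : X → Cl n} {x : X}
  {s : Set X} {m : WithTop ℕ∞}

theorem contDiffOn_mul (hf : ContDiffOn ℝ m f s) (hg : ContDiffOn ℝ m g s) :
    ContDiffOn ℝ m (fun y => f y * g y) s :=
  ((mulL n).contDiff.comp_contDiffOn hf).clm_apply hg

theorem contDiff_mul (hf : ContDiff ℝ m f) (hg : ContDiff ℝ m g) :
    ContDiff ℝ m (fun y => f y * g y) :=
  ((mulL n).contDiff.comp hf).clm_apply hg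

theorem differentiableAt_mul (hf : DifferentiableAt ℝ f x) (hg : DifferentiableAt ℝ g x) :
    DifferentiableAt ℝ (fun y => f y * g y) x :=
  ((mulL n).differentiableAt.comp x hf).clm_apply hg

theorem fderiv_comp_clm {F G : Type*} [NormedAddCommGroup F] [NormedSpace ℝ F]
    [NormedAddCommGroup G] [NormedSpace ℝ G] (L : F →L[ℝ] G) {f : X → F}
    (hf : DifferentiableAt ℝ f x) (v : X) :
    fderiv ℝ (fun y => L (f y)) x v = L (fderiv ℝ f x v) := by
  have h : HasFDerivAt (fun y => L (f y)) (L.comp (fderiv ℝ f x)) x :=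
    L.hasFDerivAt.comp x hf.hasFDerivAt
  rw [h.fderiv]; rfl

theorem fderiv_mul_apply (hf : DifferentiableAt ℝ f x) (hg : DifferentiableAt ℝ g x) (v : X) :
    fderiv ℝ (fun y => f y * g y) x v = fderiv ℝ f x v * g x + f x * fderiv ℝ g x v := by
  have h := (mulL n).hasFDerivAt_of_bilinear hf.hasFDerivAt hg.hasFDerivAt
  have h' : HasFDerivAt (fun y => f y * g y) _ x := h
  rw [h'.fderiv]
  simp [mulL_apply, add_comm]

theorem fderiv_const_mul_apply (a : Cl n) (hf : DifferentiableAt ℝ f x) (v : X) :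
    fderiv ℝ (fun y => a * f y) x v = a * fderiv ℝ f x v :=
  fderiv_comp_clm (mulL n a) hf v

end Clifford

/-! ### Homogeneous Clifford-valued polynomials -/

section Polynomials

variable {n k : ℕ} {p q : E n → Cl n}

/-- The monomials span the homogeneous polynomials. -/
theorem IsHomPoly.induction {C : (k : ℕ) → (E n → Cl n) → Prop}
    (const : ∀ a : Cl n, C 0 fun _ => a) (zero : ∀ k, C k fun _ => 0)
    (add : ∀ k p q, C k p → C k q → C k fun u => p u + q u)
    (mul : ∀ k p (j : Fin n), C k p → C (k + 1) fun u => u j • p u)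
    (h : IsHomPoly n k p) : C k p := by
  have mono : ∀ k (α : Fin n → ℕ), ∑ j, α j = k → ∀ a : Cl n,
      C k fun u => (∏ j, u j ^ α j) • a := by
    intro k
    induction k with
    | zero =>
      intro α hα a
      have h0 : ∀ j, α j = 0 := by simpa using hα
      simpa [h0] using const a
    | succ k ih =>
      intro α hα a
      obtain ⟨i, hi⟩ : ∃ i, α i ≠ 0 := by
        by_contra! h
        simp [h] at hα
      have hu : ∀ u : E n, ∏ j, u j ^ α j = u i * ∏ j, u j ^ (Function.update α i (α i - 1)) j := by
        intro u
        rw [← Finset.mul_prod_erase _ _ (Finset.mem_univ i),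
          ← Finset.mul_prod_erase Finset.univ (fun j => u j ^ (Function.update α i (α i - 1)) j)
            (Finset.mem_univ i), ← mul_assoc, Function.update_self, ← pow_succ',
          Nat.sub_add_cancel (Nat.pos_of_ne_zero hi)]
        congr 1
        exact Finset.prod_congr rfl fun j hj => by
          rw [Function.update_of_ne (Finset.ne_of_mem_erase hj)]
      have hs : ∑ j, Function.update α i (α i - 1) j = k := by
        rw [Finset.sum_update_of_mem (Finset.mem_univ i), ← Finset.erase_eq]
        have := Finset.add_sum_erase Finset.univ α (Finset.mem_univ i)
        omega
      simp only [hu, mul_smul]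
      exact mul k _ i (ih _ hs a)
  obtain ⟨c, hc⟩ := h
  have : p = fun u => ∑ α ∈ Finset.Nat.antidiagonalTuple n k, (∏ j, u j ^ α j) • c α := funext hc
  rw [this]
  suffices H : ∀ s ⊆ Finset.Nat.antidiagonalTuple n k,
      C k fun u => ∑ α ∈ s, (∏ j, u j ^ α j) • c α from H _ subset_rfl
  intro s
  induction s using Finset.induction_on with
  | empty => intro _; simpa using zero k
  | insert α s hα ih =>
    intro hs
    simp only [Finset.sum_insert hα]
    exact add k _ _ (mono k α (Finset.Nat.mem_antidiagonalTuple.1 (hs (Finset.mem_insert_self _ _))) _)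
      (ih ((Finset.subset_insert _ _).trans hs))

theorem isHomPoly_zero : IsHomPoly n k fun _ => 0 := ⟨0, by simp⟩

theorem isHomPoly_const (a : Cl n) : IsHomPoly n 0 fun _ => a :=
  ⟨fun _ => a, fun u => by simp [show Finset.Nat.antidiagonalTuple n 0 = {0} from
    Finset.Nat.antidiagonalTuple_zero_right n]⟩

theorem IsHomPoly.add (hp : IsHomPoly n k p) (hq : IsHomPoly n k q) :
    IsHomPoly n k fun u => p u + q u := by
  obtain ⟨c, hc⟩ := hp
  obtain ⟨d, hd⟩ := hq
  exact ⟨c + d, fun u => by simp [hc, hd, Finset.sum_add_distrib]⟩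

theorem IsHomPoly.map (L : Cl n →ₗ[ℝ] Cl n) (hp : IsHomPoly n k p) :
    IsHomPoly n k fun u => L (p u) := by
  obtain ⟨c, hc⟩ := hp
  exact ⟨fun α => L (c α), fun u => by simp [hc]⟩

theorem isHomPoly_monomial {α : Fin n → ℕ} (hα : ∑ j, α j = k) (a : Cl n) :
    IsHomPoly n k fun u => (∏ j, u j ^ α j) • a := by
  refine ⟨Pi.single α a, fun u => ?_⟩
  rw [Finset.sum_eq_single_of_mem α (Finset.Nat.mem_antidiagonalTuple.2 hα), Pi.single_eq_same]
  intro β _ h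
  rw [Pi.single_eq_of_ne h, smul_zero]

theorem IsHomPoly.sum {ι : Type*} {s : Finset ι} {p : ι → E n → Cl n}
    (hp : ∀ i ∈ s, IsHomPoly n k (p i)) : IsHomPoly n k fun u => ∑ i ∈ s, p i u := by
  classical
  induction s using Finset.induction_on with
  | empty => simpa using isHomPoly_zero
  | insert i s hi ih =>
    simp only [Finset.sum_insert hi]
    exact (hp i (Finset.mem_insert_self _ _)).add
      (ih fun j hj => hp j (Finset.mem_insert_of_mem hj))

theorem IsHomPoly.coord_smul (j : Fin n) (hp : IsHomPoly n k p) :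
    IsHomPoly n (k + 1) fun u => u j • p u := by
  obtain ⟨c, hc⟩ := hp
  simp only [hc, Finset.smul_sum, smul_smul]
  refine IsHomPoly.sum fun α hα => ?_
  have hu : ∀ u : E n, u j * ∏ i, u i ^ α i = ∏ i, u i ^ (α + Pi.single j 1 : Fin n → ℕ) i := by
    intro u
    simp only [Pi.add_apply, pow_add, Finset.prod_mul_distrib]
    rw [mul_comm]
    congr 1
    rw [Finset.prod_eq_single_of_mem j (Finset.mem_univ _)]
    · simp
    · intro i _ hi; simp [Pi.single_eq_of_ne hi]
  simp only [hu]
  refine isHomPoly_monomial ?_ _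
  rw [Finset.Nat.mem_antidiagonalTuple] at hα
  simp [Finset.sum_add_distrib, hα]

theorem IsHomPoly.contDiff (hp : IsHomPoly n k p) {m : WithTop ℕ∞} : ContDiff ℝ m p := by
  refine hp.induction (C := fun _ p => ContDiff ℝ m p) (fun a => ?_) (fun k => ?_)
    (fun k p q hp hq => ?_) (fun k p j hp => ?_)
  · exact contDiff_const
  · exact contDiff_const
  · exact hp.add hq
  · exact ((EuclideanSpace.proj (𝕜 := ℝ) j).contDiff).smul hp

theorem IsHomPoly.differentiableAt (hp : IsHomPoly n k p) (u : E n) : DifferentiableAt ℝ p u :=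
  (hp.contDiff (m := 1)).differentiable one_ne_zero u

theorem IsHomPoly.apply_smul (hp : IsHomPoly n k p) (r : ℝ) (u : E n) :
    p (r • u) = r ^ k • p u := by
  refine hp.induction (C := fun k p => p (r • u) = r ^ k • p u) (fun a => ?_) (fun k => ?_)
    (fun k p q hp hq => ?_) (fun k p j hp => ?_)
  · simp
  · simp
  · simp [hp, hq]
  · simp [hp, smul_smul, pow_succ]; ring_nf

theorem fderiv_coord_smul (j : Fin n) {u : E n} (hp : DifferentiableAt ℝ p u) (v : E n) :
    fderiv ℝ (fun u => u j • p u) u v = u j • fderiv ℝ p u v + v j • p u := by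
  have h : HasFDerivAt (fun u : E n => u j) (EuclideanSpace.proj (𝕜 := ℝ) j) u :=
    (EuclideanSpace.proj (𝕜 := ℝ) j).hasFDerivAt
  have h' : HasFDerivAt (fun u : E n => u j • p u) _ u := h.smul hp.hasFDerivAt
  rw [h'.fderiv]
  simp

theorem IsHomPoly.fderiv_self (hp : IsHomPoly n k p) (u : E n) :
    fderiv ℝ p u u = (k : ℝ) • p u := by
  have h : ContDiff ℝ 1 p ∧ ∀ u, fderiv ℝ p u u = (k : ℝ) • p u := by
    refine hp.induction (C := fun k p => ContDiff ℝ 1 p ∧ ∀ u, fderiv ℝ p u u = (k : ℝ) • p u)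
      (fun a => ?_) (fun k => ?_) (fun k p q hp hq => ?_) (fun k p j hp => ?_)
    · exact ⟨contDiff_const, by simp⟩
    · exact ⟨contDiff_const, by simp⟩
    · refine ⟨hp.1.add hq.1, fun u => ?_⟩
      rw [fderiv_fun_add (hp.1.differentiable one_ne_zero u) (hq.1.differentiable one_ne_zero u)]
      simp [hp.2, hq.2]
    · refine ⟨((EuclideanSpace.proj (𝕜 := ℝ) j).contDiff).smul hp.1, fun u => ?_⟩
      rw [fderiv_coord_smul j (hp.1.differentiable one_ne_zero u), hp.2]
      push_cast
      module
  exact h.2 u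

theorem IsHomPoly.fderiv (hp : IsHomPoly n (k + 1) p) (v : E n) :
    IsHomPoly n k fun u => fderiv ℝ p u v := by
  have h : ∀ l, k + 1 = l + 1 → IsHomPoly n l fun u => _root_.fderiv ℝ p u v := by
    generalize k + 1 = k at hp
    -- The degree drops by one, so the claim is carried through `k = l + 1`. Degree 0 needs its own
    -- clause: in the product rule for `u j • p` with `p` constant, the term containing the
    -- derivative of `p` must vanish.
    have : ContDiff ℝ 1 p ∧ IsHomPoly n k p ∧ (k = 0 → ∀ u, _root_.fderiv ℝ p u v = 0) ∧
        (∀ l, k = l + 1 → IsHomPoly n l fun u => _root_.fderiv ℝ p u v) := by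
      refine hp.induction (C := fun k p => ContDiff ℝ 1 p ∧ IsHomPoly n k p ∧
        (k = 0 → ∀ u, _root_.fderiv ℝ p u v = 0) ∧
        (∀ l, k = l + 1 → IsHomPoly n l fun u => _root_.fderiv ℝ p u v))
        (fun a => ?_) (fun k => ?_) (fun k p q hp hq => ?_) (fun k p j hp => ?_)
      · exact ⟨contDiff_const, isHomPoly_const a, by simp, by simp⟩
      · exact ⟨contDiff_const, isHomPoly_zero, by simp, by simpa using fun l _ => isHomPoly_zero⟩
      · have e1 : ∀ u, _root_.fderiv ℝ (fun u => p u + q u) u v =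
            _root_.fderiv ℝ p u v + _root_.fderiv ℝ q u v := fun u => by
          rw [fderiv_fun_add (hp.1.differentiable one_ne_zero u)
            (hq.1.differentiable one_ne_zero u)]; rfl
        refine ⟨hp.1.add hq.1, hp.2.1.add hq.2.1, ?_, ?_⟩
        · intro hk u; rw [e1, hp.2.2.1 hk, hq.2.2.1 hk, add_zero]
        · intro l hl
          simp only [e1]
          exact (hp.2.2.2 l hl).add (hq.2.2.2 l hl)
      · refine ⟨((EuclideanSpace.proj (𝕜 := ℝ) j).contDiff).smul hp.1, hp.2.1.coord_smul j,
          by simp, ?_⟩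
        intro l hl
        obtain rfl : k = l := by omega
        have e1 : ∀ u, _root_.fderiv ℝ (fun u => u j • p u) u v =
            u j • _root_.fderiv ℝ p u v + v j • p u := fun u =>
          fderiv_coord_smul j (hp.1.differentiable one_ne_zero u) v
        simp only [e1]
        refine IsHomPoly.add ?_ (hp.2.1.map (v j • LinearMap.id))
        rcases Nat.eq_zero_or_eq_succ_pred k with hk | hk
        · simp only [hp.2.2.1 hk, smul_zero]; exact isHomPoly_zero
        · have := (hp.2.2.2 _ hk).coord_smul j
          rwa [← Nat.succ_eq_add_one, ← hk] at this
    exact this.2.2.2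
  exact h k rfl

theorem IsHomPoly.fderiv_eq_zero (hp : IsHomPoly n 0 p) (u : E n) : _root_.fderiv ℝ p u = 0 := by
  obtain ⟨c, hc⟩ := hp
  have : p = fun _ => c 0 := funext fun u => by
    simp [hc, show Finset.Nat.antidiagonalTuple n 0 = {0} from
      Finset.Nat.antidiagonalTuple_zero_right n]
  rw [this]; simp

end Polynomials

/-! ### Monogenic polynomials and their splittings -/

section Monogenic

variable {n k : ℕ} {p q : E n → Cl n}

/-- The space of left monogenic homogeneous polynomials. -/
def leftMonogenicSubmodule (n k : ℕ) : Submodule ℝ (E n → Cl n) where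
  carrier := leftMonogenic n k
  zero_mem' := ⟨isHomPoly_zero, fun u => by
    change dirac n (fun _ => 0) u = 0
    simp [dirac]⟩
  add_mem' := by
    rintro p q ⟨hp, hp0⟩ ⟨hq, hq0⟩
    refine ⟨hp.add hq, fun u => ?_⟩
    have h : dirac n (p + q) u = dirac n p u + dirac n q u := by
      simp only [dirac, fderiv_add (hp.differentiableAt u) (hq.differentiableAt u),
        _root_.add_apply, mul_add, Finset.sum_add_distrib]
    rw [h, hp0, hq0, add_zero]
  smul_mem' := by
    rintro c p ⟨hp, hp0⟩
    refine ⟨hp.map (c • LinearMap.id), fun u => ?_⟩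
    have h : dirac n (c • p) u = c • dirac n p u := by
      simp only [dirac, fderiv_const_smul (hp.differentiableAt u), Finset.smul_sum]
      simp
    rw [h, hp0, smul_zero]

/-- Finite dimension makes the space closed under pointwise limits, which
`RegularOn.fderiv_mem_leftMonogenic` relies on. -/
instance finiteDimensional_leftMonogenicSubmodule :
    FiniteDimensional ℝ (leftMonogenicSubmodule n k) := by
  let L : (Finset.Nat.antidiagonalTuple n k → Cl n) →ₗ[ℝ] (E n → Cl n) :=
    { toFun := fun c u => ∑ α : Finset.Nat.antidiagonalTuple n k, (∏ j, u j ^ α.1 j) • c α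
      map_add' := fun c d => by ext u; simp [Finset.sum_add_distrib]
      map_smul' := fun r c => by
        ext u
        simp only [Pi.smul_apply, RingHom.id_apply, Finset.smul_sum]
        exact Finset.sum_congr rfl fun α _ => smul_comm _ _ _ }
  have h : leftMonogenicSubmodule n k ≤ LinearMap.range L := by
    rintro p ⟨⟨c, hc⟩, -⟩
    refine ⟨fun α => c α, funext fun u => ?_⟩
    rw [hc, ← Finset.sum_coe_sort]
    rfl
  exact Submodule.finiteDimensional_of_le h

theorem revL_injective : Function.Injective (revL n) := fun a b h => by
  rw [← revL_revL a, h, revL_revL]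

/-- Reversal is an anti-automorphism that fixes vectors, so it exchanges the left and right
theories. The splittings on the right are deduced from those on the left through it. -/
theorem revL_mem_leftMonogenic_iff :
    (fun u => revL n (p u)) ∈ leftMonogenic n k ↔ p ∈ rightMonogenic n k := by
  have h : ∀ {p : E n → Cl n}, IsHomPoly n k p →
      ∀ u, dirac n (fun u => revL n (p u)) u = revL n (diracRight n p u) := fun hp u => by
    simp only [dirac, diracRight, fderiv_comp_clm _ (hp.differentiableAt u), map_sum, revL_mul,
      revL_e]
  constructor
  · rintro ⟨h1, h2⟩
    have hp : IsHomPoly n k p := by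
      simpa only [ContinuousLinearMap.coe_coe, revL_revL] using
        h1.map (revL n : Cl n →ₗ[ℝ] Cl n)
    exact ⟨hp, fun u => revL_injective (by rw [← h hp, h2, map_zero])⟩
  · rintro ⟨hp, h2⟩
    exact ⟨hp.map (revL n : Cl n →ₗ[ℝ] Cl n), fun u => by rw [h hp, h2, map_zero]⟩

theorem revL_mem_rightMonogenic (hp : p ∈ leftMonogenic n k) :
    (fun u => revL n (p u)) ∈ rightMonogenic n k := by
  rw [← revL_mem_leftMonogenic_iff]
  simpa only [revL_revL] using hp

theorem continuous_uvec : Continuous (uvec n) := by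
  unfold uvec
  fun_prop

theorem isHomPoly_uvec_mul (hq : IsHomPoly n k q) :
    IsHomPoly n (k + 1) fun u => uvec n u * q u := by
  simp only [uvec, Finset.sum_mul, smul_mul_assoc]
  exact IsHomPoly.sum fun j _ => (hq.map (LinearMap.mulLeft ℝ (e n j.castSucc))).coord_smul j

theorem fderiv_uvec (u v : E n) : fderiv ℝ (uvec n) u v = uvec n v := by
  have h : uvec n = fun u => (LinearMap.toContinuousLinearMap
      ((vec n).comp (embed n))) u := by
    funext u
    exact (vec_embed u).symm
  have h2 : HasFDerivAt (uvec n) (LinearMap.toContinuousLinearMap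
      ((vec n).comp (embed n))) u := by
    rw [h]
    exact ContinuousLinearMap.hasFDerivAt _
  rw [h2.fderiv]
  exact vec_embed v

theorem differentiable_uvec : Differentiable ℝ (uvec n) := by
  have h : uvec n = fun u => (LinearMap.toContinuousLinearMap
      ((vec n).comp (embed n))) u := by
    funext u
    exact (vec_embed u).symm
  rw [h]
  exact ContinuousLinearMap.differentiable _

theorem e_mul_self (i : Fin (n + 1)) : e n i * e n i = -1 := by
  rw [e, vec_mul_self]
  simp

theorem uvec_single (j : Fin n) : uvec n (EuclideanSpace.single j 1) = e n j.castSucc := by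
  rw [← vec_embed, embed_single, e]

theorem fderiv_eq_sum (p : E n → Cl n) (u v : E n) :
    fderiv ℝ p u v = ∑ j, v j • fderiv ℝ p u (EuclideanSpace.single j 1) := by
  conv_lhs => rw [← (EuclideanSpace.basisFun (Fin n) ℝ).sum_repr v]
  simp

/-- The products `eⱼ eⱼ = -1` contribute `-n q`. Moving `eⱼ` past `u` costs `-2 uⱼ`, and `∑ uⱼ ∂ⱼ q
= k q` by Euler. -/
theorem dirac_uvec_mul (hq : IsHomPoly n k q) (u : E n) :
    dirac n (fun u => uvec n u * q u) u =
      -((n + 2 * k : ℝ) • q u) - uvec n u * dirac n q u := by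
  have h : ∀ j : Fin n, e n j.castSucc *
      fderiv ℝ (fun u => uvec n u * q u) u (EuclideanSpace.single j 1) =
      -q u - uvec n u * (e n j.castSucc * fderiv ℝ q u (EuclideanSpace.single j 1)) -
        2 • (u j • fderiv ℝ q u (EuclideanSpace.single j 1)) := fun j => by
    rw [fderiv_mul_apply (differentiable_uvec u) (hq.differentiableAt u), fderiv_uvec, mul_add,
      uvec_single, ← mul_assoc, e_mul_self, neg_one_mul, ← vec_embed, e, vec_mul_comm, inner_single_embed]
    module
  rw [dirac, Finset.sum_congr rfl fun j _ => h j]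
  simp only [Finset.sum_sub_distrib, ← Finset.mul_sum, ← Finset.smul_sum]
  rw [← fderiv_eq_sum, hq.fderiv_self, dirac]
  simp only [Finset.sum_neg_distrib, Finset.sum_const, Finset.card_univ, Fintype.card_fin]
  module

theorem dirac_vec_mul (v : E (n + 1)) (hq : IsHomPoly n k q) (u : E n) :
    dirac n (fun u => vec n v * q u) u =
      -(vec n v * dirac n q u) -
        (2 : ℝ) • fderiv ℝ q u (∑ j : Fin n, v j.castSucc • EuclideanSpace.single j 1) := by
  have h : ∀ j : Fin n, e n j.castSucc *
      fderiv ℝ (fun u => vec n v * q u) u (EuclideanSpace.single j 1) =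
      -(vec n v * (e n j.castSucc * fderiv ℝ q u (EuclideanSpace.single j 1))) -
        (2 : ℝ) • (v j.castSucc • fderiv ℝ q u (EuclideanSpace.single j 1)) := fun j => by
    rw [fderiv_const_mul_apply _ (hq.differentiableAt u), e, vec_mul_comm,
      EuclideanSpace.inner_single_left]
    simp [mul_smul]
  rw [dirac, Finset.sum_congr rfl fun j _ => h j]
  simp only [Finset.sum_sub_distrib, Finset.sum_neg_distrib, ← Finset.mul_sum, ← Finset.smul_sum,
    map_sum, map_smul, dirac]

/-- The Dirac operator has constant coefficients, so it commutes with directional derivatives by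
symmetry of the second derivative. -/
theorem fderiv_mem_leftMonogenic (hp : p ∈ leftMonogenic n (k + 1)) (v : E n) :
    (fun u => fderiv ℝ p u v) ∈ leftMonogenic n k := by
  refine ⟨hp.1.fderiv v, fun u => ?_⟩
  have hs : IsSymmSndFDerivAt ℝ p u :=
    ContDiffAt.isSymmSndFDerivAt_of_omega (hp.1.contDiff.contDiffAt)
  have hd : DifferentiableAt ℝ (fderiv ℝ p) u :=
    ((hp.1.contDiff (m := 2)).fderiv_right (m := 1) (by norm_num)).differentiable one_ne_zero u
  have hc : ∀ v w, fderiv ℝ (fun u => fderiv ℝ p u v) u w = fderiv ℝ (fderiv ℝ p) u w v :=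
    fun v w => fderiv_comp_clm (ContinuousLinearMap.apply ℝ (Cl n) v) hd w
  have h0 : fderiv ℝ (fun u => dirac n p u) u v = 0 := by
    have : (fun u => dirac n p u) = fun _ => 0 := funext hp.2
    rw [this]; simp
  rw [← h0]
  have hd' : ∀ w, DifferentiableAt ℝ (fun u => fderiv ℝ p u w) u := fun w =>
    (hp.1.fderiv w).differentiableAt u
  simp only [dirac]
  rw [fderiv_fun_sum fun j _ => differentiableAt_mul (differentiableAt_const _) (hd' _)]
  simp only [_root_.sum_apply]
  refine Finset.sum_congr rfl fun j _ => ?_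
  rw [fderiv_const_mul_apply _ (hd' _), hc, hc, hs]

/-- `h` lies in `𝓜ₖ ⊕ u 𝓜ₖ₋₁`. -/
def LeftSplit (n k : ℕ) (h : E n → Cl n) : Prop :=
  ∃ p ∈ leftMonogenic n k, h - p ∈ leftRest n k

/-- `h` lies in `𝓜̄ₖ ⊕ 𝓜̄ₖ₋₁ u`. -/
def RightSplit (n k : ℕ) (h : E n → Cl n) : Prop :=
  ∃ p ∈ rightMonogenic n k, h - p ∈ rightRest n k

theorem add_mem_leftRest {r s : E n → Cl n} (hr : r ∈ leftRest n k) (hs : s ∈ leftRest n k) :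
    r + s ∈ leftRest n k := by
  cases k with
  | zero =>
    rw [leftRest, mem_singleton_iff] at hr hs ⊢
    rw [hr, hs, add_zero]
  | succ k =>
    obtain ⟨q, hq, hr⟩ := hr
    obtain ⟨q', hq', hs⟩ := hs
    exact ⟨q + q', (leftMonogenicSubmodule n k).add_mem hq hq', fun u => by
      simp only [Pi.add_apply, hr, hs, mul_add]⟩

theorem zero_mem_leftRest : (0 : E n → Cl n) ∈ leftRest n k := by
  cases k with
  | zero => rfl
  | succ k => exact ⟨0, (leftMonogenicSubmodule n k).zero_mem, by simp⟩

theorem leftSplit_zero : LeftSplit n k fun _ => 0 :=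
  ⟨0, (leftMonogenicSubmodule n k).zero_mem, by
    rw [sub_zero]; exact zero_mem_leftRest⟩

theorem LeftSplit.add {h h' : E n → Cl n} (hh : LeftSplit n k h) (hh' : LeftSplit n k h') :
    LeftSplit n k fun u => h u + h' u := by
  obtain ⟨p, hp, hr⟩ := hh
  obtain ⟨p', hp', hr'⟩ := hh'
  refine ⟨p + p', (leftMonogenicSubmodule n k).add_mem hp hp', ?_⟩
  have := add_mem_leftRest hr hr'
  rwa [← add_sub_add_comm] at this

theorem LeftSplit.sum {ι : Type*} {s : Finset ι} {h : ι → E n → Cl n}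
    (hh : ∀ i ∈ s, LeftSplit n k (h i)) : LeftSplit n k fun u => ∑ i ∈ s, h i u := by
  classical
  induction s using Finset.induction_on with
  | empty => simpa using leftSplit_zero
  | insert i s hi ih =>
    simp only [Finset.sum_insert hi]
    exact (hh i (Finset.mem_insert_self _ _)).add
      (ih fun j hj => hh j (Finset.mem_insert_of_mem hj))

/-- The product of a vector and a left monogenic polynomial has an Almansi–Fischer
decomposition. -/
theorem leftSplit_vec_mul (hn : 1 ≤ n) (v : E (n + 1)) (hp : p ∈ leftMonogenic n k) :
    LeftSplit n k fun u => vec n v * p u := by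
  have hvp : IsHomPoly n k fun u => vec n v * p u := hp.1.map (LinearMap.mulLeft ℝ (vec n v))
  cases k with
  | zero =>
    refine ⟨_, ⟨hvp, fun u => ?_⟩, by rw [sub_self]; exact zero_mem_leftRest⟩
    simp [dirac, hvp.fderiv_eq_zero u]
  | succ k =>
    set v' : E n := ∑ j : Fin n, v j.castSucc • EuclideanSpace.single j 1 with hv'
    set q : E n → Cl n := fun u => fderiv ℝ p u v' with hq
    have hqm : q ∈ leftMonogenic n k := fderiv_mem_leftMonogenic hp v'
    -- Here `D (v p) = -2 q` by `dirac_vec_mul` and `D (u q) = -(n + 2 k) q` by `dirac_uvec_mul`, as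
    -- `p` and `q` are monogenic and `q` has degree `k`. This `c` makes `v p - c u q` monogenic.
    set c : ℝ := 2 / (n + 2 * k) with hc
    have hc0 : (n + 2 * k : ℝ) ≠ 0 := by positivity
    have huq : IsHomPoly n (k + 1) fun u => c • (uvec n u * q u) :=
      (isHomPoly_uvec_mul hqm.1).map (c • LinearMap.id)
    refine ⟨fun u => vec n v * p u - c • (uvec n u * q u), ⟨?_, fun u => ?_⟩,
      c • q, (leftMonogenicSubmodule n k).smul_mem c hqm, fun u => ?_⟩
    · simpa [sub_eq_add_neg] using hvp.add (huq.map (-LinearMap.id))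
    · have h1 : dirac n (fun u => vec n v * p u - c • (uvec n u * q u)) u =
          dirac n (fun u => vec n v * p u) u - c • dirac n (fun u => uvec n u * q u) u := by
        simp only [dirac, fderiv_fun_sub (hvp.differentiableAt u) (huq.differentiableAt u),
          fderiv_fun_const_smul ((isHomPoly_uvec_mul hqm.1).differentiableAt u),
          _root_.sub_apply, mul_sub, Finset.sum_sub_distrib, Finset.smul_sum]
        simp
      rw [h1, dirac_vec_mul v hp.1, dirac_uvec_mul hqm.1, hp.2, hqm.2]
      simp only [mul_zero, neg_zero, sub_zero, zero_sub, smul_neg, smul_smul, ← hv']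
      rw [hc, div_mul_cancel₀ _ hc0, sub_neg_eq_add, neg_add_cancel]
    · simp

theorem LeftSplit.revL {h : E n → Cl n} (hh : LeftSplit n k h) :
    RightSplit n k fun u => revL n (h u) := by
  obtain ⟨p, hp, hr⟩ := hh
  refine ⟨_, revL_mem_rightMonogenic hp, ?_⟩
  cases k with
  | zero =>
    rw [leftRest, mem_singleton_iff, sub_eq_zero] at hr
    rw [rightRest, mem_singleton_iff, sub_eq_zero, hr]
  | succ k =>
    obtain ⟨q, hq, hr⟩ := hr
    refine ⟨_, revL_mem_rightMonogenic hq, fun u => ?_⟩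
    have := congrArg (RS.revL n) (hr u)
    rw [revL_mul, ← vec_embed, revL_vec, Pi.sub_apply, map_sub] at this
    rw [← vec_embed]
    exact this

theorem rightSplit_of_revL {h : E n → Cl n} (hh : LeftSplit n k fun u => revL n (h u)) :
    RightSplit n k h := by
  simpa only [revL_revL] using hh.revL

theorem leftProj_spec {h : E n → Cl n} (hh : LeftSplit n k h) :
    leftProj n k h ∈ leftMonogenic n k ∧ h - leftProj n k h ∈ leftRest n k := by
  have hh' : ∃ p ∈ leftMonogenic n k, h - p ∈ leftRest n k := hh
  rw [leftProj, dif_pos hh']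
  exact hh'.choose_spec

theorem rightProj_spec {h : E n → Cl n} (hh : RightSplit n k h) :
    rightProj n k h ∈ rightMonogenic n k ∧ h - rightProj n k h ∈ rightRest n k := by
  have hh' : ∃ p ∈ rightMonogenic n k, h - p ∈ rightRest n k := hh
  rw [rightProj, dif_pos hh']
  exact hh'.choose_spec

end Monogenic

end RS

/-- Gives the cutoff `max 0 (1 - ‖x‖²)²`, which is `C¹`, supported in the unit ball, and has a
radial gradient. -/
theorem hasDerivAt_max_zero_sq (s : ℝ) :
    HasDerivAt (fun s : ℝ => max 0 s ^ 2) (2 * max 0 s) s := by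
  rcases lt_trichotomy s 0 with hs | rfl | hs
  · rw [max_eq_left hs.le, mul_zero]
    refine (hasDerivAt_const s (0 : ℝ)).congr_of_eventuallyEq ?_
    filter_upwards [gt_mem_nhds hs] with t ht
    rw [max_eq_left (le_of_lt ht)]; norm_num
  · rw [max_self, mul_zero, hasDerivAt_iff_isLittleO]
    simp only [max_self, smul_zero, sub_zero, ne_eq, OfNat.ofNat_ne_zero, not_false_eq_true,
      zero_pow]
    have h1 : (fun s : ℝ => max 0 s ^ 2) =O[𝓝 0] fun s => s ^ 2 := by
      refine Asymptotics.IsBigO.of_bound 1 (Eventually.of_forall fun t => ?_)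
      rw [one_mul, norm_pow, norm_pow]
      refine pow_le_pow_left₀ (norm_nonneg _) ?_ 2
      rw [Real.norm_eq_abs, Real.norm_eq_abs, abs_of_nonneg (le_max_left _ _)]
      exact max_le (abs_nonneg t) (le_abs_self t)
    exact h1.trans_isLittleO (Asymptotics.isLittleO_pow_id one_lt_two)
  · rw [max_eq_right hs.le]
    have h := hasDerivAt_pow 2 s
    simp only [Nat.add_one_sub_one, pow_one, Nat.cast_ofNat] at h
    refine h.congr_of_eventuallyEq ?_
    filter_upwards [lt_mem_nhds hs] with t ht
    rw [max_eq_right (le_of_lt ht)]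

theorem contDiff_max_zero_sq : ContDiff ℝ 1 fun s : ℝ => max 0 s ^ 2 := by
  rw [contDiff_one_iff_deriv]
  refine ⟨fun s => (hasDerivAt_max_zero_sq s).differentiableAt, ?_⟩
  have : deriv (fun s : ℝ => max 0 s ^ 2) = fun s => 2 * max 0 s :=
    funext fun s => (hasDerivAt_max_zero_sq s).deriv
  rw [this]
  fun_prop

theorem integral_fderiv_eq_zero {X F : Type*} [NormedAddCommGroup X] [NormedSpace ℝ X]
    [FiniteDimensional ℝ X] [MeasurableSpace X] [BorelSpace X]
    [NormedAddCommGroup F] [NormedSpace ℝ F] [SecondCountableTopology F]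
    {μ : Measure X} [μ.IsAddHaarMeasure] {u : X → F}
    (hu : ContDiff ℝ 1 u) (hc : HasCompactSupport u) (v : X) :
    ∫ x, fderiv ℝ u x v ∂μ = 0 := by
  have h := integral_bilinear_hasLineDerivAt_right_eq_neg_left_of_integrable (μ := μ)
    (f := fun _ : X => (1 : ℝ)) (f' := fun _ => 0) (g := u) (g' := fun x => fderiv ℝ u x v)
    (v := v) (B := ContinuousLinearMap.lsmul ℝ ℝ) (by simp)
    (by simpa using integrable_fderiv_apply hu hc v)
    (by simpa using hu.continuous.integrable_of_hasCompactSupport hc)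
    (fun x _ => (hasFDerivAt_const (1 : ℝ) x).hasLineDerivAt v)
    (fun x _ => (hu.differentiable one_ne_zero x).hasFDerivAt.hasLineDerivAt v)
  simpa using h

/-- Positivity of the radial factor allows it to be divided out when an integral over `ℝⁿ` is
reduced to the sphere. -/
theorem integral_pow_mul_cap_pos (d : ℕ) :
    0 < ∫ r in Ioi (0 : ℝ), r ^ d * max 0 (1 - r ^ 2) := by
  have hc : Continuous fun r : ℝ => r ^ d * max 0 (1 - r ^ 2) := by fun_prop
  have hi : Integrable fun r : ℝ => r ^ d * max 0 (1 - r ^ 2) := by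
    refine hc.integrable_of_hasCompactSupport (hasCompactSupport_of_norm_le (r := 1) fun r hr => ?_)
    by_contra! h
    rw [Real.norm_eq_abs] at h
    refine hr ?_
    rw [max_eq_left, mul_zero]
    have := one_lt_sq_iff_one_lt_abs r |>.2 h
    linarith
  rw [setIntegral_pos_iff_support_of_nonneg_ae _ hi.integrableOn]
  · have hs : Ioo (0 : ℝ) 1 ⊆ Function.support (fun r : ℝ => r ^ d * max 0 (1 - r ^ 2)) ∩ Ioi 0 := by
      rintro r ⟨h0, h1⟩
      refine ⟨?_, h0⟩
      rw [Function.mem_support, max_eq_right (by nlinarith)]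
      have : 0 < 1 - r ^ 2 := by nlinarith
      positivity
    refine lt_of_lt_of_le ?_ (measure_mono hs)
    simp
  · filter_upwards [ae_restrict_mem measurableSet_Ioi] with r hr
    have : (0 : ℝ) < r := hr
    simp only [Pi.zero_apply]
    positivity

/-! ### Orthogonality, and pairings with projections -/

namespace RS

variable {n k : ℕ}

/-- Orthogonality of right monogenic polynomials and `u` times left monogenic polynomials. -/
theorem integral_mul_uvec_mul_eq_zero (hn : 1 ≤ n) {a b : ℕ} {g q : E n → Cl n}
    (hg : g ∈ rightMonogenic n a) (hq : q ∈ leftMonogenic n b) :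
    ∫ w : sphere (0 : E n) 1, g w * (uvec n w * q w) ∂(volume : Measure (E n)).toSphere = 0 := by
  have : Nonempty (Fin n) := ⟨⟨0, hn⟩⟩
  have hgd := hg.1.differentiableAt
  have hqd := hq.1.differentiableAt
  -- Consider the divergence of `η g eⱼ q`, summed over `j`. Monogenicity kills the terms in which
  -- `g` or `q` is differentiated, and the radial gradient of `η` leaves `-4 max 0 (1 - ‖x‖²) g x
  -- q`. Its integral over `ℝⁿ` is zero by compact support, and in polar coordinates it is a
  -- non-zero constant times the integral over the sphere.
  let η : E n → ℝ := fun x => max 0 (1 - ‖x‖ ^ 2) ^ 2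
  have hηc : ContDiff ℝ 1 η := contDiff_max_zero_sq.comp (contDiff_const.sub (contDiff_norm_sq ℝ))
  have hη : ∀ x v, fderiv ℝ η x v = -4 * max 0 (1 - ‖x‖ ^ 2) * inner ℝ x v := fun x v => by
    have h1 : HasFDerivAt (fun x : E n => 1 - ‖x‖ ^ 2) (-(2 • innerSL ℝ x)) x := by
      simpa using (hasStrictFDerivAt_norm_sq x).hasFDerivAt.const_sub 1
    have h2 := HasDerivAt.comp_hasFDerivAt (f := fun x : E n => 1 - ‖x‖ ^ 2) x
      (hasDerivAt_max_zero_sq (1 - ‖x‖ ^ 2)) h1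
    have h3 : HasFDerivAt η _ x := h2
    rw [h3.fderiv]
    simp
    ring
  let F : Fin n → E n → Cl n := fun j x => η x • (g x * (e n j.castSucc * q x))
  have hprod : ∀ j : Fin n, ContDiff ℝ 1 fun x => g x * (e n j.castSucc * q x) := fun j =>
    contDiff_mul hg.1.contDiff (contDiff_mul contDiff_const hq.1.contDiff)
  have hFc : ∀ j, ContDiff ℝ 1 (F j) := fun j => hηc.smul (hprod j)
  have hcap : ∀ x : E n, 1 < ‖x‖ → max 0 (1 - ‖x‖ ^ 2) = 0 := fun x hx =>
    max_eq_left (by nlinarith)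
  have hFs : ∀ j, HasCompactSupport (F j) := fun j =>
    hasCompactSupport_of_norm_le (r := 1) fun x hx => by
      by_contra! h
      exact hx (by simp only [F, η, hcap x h]; simp)
  have hsum : ∀ x, ∑ j, fderiv ℝ (F j) x (EuclideanSpace.single j 1) =
      (-4 * max 0 (1 - ‖x‖ ^ 2)) • (g x * (uvec n x * q x)) := fun x => by
    have h1 : ∀ j, fderiv ℝ (F j) x (EuclideanSpace.single j 1) =
        η x • (fderiv ℝ g x (EuclideanSpace.single j 1) * e n j.castSucc * q x) +
        η x • (g x * (e n j.castSucc * fderiv ℝ q x (EuclideanSpace.single j 1))) +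
        (-4 * max 0 (1 - ‖x‖ ^ 2)) • (x j • (g x * (e n j.castSucc * q x))) := fun j => by
      have h : HasFDerivAt (F j) _ x :=
        (hηc.differentiable one_ne_zero x).hasFDerivAt.smul
          ((hprod j).differentiable one_ne_zero x).hasFDerivAt
      rw [h.fderiv]
      simp only [_root_.add_apply, _root_.smul_apply, ContinuousLinearMap.smulRight_apply,
        hη, fderiv_mul_apply (hgd x) (differentiableAt_mul (differentiableAt_const _) (hqd x)),
        fderiv_const_mul_apply _ (hqd x), smul_add, mul_assoc, mul_smul,
        EuclideanSpace.inner_single_right]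
      simp
    rw [Finset.sum_congr rfl fun j _ => h1 j]
    simp only [Finset.sum_add_distrib, ← Finset.smul_sum, ← Finset.sum_mul, ← Finset.mul_sum]
    have h2 := hg.2 x
    have h3 := hq.2 x
    rw [diracRight] at h2
    rw [dirac] at h3
    rw [h2, h3]
    simp only [zero_mul, mul_zero, smul_zero, zero_add, uvec, Finset.sum_mul, Finset.mul_sum,
      smul_mul_assoc, mul_smul_comm]
  have h0 : ∫ x, (-4 * max 0 (1 - ‖x‖ ^ 2)) • (g x * (uvec n x * q x)) = 0 := by
    simp only [← hsum]
    rw [integral_finsetSum _ fun j _ => integrable_fderiv_apply (hFc j) (hFs j) _]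
    exact Finset.sum_eq_zero fun j _ => integral_fderiv_eq_zero (hFc j) (hFs j) _
  have hi : Integrable fun x : E n => (-4 * max 0 (1 - ‖x‖ ^ 2)) • (g x * (uvec n x * q x)) := by
    simp only [← hsum]
    exact integrable_finsetSum _ fun j _ => integrable_fderiv_apply (hFc j) (hFs j) _
  rw [integral_polar _ hi] at h0
  have h4 : ∀ w : sphere (0 : E n) 1, (∫ r in Ioi (0 : ℝ), r ^ (finrank ℝ (E n) - 1) •
      (-4 * max 0 (1 - ‖r • (w : E n)‖ ^ 2)) •
        (g (r • (w : E n)) * (uvec n (r • (w : E n)) * q (r • (w : E n))))) =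
      (-4 * ∫ r in Ioi (0 : ℝ), r ^ (finrank ℝ (E n) - 1 + (a + b + 1)) * max 0 (1 - r ^ 2)) •
        (g w * (uvec n w * q w)) := fun w => by
    rw [← integral_const_mul, ← integral_smul_const]
    refine integral_congr_ae (Eventually.of_forall fun r => ?_)
    simp only
    rw [norm_smul, norm_eq_of_mem_sphere, mul_one, Real.norm_eq_abs, sq_abs, hg.1.apply_smul,
      hq.1.apply_smul, ← vec_embed, map_smul, map_smul, vec_embed]
    simp only [smul_mul_assoc, mul_smul_comm, smul_smul]
    congr 1
    ring
  simp only [h4] at h0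
  rw [integral_smul, smul_eq_zero] at h0
  have h5 := integral_pow_mul_cap_pos (finrank ℝ (E n) - 1 + (a + b + 1))
  rcases h0 with h0 | h0
  · linarith
  · exact h0

instance isFiniteMeasure_toSphere_volume :
    IsFiniteMeasure (volume : Measure (E n)).toSphere := inferInstance

theorem integrable_pairing {P Q : E n → Cl n} (hP : Continuous P) (hQ : Continuous Q) :
    Integrable (fun u : sphere (0 : E n) 1 => P u * Q u) (volume : Measure (E n)).toSphere := by
  rw [← integrableOn_univ]
  refine integrableOn_of_continuousOn_compact isCompact_univ (measure_lt_top _ _)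
    (Continuous.continuousOn ?_)
  exact (hP.comp continuous_subtype_val).mul (hQ.comp continuous_subtype_val)

theorem IsHomPoly.continuous {p : E n → Cl n} (hp : IsHomPoly n k p) : Continuous p :=
  (hp.contDiff (m := 0)).continuous

theorem continuous_of_mem_leftRest {r : E n → Cl n} (hr : r ∈ leftRest n k) : Continuous r := by
  cases k with
  | zero => rw [mem_singleton_iff.1 hr]; exact continuous_const
  | succ k =>
    obtain ⟨q, hq, hr⟩ := hr
    rw [show r = fun u => uvec n u * q u from funext hr]
    exact continuous_uvec.mul hq.1.continuous

theorem continuous_of_mem_rightRest {r : E n → Cl n} (hr : r ∈ rightRest n k) :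
    Continuous r := by
  cases k with
  | zero => rw [mem_singleton_iff.1 hr]; exact continuous_const
  | succ k =>
    obtain ⟨q, hq, hr⟩ := hr
    rw [show r = fun u => q u * uvec n u from funext hr]
    exact hq.1.continuous.mul continuous_uvec

theorem pairing_leftRest (hn : 1 ≤ n) {g r : E n → Cl n} (hg : g ∈ rightMonogenic n k)
    (hr : r ∈ leftRest n k) : pairing n g r = 0 := by
  cases k with
  | zero => rw [mem_singleton_iff.1 hr]; simp [pairing]
  | succ k =>
    obtain ⟨q, hq, hr⟩ := hr
    simpa only [pairing, hr] using integral_mul_uvec_mul_eq_zero hn hg hq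

theorem pairing_rightRest (hn : 1 ≤ n) {f r : E n → Cl n} (hf : f ∈ leftMonogenic n k)
    (hr : r ∈ rightRest n k) : pairing n r f = 0 := by
  cases k with
  | zero => rw [mem_singleton_iff.1 hr]; simp [pairing]
  | succ k =>
    obtain ⟨q, hq, hr⟩ := hr
    simpa only [pairing, hr, mul_assoc] using integral_mul_uvec_mul_eq_zero hn hq hf

/-- The remainder of any splitting of `h` is orthogonal to `g`. Uniqueness of the decomposition is
not needed: every choice gives the same pairing. -/
theorem pairing_leftProj (hn : 1 ≤ n) {g h : E n → Cl n} (hg : g ∈ rightMonogenic n k)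
    (hh : LeftSplit n k h) : pairing n g (leftProj n k h) = pairing n g h := by
  obtain ⟨hp, hr⟩ := leftProj_spec hh
  have h1 := pairing_leftRest hn hg hr
  have h2 : ∀ u, h u = leftProj n k h u + (h - leftProj n k h) u := fun u => by simp
  rw [pairing] at h1
  conv_rhs => rw [pairing]
  rw [integral_congr_ae (Eventually.of_forall
    fun u : sphere (0 : E n) 1 => congrArg (g u * ·) (h2 u))]
  simp only [mul_add]
  rw [integral_add (integrable_pairing hg.1.continuous hp.1.continuous)
    (integrable_pairing hg.1.continuous (continuous_of_mem_leftRest hr)), h1, add_zero, pairing]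

theorem pairing_rightProj (hn : 1 ≤ n) {f h : E n → Cl n} (hf : f ∈ leftMonogenic n k)
    (hh : RightSplit n k h) : pairing n (rightProj n k h) f = pairing n h f := by
  obtain ⟨hp, hr⟩ := rightProj_spec hh
  have h1 := pairing_rightRest hn hf hr
  have h2 : ∀ u, h u = rightProj n k h u + (h - rightProj n k h) u := fun u => by simp
  rw [pairing] at h1
  conv_rhs => rw [pairing]
  rw [integral_congr_ae (Eventually.of_forall
    fun u : sphere (0 : E n) 1 => congrArg (· * f u) (h2 u))]
  simp only [add_mul]
  rw [integral_add (integrable_pairing hp.1.continuous hf.1.continuous)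
    (integrable_pairing (continuous_of_mem_rightRest hr) hf.1.continuous), h1, add_zero, pairing]

end RS

/-- Near every non-zero point, the radial projection onto the sphere coincides with a globally
smooth map. -/
theorem exists_contMDiff_normalize {n : ℕ} {x₀ : RS.E (n + 1)} (hx : x₀ ≠ 0) :
    ∃ σ : RS.E (n + 1) → RS.S n, ContMDiff 𝓘(ℝ, RS.E (n + 1)) (𝓡 n) 1 σ ∧
      ∀ᶠ x in 𝓝 x₀, (σ x : RS.E (n + 1)) = ‖x‖⁻¹ • x := by
  have h0 : 0 < ‖x₀‖ := norm_pos_iff.2 hx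
  -- The map `G` damps the displacement from `x₀` so as to be the identity near `x₀` and never zero:
  -- a zero would need `‖x₀‖ = χ x * ‖x - x₀‖`, but this is less than `‖x₀‖` on the support of the
  -- bump. Normalizing `G` is therefore smooth everywhere.
  let χ : ContDiffBump x₀ := ⟨‖x₀‖ / 2, ‖x₀‖, by linarith, by linarith⟩
  let G : RS.E (n + 1) → RS.E (n + 1) := fun x => x₀ + χ x • (x - x₀)
  have hG : ContDiff ℝ 1 G := contDiff_const.add (χ.contDiff.smul (contDiff_id.sub contDiff_const))
  have hG0 : ∀ x, G x ≠ 0 := fun x hGx => by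
    have h1 : χ x • (x - x₀) = -x₀ := by
      exact eq_neg_of_add_eq_zero_right hGx
    have h2 : χ x ≠ 0 := fun h => by
      rw [h, zero_smul] at h1
      exact hx (neg_eq_zero.1 h1.symm)
    have h3 : x ∈ ball x₀ ‖x₀‖ := by
      have := χ.support_eq
      change x ∈ ball x₀ χ.rOut
      rw [← this]; exact h2
    rw [mem_ball, dist_eq_norm] at h3
    have h4 : ‖χ x • (x - x₀)‖ ≤ ‖x - x₀‖ := by
      rw [norm_smul, Real.norm_eq_abs, abs_of_nonneg χ.nonneg]
      exact mul_le_of_le_one_left (norm_nonneg _) χ.le_one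
    rw [h1, norm_neg] at h4
    linarith
  have hN : ContDiff ℝ 1 fun x => ‖G x‖⁻¹ • G x :=
    ((hG.norm ℝ hG0).inv fun x => norm_ne_zero_iff.2 (hG0 x)).smul hG
  have : Fact (finrank ℝ (RS.E (n + 1)) = n + 1) := ⟨finrank_euclideanSpace_fin⟩
  refine ⟨_, hN.contMDiff.codRestrict_sphere (n := n)
    (fun x => norm_inv_smul_mem_sphere (hG0 x)), ?_⟩
  filter_upwards [χ.eventuallyEq_one] with x hx
  have : G x = x := by simp only [G, hx, Pi.one_apply, one_smul]; abel
  simp [this]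

/-! ### Extensions constant along rays -/

namespace RS

variable {n k : ℕ} {U : Set (S n)}

theorem radialExt_of_ne {F : S n → Cl n} {x : E (n + 1)} (hx : x ≠ 0) :
    radialExt n F x = F ⟨‖x‖⁻¹ • x, norm_inv_smul_mem_sphere hx⟩ := dif_neg hx

theorem radialExt_coe (F : S n → Cl n) (w : S n) : radialExt n F w = F w := by
  rw [radialExt_of_ne (ne_zero_of_mem_unit_sphere w)]
  congr 1
  ext1
  simp

theorem radialExt_smul (F : S n → Cl n) {r : ℝ} (hr : 0 < r) (x : E (n + 1)) :
    radialExt n F (r • x) = radialExt n F x := by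
  by_cases hx : x = 0
  · simp [hx]
  · rw [radialExt_of_ne hx, radialExt_of_ne (smul_ne_zero hr.ne' hx)]
    congr 2
    exact normalize_smul hr x

theorem negHomogeneous_radialExt (F : S n → Cl n) : NegHomogeneous 0 (radialExt n F) :=
  fun r hr x => by rw [radialExt_smul F hr, pow_zero, inv_one, one_smul]

theorem fderiv_radialExt_self {F : S n → Cl n} {w : E (n + 1)}
    (h : DifferentiableAt ℝ (radialExt n F) w) : fderiv ℝ (radialExt n F) w w = 0 := by
  rw [(negHomogeneous_radialExt F).fderiv_self h]; simp

/-- The extension of a `C¹` function is `C¹`, jointly in both variables. -/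
theorem contDiffOn_radialExt (hU : IsOpen U) {f : S n → E n → Cl n}
    (hf : ContMDiffOn ((𝓡 n).prod 𝓘(ℝ, E n)) 𝓘(ℝ, Cl n) 1
      (fun q : S n × E n => f q.1 q.2) (U ×ˢ univ)) :
    ContDiffOn ℝ 1 (fun z : E (n + 1) × E n => radialExt n (fun y => f y z.2) z.1)
      (coneOver U ×ˢ univ) := by
  rintro ⟨x₀, u₀⟩ ⟨hx₀, -⟩
  refine ContDiffAt.contDiffWithinAt ?_
  obtain ⟨hx, hxU⟩ := hx₀
  obtain ⟨σ, hσ, hσe⟩ := exists_contMDiff_normalize hx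
  have hσ0 : σ x₀ = ⟨‖x₀‖⁻¹ • x₀, norm_inv_smul_mem_sphere hx⟩ := Subtype.ext hσe.self_of_nhds
  have h1 : ContMDiffAt ((𝓡 n).prod 𝓘(ℝ, E n)) 𝓘(ℝ, Cl n) 1
      (fun q : S n × E n => f q.1 q.2) (σ x₀, u₀) :=
    hf.contMDiffAt ((hU.prod isOpen_univ).mem_nhds ⟨by rw [hσ0]; exact hxU, mem_univ _⟩)
  have h2 : ContMDiff 𝓘(ℝ, E (n + 1) × E n) ((𝓡 n).prod 𝓘(ℝ, E n)) 1
      (fun z : E (n + 1) × E n => (σ z.1, z.2)) :=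
    (hσ.comp contDiff_fst.contMDiff).prodMk contDiff_snd.contMDiff
  have h3 : ContDiffAt ℝ 1 (fun z : E (n + 1) × E n => f (σ z.1) z.2) (x₀, u₀) :=
    contMDiffAt_iff_contDiffAt.1 (h1.comp (x₀, u₀) h2.contMDiffAt)
  refine h3.congr_of_eventuallyEq ?_
  have h4 : ∀ᶠ z : E (n + 1) × E n in 𝓝 (x₀, u₀), (σ z.1 : E (n + 1)) = ‖z.1‖⁻¹ • z.1 ∧ z.1 ≠ 0 :=
    (continuous_fst.tendsto (x₀, u₀)).eventually
      (hσe.and (isOpen_compl_singleton.mem_nhds hx))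
  filter_upwards [h4] with z hz
  rw [radialExt_of_ne hz.2]
  congr 1
  exact Subtype.ext hz.1.symm

variable {f : S n → E n → Cl n}

/-- Joint regularity of the extension along rays. -/
def RegularOn (U : Set (S n)) (f : S n → E n → Cl n) : Prop :=
  ContDiffOn ℝ 1 (fun z : E (n + 1) × E n => radialExt n (fun y => f y z.2) z.1)
    (coneOver U ×ˢ univ)

theorem RegularOn.contDiffOn (hf : RegularOn U f) (u : E n) :
    ContDiffOn ℝ 1 (radialExt n fun y => f y u) (coneOver U) :=
  hf.comp (contDiff_id.prodMk contDiff_const).contDiffOn fun _ hx => ⟨hx, mem_univ u⟩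

theorem RegularOn.contDiffAt (hU : IsOpen U) (hf : RegularOn U f) (u : E n) {x : E (n + 1)}
    (hx : x ∈ coneOver U) : ContDiffAt ℝ 1 (radialExt n fun y => f y u) x :=
  (hf.contDiffOn u).contDiffAt ((isOpen_coneOver hU).mem_nhds hx)

theorem RegularOn.differentiableAt (hU : IsOpen U) (hf : RegularOn U f) (u : E n) {x : E (n + 1)}
    (hx : x ∈ coneOver U) : DifferentiableAt ℝ (radialExt n fun y => f y u) x :=
  (hf.contDiffAt hU u hx).differentiableAt one_ne_zero

theorem mapsTo_coneOver : MapsTo (fun z : S n × E n => ((z.1 : E (n + 1)), z.2)) (U ×ˢ univ)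
    (coneOver U ×ˢ univ) := fun z hz => ⟨(coe_mem_coneOver_iff z.1).2 hz.1, mem_univ _⟩

theorem RegularOn.continuousOn (hf : RegularOn U f) :
    ContinuousOn (fun z : S n × E n => f z.1 z.2) (U ×ˢ univ) := by
  have h : ContinuousOn (fun z : S n × E n => radialExt n (fun y => f y z.2) z.1) (U ×ˢ univ) :=
    (ContDiffOn.continuousOn hf).comp (by fun_prop) mapsTo_coneOver
  simpa only [radialExt_coe] using h

theorem RegularOn.continuousOn_fderiv (hU : IsOpen U) (hf : RegularOn U f) (v : E (n + 1)) :
    ContinuousOn (fun z : S n × E n => fderiv ℝ (radialExt n fun y => f y z.2) z.1 v)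
      (U ×ˢ univ) := by
  have hO : IsOpen (coneOver U ×ˢ (univ : Set (E n))) := (isOpen_coneOver hU).prod isOpen_univ
  have h : ContinuousOn (fun z : S n × E n => fderiv ℝ (fun z : E (n + 1) × E n =>
      radialExt n (fun y => f y z.2) z.1) ((z.1 : E (n + 1)), z.2) (v, 0)) (U ×ˢ univ) :=
    ((ContDiffOn.continuousOn_fderiv_of_isOpen hf hO le_rfl).clm_apply continuousOn_const).comp
      (f := fun z : S n × E n => ((z.1 : E (n + 1)), z.2)) (by fun_prop) mapsTo_coneOver
  refine h.congr fun z hz => ?_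
  have hd : DifferentiableAt ℝ (fun z : E (n + 1) × E n =>
      radialExt n (fun y => f y z.2) z.1) ((z.1 : E (n + 1)), z.2) :=
    (ContDiffOn.contDiffAt hf (hO.mem_nhds (mapsTo_coneOver hz))).differentiableAt one_ne_zero
  have h2 : HasFDerivAt (fun x : E (n + 1) => (x, z.2))
      (ContinuousLinearMap.inl ℝ (E (n + 1)) (E n)) (z.1 : E (n + 1)) :=
    hasFDerivAt_prodMk_left _ _
  have h3 := HasFDerivAt.comp (f := fun x : E (n + 1) => (x, z.2)) (z.1 : E (n + 1))
    hd.hasFDerivAt h2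
  have h4 : HasFDerivAt (radialExt n fun y => f y z.2) _ (z.1 : E (n + 1)) := h3
  simp only
  rw [h4.fderiv]
  simp

/-- The derivatives in the spherical variable stay monogenic. -/
theorem RegularOn.fderiv_mem_leftMonogenic (hU : IsOpen U) (hf : RegularOn U f)
    (hm : ∀ x ∈ U, f x ∈ leftMonogenic n k) {x : E (n + 1)} (hx : x ∈ coneOver U)
    (v : E (n + 1)) :
    (fun u => fderiv ℝ (radialExt n fun y => f y u) x v) ∈ leftMonogenic n k := by
  -- Difference quotients in the spherical variable are combinations of values of `f`, hence
  -- monogenic in `u`, and they converge pointwise to the derivative.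
  have hc : IsClosed (leftMonogenicSubmodule n k : Set (E n → Cl n)) :=
    Submodule.closed_of_finiteDimensional _
  have hmem : ∀ y ∈ coneOver U, (fun u => radialExt n (fun y => f y u) y) ∈
      leftMonogenicSubmodule n k := by
    rintro y ⟨hy, hyU⟩
    simp only [radialExt_of_ne hy]
    exact hm _ hyU
  refine hc.mem_of_tendsto (b := 𝓝[≠] (0 : ℝ)) (f := fun t u =>
    t⁻¹ • (radialExt n (fun y => f y u) (x + t • v) - radialExt n (fun y => f y u) x)) ?_ ?_
  · rw [tendsto_pi_nhds]
    intro u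
    exact ((hf.differentiableAt hU u hx).hasFDerivAt.hasLineDerivAt v).tendsto_slope_zero
  · have h1 : ∀ᶠ t : ℝ in 𝓝 0, x + t • v ∈ coneOver U := by
      have : Continuous fun t : ℝ => x + t • v := by fun_prop
      exact this.continuousAt.eventually_mem ((isOpen_coneOver hU).mem_nhds (by simpa using hx))
    filter_upwards [nhdsWithin_le_nhds h1] with t ht
    exact (leftMonogenicSubmodule n k).smul_mem _
      ((leftMonogenicSubmodule n k).sub_mem (hmem _ ht) (hmem _ hx))

theorem radialExt_revL (F : S n → Cl n) (x : E (n + 1)) :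
    radialExt n (fun y => revL n (F y)) x = revL n (radialExt n F x) := by
  by_cases hx : x = 0
  · simp [radialExt, hx]
  · rw [radialExt_of_ne hx, radialExt_of_ne hx]

theorem RegularOn.fderiv_mem_rightMonogenic (hU : IsOpen U) (hf : RegularOn U f)
    (hm : ∀ x ∈ U, f x ∈ rightMonogenic n k) {x : E (n + 1)} (hx : x ∈ coneOver U)
    (v : E (n + 1)) :
    (fun u => fderiv ℝ (radialExt n fun y => f y u) x v) ∈ rightMonogenic n k := by
  have hf' : RegularOn U fun y u => revL n (f y u) := by
    unfold RegularOn
    simp only [radialExt_revL]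
    exact (revL n).contDiff.comp_contDiffOn hf
  have h := hf'.fderiv_mem_leftMonogenic hU
    (fun x hx => revL_mem_leftMonogenic_iff.2 (hm x hx)) hx v
  rw [← revL_mem_leftMonogenic_iff]
  convert h using 2 with u
  rw [show (radialExt n fun y => revL n (f y u)) = fun x => revL n (radialExt n (fun y => f y u) x)
    from funext fun x => radialExt_revL _ x, fderiv_comp_clm _ (hf.differentiableAt hU u hx)]

/-! ### The spherical Dirac operators through Euclidean derivatives -/

section Operators

/-- The antisymmetric sum over `i < j` becomes a full double sum, which factors, minus a diagonal,
which will be a radial derivative and vanish. -/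
theorem sum_Ioi_add_swap {M : Type*} [AddCommGroup M] {m : ℕ} (T : Fin m → Fin m → M) :
    ∑ i, ∑ j ∈ Finset.Ioi i, (T j i + T i j) = ∑ i, ∑ j, T i j - ∑ i, T i i := by
  rw [Finset.sum_sum_Ioi_add_eq_sum_sum_off_diag T, eq_sub_iff_add_eq, ← Finset.sum_add_distrib,
    Finset.sum_comm (f := T)]
  refine Finset.sum_congr rfl fun i _ => ?_
  rw [← Finset.sum_compl_add_sum {i} (fun j => T j i), Finset.sum_singleton]

variable {F : S n → Cl n} {w : S n}

theorem sum_coord_smul_fderiv (h : DifferentiableAt ℝ (radialExt n F) (w : E (n + 1))) :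
    ∑ i, (w : E (n + 1)) i • fderiv ℝ (radialExt n F) w (EuclideanSpace.single i 1) = 0 := by
  have h1 := fderiv_radialExt_self h
  have h2 : (w : E (n + 1)) = ∑ i, (w : E (n + 1)) i • EuclideanSpace.single i (1 : ℝ) := by
    conv_lhs => rw [← (EuclideanSpace.basisFun (Fin (n + 1)) ℝ).sum_repr (w : E (n + 1))]
    simp
  rw [← h1]
  conv_rhs => enter [2]; rw [h2]
  simp only [map_sum, map_smul]

theorem e_mul_e_swap {i j : Fin (n + 1)} (h : i ≠ j) : e n j * e n i = -(e n i * e n j) := by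
  have := vec_mul_add_swap (n := n) (EuclideanSpace.single j (1 : ℝ)) (EuclideanSpace.single i 1)
  rw [EuclideanSpace.inner_single_left, PiLp.single_apply, if_neg h.symm, mul_zero, mul_zero,
    map_zero] at this
  exact eq_neg_of_add_eq_zero_left this

theorem vec_coe_mul_self : vec n w * vec n w = -1 := by
  rw [vec_mul_self, norm_eq_of_mem_sphere]; simp

/-- The spherical Dirac operator in terms of the Euclidean one. -/
theorem sphDirac_eq (h : DifferentiableAt ℝ (radialExt n F) (w : E (n + 1))) :
    sphDirac n F w =
      ∑ j, e n j * fderiv ℝ (radialExt n F) w (EuclideanSpace.single j 1) -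
        ((n : ℝ) / 2) • (vec n w * F w) := by
  set a : Fin (n + 1) → Cl n := fun j =>
    fderiv ℝ (radialExt n F) w (EuclideanSpace.single j 1) with ha
  have h1 : ∑ i : Fin (n + 1), ∑ j ∈ Finset.Ioi i, e n i * e n j * angular n i j F w =
      vec n w * ∑ j, e n j * a j := by
    -- By anticommutation the two halves of the angular term are `T j i` and `T i j` with `T i j =
    -- wᵢ eᵢ eⱼ ∂ⱼF`. The full double sum is `w` times the Euclidean Dirac operator, and the
    -- diagonal is minus the radial derivative, which is zero. Finally `-w w = 1`.
    have h2 : ∀ i, ∀ j ∈ Finset.Ioi i, e n i * e n j * angular n i j F w =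
        (w : E (n + 1)) j • (e n j * (e n i * a i)) + (w : E (n + 1)) i • (e n i * (e n j * a j)) :=
      fun i j hij => by
        have h3 : e n j * e n i = -(e n i * e n j) :=  e_mul_e_swap (Finset.mem_Ioi.1 hij).ne
        rw [← mul_assoc (e n j), h3, angular]
        simp only [mul_sub, mul_smul_comm, neg_mul, smul_neg, ha, mul_assoc]
        abel
    rw [Finset.sum_congr rfl fun i _ => Finset.sum_congr rfl (h2 i),
      sum_Ioi_add_swap fun i j => (w : E (n + 1)) i • (e n i * (e n j * a j))]
    have h4 : ∑ i, (w : E (n + 1)) i • (e n i * (e n i * a i)) = 0 := by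
      rw [← neg_eq_zero, ← sum_coord_smul_fderiv h, ← Finset.sum_neg_distrib]
      refine Finset.sum_congr rfl fun i _ => ?_
      rw [← mul_assoc, e_mul_self, neg_one_mul, smul_neg, neg_neg]
    rw [h4, sub_zero, vec_eq_sum, Finset.sum_mul]
    simp only [smul_mul_assoc, Finset.mul_sum]
  rw [sphDirac, h1, mul_add, ← mul_assoc, vec_coe_mul_self, mul_smul_comm]
  simp only [neg_add, neg_mul, one_mul, neg_neg, ← sub_eq_add_neg, ha]

/-- The right spherical Dirac operator in terms of the Euclidean one. -/
theorem sphDiracRight_eq (h : DifferentiableAt ℝ (radialExt n F) (w : E (n + 1))) :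
    sphDiracRight n F w =
      ∑ j, fderiv ℝ (radialExt n F) w (EuclideanSpace.single j 1) * e n j -
        ((n : ℝ) / 2) • (F w * vec n w) := by
  set a : Fin (n + 1) → Cl n := fun j =>
    fderiv ℝ (radialExt n F) w (EuclideanSpace.single j 1) with ha
  have h1 : ∑ i : Fin (n + 1), ∑ j ∈ Finset.Ioi i, angular n i j F w * (vec n w * (e n i * e n j)) =
      -∑ j, a j * e n j := by
    -- The same rearrangement with coefficients `w eᵢ eⱼ` on the right; summing over `i` gives `w w
    -- eⱼ = -eⱼ`.
    have h2 : ∀ i, ∀ j ∈ Finset.Ioi i, angular n i j F w * (vec n w * (e n i * e n j)) =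
        (w : E (n + 1)) j • (a i * (vec n w * (e n j * e n i))) +
          (w : E (n + 1)) i • (a j * (vec n w * (e n i * e n j))) :=
      fun i j hij => by
        have h3 : e n j * e n i = -(e n i * e n j) :=  e_mul_e_swap (Finset.mem_Ioi.1 hij).ne
        rw [h3, angular]
        simp only [sub_mul, smul_mul_assoc, mul_neg, smul_neg, ha]
        abel
    rw [Finset.sum_congr rfl fun i _ => Finset.sum_congr rfl (h2 i),
      sum_Ioi_add_swap fun i j => (w : E (n + 1)) i • (a j * (vec n w * (e n i * e n j)))]
    have h4 : ∑ i, (w : E (n + 1)) i • (a i * (vec n w * (e n i * e n i))) = 0 := by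
      simp only [e_mul_self, mul_neg, mul_one, smul_neg, Finset.sum_neg_distrib, neg_eq_zero]
      simp only [← smul_mul_assoc, ← Finset.sum_mul, ha]
      rw [sum_coord_smul_fderiv h, zero_mul]
    rw [h4, sub_zero, Finset.sum_comm, ← Finset.sum_neg_distrib]
    refine Finset.sum_congr rfl fun j _ => ?_
    have h5 : ∀ i, (w : E (n + 1)) i • (a j * (vec n w * (e n i * e n j))) =
        a j * (vec n w * (((w : E (n + 1)) i • e n i) * e n j)) := fun i => by
      simp only [smul_mul_assoc, mul_smul_comm]
    simp only [h5, ← Finset.mul_sum, ← Finset.sum_mul]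
    rw [← vec_eq_sum, ← mul_assoc (vec n w), vec_coe_mul_self, neg_one_mul, mul_neg]
  rw [sphDiracRight, h1, neg_add, neg_neg, ← sub_eq_add_neg]

end Operators

/-! ### The Stokes formula for the spherical Dirac operators -/

variable {n k : ℕ} {U V : Set (S n)}

theorem exists_cutoff (hU : IsOpen U) {K : Set (S n)} (hK : IsClosed K) (hKU : K ⊆ U) :
    ∃ χ : E (n + 1) → ℝ, ContDiff ℝ 1 χ ∧ (∀ w ∈ K, ∀ᶠ x in 𝓝 (w : E (n + 1)), χ x = 1) ∧
      ∃ L : Set (E (n + 1)), IsClosed L ∧ L ⊆ coneOver U ∧ ∀ x ∉ L, χ x = 0 := by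
  have hK' : IsCompact (((↑) : S n → E (n + 1)) '' K) :=
    hK.isCompact.image continuous_subtype_val
  obtain ⟨L, hL, hKL, hLU⟩ := exists_compact_between hK' (isOpen_coneOver hU) (by
    rintro _ ⟨w, hw, rfl⟩
    exact (coe_mem_coneOver_iff w).2 (hKU hw))
  obtain ⟨χ, h1, h0, -⟩ := exists_contMDiffMap_one_nhds_of_subset_interior (n := 1)
    𝓘(ℝ, E (n + 1)) hK'.isClosed hKL
  refine ⟨χ, χ.contMDiff.contDiff, fun w hw => ?_, L, hL.isClosed, hLU, h0⟩
  exact (eventually_nhdsSet_iff_forall.1 h1) _ (mem_image_of_mem _ hw)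

theorem fderiv_norm_pow_inv (w : S n) (v : E (n + 1)) :
    DifferentiableAt ℝ (fun x : E (n + 1) => (‖x‖ ^ n)⁻¹) w ∧
      fderiv ℝ (fun x : E (n + 1) => (‖x‖ ^ n)⁻¹) w v = -n * inner ℝ (w : E (n + 1)) v := by
  have hw : ‖(w : E (n + 1))‖ = 1 := norm_eq_of_mem_sphere w
  have h1 : HasFDerivAt (fun x : E (n + 1) => ‖x‖) (innerSL ℝ (w : E (n + 1))) w := by
    have h := (hasStrictFDerivAt_norm_sq (w : E (n + 1))).hasFDerivAt.sqrt (by rw [hw]; norm_num)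
    simp only [Real.sqrt_sq (norm_nonneg _), hw] at h
    refine h.congr_fderiv ?_
    rw [← Nat.cast_smul_eq_nsmul ℝ, smul_smul]
    norm_num
  have h2 : HasDerivAt (fun r : ℝ => (r ^ n)⁻¹) (-(n : ℝ)) ‖(w : E (n + 1))‖ := by
    have := (hasDerivAt_pow n (1 : ℝ)).inv (by simp)
    simp only [one_pow, mul_one, div_one] at this
    rw [hw]
    exact this
  have h3 := HasDerivAt.comp_hasFDerivAt (f := fun x : E (n + 1) => ‖x‖) (w : E (n + 1)) h2 h1
  have h4 : HasFDerivAt (fun x : E (n + 1) => (‖x‖ ^ n)⁻¹) _ (w : E (n + 1)) := h3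
  refine ⟨h4.differentiableAt, ?_⟩
  rw [h4.fderiv]
  simp

theorem inner_single_coord (i : Fin (n + 1)) (x : E (n + 1)) :
    inner ℝ (EuclideanSpace.single i (1 : ℝ)) x = x i := by
  simp [EuclideanSpace.inner_single_left]

/-- The Leibniz rule for the spherical Dirac operators. -/
theorem sum_fderiv_mul_e_mul {F G : S n → Cl n} {w : S n}
    (hF : DifferentiableAt ℝ (radialExt n F) (w : E (n + 1)))
    (hG : DifferentiableAt ℝ (radialExt n G) (w : E (n + 1))) :
    ∑ j, fderiv ℝ (fun x : E (n + 1) =>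
        (‖x‖ ^ n)⁻¹ • (radialExt n G x * (e n j * radialExt n F x))) w (EuclideanSpace.single j 1) =
      sphDiracRight n G w * F w + G w * sphDirac n F w := by
  have hw : ‖(w : E (n + 1))‖ = 1 := norm_eq_of_mem_sphere w
  have h1 : ∀ j, fderiv ℝ (fun x : E (n + 1) =>
      (‖x‖ ^ n)⁻¹ • (radialExt n G x * (e n j * radialExt n F x))) w (EuclideanSpace.single j 1) =
      fderiv ℝ (radialExt n G) w (EuclideanSpace.single j 1) * e n j * F w +
        G w * (e n j * fderiv ℝ (radialExt n F) w (EuclideanSpace.single j 1)) -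
        (n : ℝ) • (G w * (((w : E (n + 1)) j • e n j) * F w)) := fun j => by
    have hd := fderiv_norm_pow_inv w (EuclideanSpace.single j 1)
    rw [real_inner_comm, inner_single_coord] at hd
    have hm : DifferentiableAt ℝ (fun x => e n j * radialExt n F x) (w : E (n + 1)) :=
      differentiableAt_mul (differentiableAt_const _) hF
    have h : HasFDerivAt (fun x : E (n + 1) =>
      (‖x‖ ^ n)⁻¹ • (radialExt n G x * (e n j * radialExt n F x))) _ (w : E (n + 1)) :=
      hd.1.hasFDerivAt.smul (differentiableAt_mul hG hm).hasFDerivAt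
    rw [h.fderiv]
    simp only [_root_.add_apply, ContinuousLinearMap.smulRight_apply, hd.2,
      fderiv_mul_apply hG hm, fderiv_const_mul_apply _ hF, radialExt_coe, hw, one_pow,
      inv_one, one_smul, mul_assoc, smul_mul_assoc,
      mul_smul_comm, mul_smul, neg_smul]
    abel
  -- Differentiating `‖x‖⁻ⁿ` produces `-n G w F`, which is shared equally by the two zero-order
  -- terms `-(n/2)` of the left and right operators.
  have h2 : ∑ j, (n : ℝ) • (G w * (((w : E (n + 1)) j • e n j) * F w)) =
      (n : ℝ) • (G w * (vec n w * F w)) := by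
    rw [vec_eq_sum, Finset.sum_mul, Finset.mul_sum, Finset.smul_sum]
  rw [Finset.sum_congr rfl fun j _ => h1 j, sphDirac_eq hF, sphDiracRight_eq hG,
    Finset.sum_sub_distrib, Finset.sum_add_distrib, h2, ← Finset.sum_mul, ← Finset.mul_sum,
    sub_mul, mul_sub, smul_mul_assoc, mul_smul_comm, mul_assoc (G w)]
  module

theorem contDiffOn_norm_pow_inv :
    ContDiffOn ℝ 1 (fun x : E (n + 1) => (‖x‖ ^ n)⁻¹) {0}ᶜ := fun x hx => by
  have hx : x ≠ 0 := hx
  exact (((contDiffAt_norm ℝ hx).pow n).inv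
    (pow_ne_zero _ (norm_ne_zero_iff.2 hx))).contDiffWithinAt

/-- The Stokes formula for the spherical Dirac operators. -/
theorem integral_sphDirac (hn : 1 ≤ n) (hU : IsOpen U) (hV : IsOpen V) (hb : HasC1Boundary n V)
    (hVU : closure V ⊆ U) {F G : S n → Cl n}
    (hF : ContDiffOn ℝ 1 (radialExt n F) (coneOver U))
    (hG : ContDiffOn ℝ 1 (radialExt n G) (coneOver U)) :
    ∫ w in V, (sphDiracRight n G w * F w + G w * sphDirac n F w) ∂areaMeasure n =
      ∫ w in frontier V, G w * (vec n (outerNormal n V w) * F w) ∂hypersurfaceMeasure n := by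
  obtain ⟨χ, hχ, hχ1, L, hL, hLU, hχ0⟩ := exists_cutoff hU isClosed_closure hVU
  let θ : Fin (n + 1) → E (n + 1) → Cl n := fun j x =>
    (‖x‖ ^ n)⁻¹ • (radialExt n G x * (e n j * radialExt n F x))
  -- The cutoff, made constant along rays, extends `θ j` by zero beyond the cone over `U` and keeps
  -- the degree `-n`. It equals 1 near the cone over `closure V`, so neither integral changes.
  let φ : Fin (n + 1) → E (n + 1) → Cl n := fun j x => χ (‖x‖⁻¹ • x) • θ j x
  have hUo := isOpen_coneOver hU
  have hU0 : coneOver U ⊆ {0}ᶜ := fun x hx => hx.1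
  have hφc : ∀ j, ContDiffOn ℝ 1 (φ j) {0}ᶜ := fun j x hx => by
    refine ContDiffAt.contDiffWithinAt ?_
    have hx : x ≠ 0 := hx
    by_cases hxU : x ∈ coneOver U
    · have h1 : ContDiffOn ℝ 1 (φ j) (coneOver U) :=
        (hχ.comp_contDiffOn (contDiffOn_normalize.mono hU0)).smul
          ((contDiffOn_norm_pow_inv.mono hU0).smul
            (contDiffOn_mul hG (contDiffOn_mul contDiffOn_const hF)))
      exact h1.contDiffAt (hUo.mem_nhds hxU)
    · have h2 : ‖x‖⁻¹ • x ∉ L := fun h => hxU <|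
        (smul_mem_coneOver_iff _ (inv_pos.2 (norm_pos_iff.2 hx)) x).1 (hLU h)
      have h3 : ContinuousAt (fun x : E (n + 1) => ‖x‖⁻¹ • x) x :=
        (contDiffOn_normalize (k := 0)).continuousOn.continuousAt
          (isOpen_compl_singleton.mem_nhds hx)
      refine (contDiffAt_const (c := (0 : Cl n))).congr_of_eventuallyEq ?_
      filter_upwards [h3 (hL.isOpen_compl.mem_nhds h2)] with y hy
      simp only [φ]
      rw [hχ0 _ hy, zero_smul]
  have hφh : ∀ j, NegHomogeneous n (φ j) := fun j r hr x => by
    simp only [φ, θ, normalize_smul hr]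
    simp only [radialExt_smul _ hr, norm_smul, Real.norm_eq_abs, abs_of_pos hr, mul_pow, mul_inv,
      mul_smul]
    rw [smul_comm]
  have hχw : ∀ w ∈ closure V, ∀ᶠ x in 𝓝 (w : E (n + 1)), χ (‖x‖⁻¹ • x) = 1 := fun w hw => by
    have h3 : ContinuousAt (fun x : E (n + 1) => ‖x‖⁻¹ • x) (w : E (n + 1)) :=
      (contDiffOn_normalize (k := 0)).continuousOn.continuousAt
        (isOpen_compl_singleton.mem_nhds (ne_zero_of_mem_unit_sphere w))
    have h4 : ‖(w : E (n + 1))‖⁻¹ • (w : E (n + 1)) = w := by rw [norm_eq_of_mem_sphere]; simp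
    rw [ContinuousAt, h4] at h3
    exact h3.eventually (hχ1 w hw)
  have hwU : ∀ w ∈ V, (w : E (n + 1)) ∈ coneOver U := fun w hw =>
    (coe_mem_coneOver_iff w).2 (hVU (subset_closure hw))
  have hA : ∀ w ∈ V, ∑ j, fderiv ℝ (φ j) w (EuclideanSpace.single j 1) =
      sphDiracRight n G w * F w + G w * sphDirac n F w := fun w hw => by
    rw [← sum_fderiv_mul_e_mul
      ((hF.contDiffAt (hUo.mem_nhds (hwU w hw))).differentiableAt one_ne_zero)
      ((hG.contDiffAt (hUo.mem_nhds (hwU w hw))).differentiableAt one_ne_zero)]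
    refine Finset.sum_congr rfl fun j _ => ?_
    have : φ j =ᶠ[𝓝 (w : E (n + 1))] θ j := by
      filter_upwards [hχw w (subset_closure hw)] with x hx
      simp only [φ, hx, one_smul]
    rw [this.fderiv_eq]
  have hB : ∀ w ∈ frontier V,
      ∑ j, inner ℝ (EuclideanSpace.single j (1 : ℝ)) (outerNormal n V w) • φ j w =
        G w * (vec n (outerNormal n V w) * F w) := fun w hw => by
    have h4 : ∀ j, φ j w = G w * (e n j * F w) := fun j => by
      have h5 := (hχw w (frontier_subset_closure hw)).self_of_nhds
      simp only [φ, θ, h5]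
      simp only [radialExt_coe, norm_eq_of_mem_sphere, one_pow, inv_one, one_smul]
    simp only [h4, inner_single_coord, vec_eq_sum, Finset.sum_mul, Finset.mul_sum, smul_mul_assoc,
      mul_smul_comm]
  have hint : ∀ j, IntegrableOn (fun w : S n =>
      inner ℝ (EuclideanSpace.single j (1 : ℝ)) (outerNormal n V w) • φ j w)
      (frontier V) (hypersurfaceMeasure n) := fun j => integrableOn_frontier hn hV hb
    ((continuousOn_const.inner (continuousOn_outerNormal hV hb)).fun_smul
      (continuous_sphere_of_contDiffOn (hφc j)).continuousOn)
  rw [← setIntegral_congr_fun hV.measurableSet hA,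
    ← setIntegral_congr_fun isClosed_frontier.measurableSet hB,
    integral_finsetSum _ fun j _ =>
      (integrable_area (continuous_sphere_fderiv (hφc j) _)).integrableOn,
    integral_finsetSum _ fun j _ => hint j]
  exact Finset.sum_congr rfl fun j _ => integral_fderiv_eq hn hV hb (hφc j) (hφh j) _

/-! ### Splitting and continuity of the Dirac images -/

section Split

variable {f g : S n → E n → Cl n}

/-- `D_s f` is a sum of vectors times derivatives of `f` in the spherical variable, which stay
monogenic in `u`, and of a multiple of `w f`. It thus lies in the domain of the projection, where
`leftProj` does not take its default value. -/
theorem RegularOn.leftSplit_sphDirac (hn : 1 ≤ n) (hU : IsOpen U) (hf : RegularOn U f)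
    (hm : ∀ x ∈ U, f x ∈ leftMonogenic n k) {x : S n} (hx : x ∈ U) :
    LeftSplit n k fun u => sphDirac n (fun y => f y u) x := by
  have hxU := (coe_mem_coneOver_iff x).2 hx
  have h1 : LeftSplit n k fun u => ∑ j, e n j * fderiv ℝ (radialExt n fun y => f y u) x
      (EuclideanSpace.single j 1) := LeftSplit.sum fun j _ =>
    leftSplit_vec_mul hn (EuclideanSpace.single j 1) (hf.fderiv_mem_leftMonogenic hU hm hxU _)
  have h2 := h1.add (leftSplit_vec_mul hn (-((n : ℝ) / 2) • (x : E (n + 1))) (hm x hx))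
  convert h2 using 2 with u
  rw [sphDirac_eq (hf.differentiableAt hU u hxU), map_smul, neg_smul, neg_mul, smul_mul_assoc,
    sub_eq_add_neg]

theorem RegularOn.rightSplit_sphDiracRight (hn : 1 ≤ n) (hU : IsOpen U) (hg : RegularOn U g)
    (hm : ∀ x ∈ U, g x ∈ rightMonogenic n k) {x : S n} (hx : x ∈ U) :
    RightSplit n k fun u => sphDiracRight n (fun y => g y u) x := by
  have hxU := (coe_mem_coneOver_iff x).2 hx
  refine rightSplit_of_revL ?_
  have h1 : LeftSplit n k fun u => ∑ j, e n j * revL n (fderiv ℝ (radialExt n fun y => g y u) x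
      (EuclideanSpace.single j 1)) := LeftSplit.sum fun j _ =>
    leftSplit_vec_mul hn (EuclideanSpace.single j 1)
      (revL_mem_leftMonogenic_iff.2 (hg.fderiv_mem_rightMonogenic hU hm hxU _))
  have h2 := h1.add (leftSplit_vec_mul hn (-((n : ℝ) / 2) • (x : E (n + 1)))
    (revL_mem_leftMonogenic_iff.2 (hm x hx)))
  convert h2 using 2 with u
  rw [sphDiracRight_eq (hg.differentiableAt hU u hxU), map_smul, neg_smul, neg_mul, smul_mul_assoc,
    map_sub, map_smul, revL_mul, revL_vec, map_sum, sub_eq_add_neg]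
  simp only [revL_mul, revL_e]

theorem rightSplit_mul_vec (hn : 1 ≤ n) (v : E (n + 1)) {p : E n → Cl n}
    (hp : p ∈ rightMonogenic n k) : RightSplit n k fun u => p u * vec n v := by
  refine rightSplit_of_revL ?_
  simp only [revL_mul, revL_vec]
  exact leftSplit_vec_mul hn v (revL_mem_leftMonogenic_iff.2 hp)

theorem LeftSplit.continuous {h : E n → Cl n} (hh : LeftSplit n k h) : Continuous h := by
  obtain ⟨p, hp, hr⟩ := hh
  have := hp.1.continuous.add (continuous_of_mem_leftRest hr)
  rwa [add_sub_cancel] at this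

theorem RightSplit.continuous {h : E n → Cl n} (hh : RightSplit n k h) : Continuous h := by
  obtain ⟨p, hp, hr⟩ := hh
  have := hp.1.continuous.add (continuous_of_mem_rightRest hr)
  rwa [add_sub_cancel] at this

theorem RegularOn.continuousOn_sphDirac (hU : IsOpen U) (hf : RegularOn U f) :
    ContinuousOn (fun z : S n × E n => sphDirac n (fun y => f y z.2) z.1) (U ×ˢ univ) := by
  have h : ContinuousOn (fun z : S n × E n =>
      ∑ j, e n j * fderiv ℝ (radialExt n fun y => f y z.2) z.1 (EuclideanSpace.single j 1) -
        ((n : ℝ) / 2) • (vec n z.1 * f z.1 z.2)) (U ×ˢ univ) := by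
    have hv : Continuous fun z : S n × E n => vec n z.1 :=
      (LinearMap.continuous_of_finiteDimensional (vec n)).comp
        (continuous_subtype_val.comp continuous_fst)
    exact (continuousOn_finsetSum _ fun j _ => continuousOn_const.fun_mul
      (hf.continuousOn_fderiv hU _)).fun_sub (continuousOn_const.fun_smul
        (hv.continuousOn.fun_mul hf.continuousOn))
  exact h.congr fun z hz =>
    sphDirac_eq (hf.differentiableAt hU z.2 ((coe_mem_coneOver_iff z.1).2 hz.1))

theorem RegularOn.continuousOn_sphDiracRight (hU : IsOpen U) (hg : RegularOn U g) :
    ContinuousOn (fun z : S n × E n => sphDiracRight n (fun y => g y z.2) z.1) (U ×ˢ univ) := by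
  have h : ContinuousOn (fun z : S n × E n =>
      ∑ j, fderiv ℝ (radialExt n fun y => g y z.2) z.1 (EuclideanSpace.single j 1) * e n j -
        ((n : ℝ) / 2) • (g z.1 z.2 * vec n z.1)) (U ×ˢ univ) := by
    have hv : Continuous fun z : S n × E n => vec n z.1 :=
      (LinearMap.continuous_of_finiteDimensional (vec n)).comp
        (continuous_subtype_val.comp continuous_fst)
    exact (continuousOn_finsetSum _ fun j _ => (hg.continuousOn_fderiv hU _).fun_mul
      continuousOn_const).fun_sub (continuousOn_const.fun_smul
        (hg.continuousOn.fun_mul hv.continuousOn))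
  exact h.congr fun z hz =>
    sphDiracRight_eq (hg.differentiableAt hU z.2 ((coe_mem_coneOver_iff z.1).2 hz.1))

end Split

theorem continuousOn_restrict_sphere {P : S n × E n → Cl n} (hP : ContinuousOn P (U ×ˢ univ))
    {K : Set (S n)} (hK : K ⊆ U) :
    ContinuousOn (fun z : S n × sphere (0 : E n) 1 => P (z.1, (z.2 : E n))) (K ×ˢ univ) := by
  have hc : Continuous fun z : S n × sphere (0 : E n) 1 => (z.1, (z.2 : E n)) := by fun_prop
  exact ContinuousOn.comp (f := fun z : S n × sphere (0 : E n) 1 => (z.1, (z.2 : E n))) hP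
    hc.continuousOn fun z hz => ⟨hK hz.1, mem_univ _⟩

theorem integrable_prod_of_continuousOn {X Y F : Type*} [TopologicalSpace X] [T2Space X]
    [SecondCountableTopology X] [MeasurableSpace X] [BorelSpace X] [TopologicalSpace Y]
    [T2Space Y] [CompactSpace Y] [SecondCountableTopology Y] [MeasurableSpace Y] [BorelSpace Y]
    [NormedAddCommGroup F] {μ : Measure X} {τ : Measure Y} [IsFiniteMeasure τ] {K : Set X}
    (hK : IsCompact K) (hμ : μ K < ⊤) {A : X × Y → F} (hA : ContinuousOn A (K ×ˢ univ)) :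
    Integrable A ((μ.restrict K).prod τ) := by
  have : IsFiniteMeasure (μ.restrict K) := ⟨by rwa [Measure.restrict_apply_univ]⟩
  have h : ((μ.restrict K).prod τ).restrict (K ×ˢ univ) = (μ.restrict K).prod τ := by
    rw [← Measure.prod_restrict, Measure.restrict_restrict hK.isClosed.measurableSet, inter_self,
      Measure.restrict_univ]
  rw [← h]
  exact integrableOn_of_continuousOn_compact (hK.prod isCompact_univ) (measure_lt_top _ _) hA

end RS

end

/-! ### The theorem for the Rarita–Schwinger operators -/

theorem theorem7 (n k : ℕ) (hn : 1 ≤ n) (U V : Set (RS.S n))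
    (hU : IsOpen U) (hV : IsOpen V) (hVU : V ⊆ U) (hbU : frontier V ⊆ U)
    (hbV : RS.HasC1Boundary n V)
    (f g : RS.S n → RS.E n → RS.Cl n)
    (hf : ContMDiffOn ((𝓡 n).prod 𝓘(ℝ, RS.E n)) 𝓘(ℝ, RS.Cl n) 1
      (fun q : RS.S n × RS.E n => f q.1 q.2) (U ×ˢ Set.univ))
    (hg : ContMDiffOn ((𝓡 n).prod 𝓘(ℝ, RS.E n)) 𝓘(ℝ, RS.Cl n) 1
      (fun q : RS.S n × RS.E n => g q.1 q.2) (U ×ˢ Set.univ))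
    (hfM : ∀ x ∈ U, f x ∈ RS.leftMonogenic n k)
    (hgM : ∀ x ∈ U, g x ∈ RS.rightMonogenic n k) :
    IntegrableOn (fun x => RS.pairing n (RS.raritaSchwingerRight n k g x) (f x) +
        RS.pairing n (g x) (RS.raritaSchwinger n k f x)) V (RS.areaMeasure n) ∧
    IntegrableOn (fun x => RS.pairing n (g x)
        (RS.leftProj n k fun u => RS.vec n (RS.outerNormal n V x) * f x u))
      (frontier V) (RS.hypersurfaceMeasure n) ∧
    IntegrableOn (fun x => RS.pairing n
        (RS.rightProj n k fun u => g x u * RS.vec n (RS.outerNormal n V x)) (f x))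
      (frontier V) (RS.hypersurfaceMeasure n) ∧
    (∫ x in V, (RS.pairing n (RS.raritaSchwingerRight n k g x) (f x) +
        RS.pairing n (g x) (RS.raritaSchwinger n k f x)) ∂(RS.areaMeasure n)) =
      ∫ x in frontier V, RS.pairing n (g x)
        (RS.leftProj n k fun u => RS.vec n (RS.outerNormal n V x) * f x u)
        ∂(RS.hypersurfaceMeasure n) ∧
    (∫ x in frontier V, RS.pairing n (g x)
        (RS.leftProj n k fun u => RS.vec n (RS.outerNormal n V x) * f x u)
        ∂(RS.hypersurfaceMeasure n)) =
      ∫ x in frontier V, RS.pairing n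
        (RS.rightProj n k fun u => g x u * RS.vec n (RS.outerNormal n V x)) (f x)
        ∂(RS.hypersurfaceMeasure n) := by
  have hfr : RS.RegularOn U f := RS.contDiffOn_radialExt hU hf
  have hgr : RS.RegularOn U g := RS.contDiffOn_radialExt hU hg
  -- Everything is continuous on the compact set `closure V` times the unit sphere of `ℝⁿ`; this
  -- supplies the integrability and Fubini.
  have hcU : closure V ⊆ U := by
    rw [closure_eq_self_union_frontier]; exact Set.union_subset hVU hbU
  have hfin := RS.hypersurfaceMeasure_frontier_lt_top hn hV hbV
  have : IsFiniteMeasure (RS.areaMeasure n) := by unfold RS.areaMeasure; infer_instance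
  have : IsFiniteMeasure ((RS.hypersurfaceMeasure n).restrict (frontier V)) :=
    ⟨by rwa [Measure.restrict_apply_univ]⟩
  let τ : Measure (Metric.sphere (0 : RS.E n) 1) := (volume : Measure (RS.E n)).toSphere
  -- `A` and `B` are the integrands before projection. Orthogonality identifies all the pairings
  -- with their integrals over `u`, and `B` is common to the two boundary pairings.
  let A : RS.S n × Metric.sphere (0 : RS.E n) 1 → RS.Cl n := fun z =>
    RS.sphDiracRight n (fun y => g y z.2) z.1 * f z.1 z.2 +
      g z.1 z.2 * RS.sphDirac n (fun y => f y z.2) z.1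
  let B : RS.S n × Metric.sphere (0 : RS.E n) 1 → RS.Cl n := fun z =>
    g z.1 z.2 * (RS.vec n (RS.outerNormal n V z.1) * f z.1 z.2)
  have eA : ∀ x ∈ V, RS.pairing n (RS.raritaSchwingerRight n k g x) (f x) +
      RS.pairing n (g x) (RS.raritaSchwinger n k f x) = ∫ u, A (x, u) ∂τ := fun x hx => by
    have hr := hgr.rightSplit_sphDiracRight hn hU hgM (hVU hx)
    have hl := hfr.leftSplit_sphDirac hn hU hfM (hVU hx)
    rw [RS.raritaSchwingerRight, RS.raritaSchwinger, RS.pairing_rightProj hn (hfM x (hVU hx)) hr,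
      RS.pairing_leftProj hn (hgM x (hVU hx)) hl, RS.pairing, RS.pairing,
      ← integral_add (RS.integrable_pairing hr.continuous (hfM x (hVU hx)).1.continuous)
        (RS.integrable_pairing (hgM x (hVU hx)).1.continuous hl.continuous)]
  have eB : ∀ x ∈ frontier V, RS.pairing n (g x)
      (RS.leftProj n k fun u => RS.vec n (RS.outerNormal n V x) * f x u) = ∫ u, B (x, u) ∂τ :=
    fun x hx => by
      rw [RS.pairing_leftProj hn (hgM x (hbU hx)) (RS.leftSplit_vec_mul hn _ (hfM x (hbU hx))),
        RS.pairing]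
  have eC : ∀ x ∈ frontier V, RS.pairing n
      (RS.rightProj n k fun u => g x u * RS.vec n (RS.outerNormal n V x)) (f x) =
      ∫ u, B (x, u) ∂τ := fun x hx => by
    rw [RS.pairing_rightProj hn (hfM x (hbU hx)) (RS.rightSplit_mul_vec hn _ (hgM x (hbU hx))),
      RS.pairing]
    simp only [mul_assoc, B, τ]
  have hA' : ContinuousOn (fun z : RS.S n × RS.E n =>
      RS.sphDiracRight n (fun y => g y z.2) z.1 * f z.1 z.2 +
        g z.1 z.2 * RS.sphDirac n (fun y => f y z.2) z.1) (U ×ˢ Set.univ) :=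
    ((hgr.continuousOn_sphDiracRight hU).fun_mul hfr.continuousOn).fun_add
      (hgr.continuousOn.fun_mul (hfr.continuousOn_sphDirac hU))
  have hAc : ContinuousOn A (closure V ×ˢ Set.univ) :=
    RS.continuousOn_restrict_sphere hA' hcU
  have hfc : ContinuousOn (fun z : RS.S n × Metric.sphere (0 : RS.E n) 1 => f z.1 z.2)
      (frontier V ×ˢ Set.univ) := RS.continuousOn_restrict_sphere hfr.continuousOn hbU
  have hgc : ContinuousOn (fun z : RS.S n × Metric.sphere (0 : RS.E n) 1 => g z.1 z.2)
      (frontier V ×ˢ Set.univ) := RS.continuousOn_restrict_sphere hgr.continuousOn hbU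
  have hν : ContinuousOn (fun z : RS.S n × Metric.sphere (0 : RS.E n) 1 =>
      RS.vec n (RS.outerNormal n V z.1)) (frontier V ×ˢ Set.univ) :=
    (LinearMap.continuous_of_finiteDimensional (RS.vec n)).comp_continuousOn
      ((RS.continuousOn_outerNormal hV hbV).comp continuousOn_fst fun z hz => hz.1)
  have hBc : ContinuousOn B (frontier V ×ˢ Set.univ) := hgc.fun_mul (hν.fun_mul hfc)
  have hAi : Integrable A (((RS.areaMeasure n).restrict V).prod τ) :=
    (RS.integrable_prod_of_continuousOn isClosed_closure.isCompact (measure_lt_top _ _)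
      hAc).mono_measure (Measure.prod_mono (Measure.restrict_mono subset_closure le_rfl) le_rfl)
  have hBi : Integrable B (((RS.hypersurfaceMeasure n).restrict (frontier V)).prod τ) :=
    RS.integrable_prod_of_continuousOn isClosed_frontier.isCompact hfin hBc
  have hmF : MeasurableSet (frontier V) := isClosed_frontier.measurableSet
  refine ⟨IntegrableOn.congr_fun hAi.integral_prod_left (fun x hx => (eA x hx).symm)
      hV.measurableSet,
    IntegrableOn.congr_fun hBi.integral_prod_left (fun x hx => (eB x hx).symm) hmF,
    IntegrableOn.congr_fun hBi.integral_prod_left (fun x hx => (eC x hx).symm) hmF, ?_, ?_⟩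
  -- For fixed `u` this is the Stokes formula; exchanging the order of integration on both sides
  -- then gives the claim.
  · have hS : ∀ u : Metric.sphere (0 : RS.E n) 1, ∫ x in V, A (x, u) ∂(RS.areaMeasure n) =
        ∫ x in frontier V, B (x, u) ∂(RS.hypersurfaceMeasure n) := fun u =>
      RS.integral_sphDirac (F := fun y => f y u) (G := fun y => g y u) hn hU hV hbV hcU
        (hfr.contDiffOn u) (hgr.contDiffOn u)
    have hA2 := integral_integral_swap (f := fun x u => A (x, u)) hAi
    have hB2 := integral_integral_swap (f := fun x u => B (x, u)) hBi
    rw [setIntegral_congr_fun hV.measurableSet eA, setIntegral_congr_fun hmF eB, hA2, hB2]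
    simp only [hS]
  · rw [setIntegral_congr_fun hmF eB, setIntegral_congr_fun hmF eC]
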